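/- Let $\mathbf k$ be an algebraically closed field of characteristic $0$ and let $Y$ be a reduced scheme locally of finite type over $\mathbf k$ (for instance a smooth quasi-projective variety). Let $E=\bigoplus_{n\ge 0}E^{-n}$ be a graded $\mathcal O_Y$-module, with each $E^{-n}$ (placed in degree $-n$) locally free of finite rank; if $Y$ has isolated points, assume that at each of them only finitely many of the $E^{-n}$ are nonzero. Let $Q$ be an $\mathcal O_Y$-linear derivation of degree $1$ with $Q^2=0$ of the graded symmetric algebra $S_{\mathcal O_Y}(E[1])$ (so that $E^{-n}$ sits in degree $-n-1$ there). Let $\widetilde X$ be the dg-scheme $(Y,\mathcal A)$ over $Y$, with $\mathcal A=\mathcal O_{\widetilde X}:=(S_{\mathcal O_Y}(E[1]),Q)$; for instance $\mathcal A$ may be a resolution of $\mathcal O_X$ for a closed embedding $X\hookrightarrow Y$. The dg-scheme $\widetilde X\times_Y\widetilde X$ is $Y$ with the structure sheaf $\mathcal A\otimes_{\mathcal O_Y}\mathcal A$. Let $\mathcal J$ be the kernel of the multiplication map $\mathcal A\otimes_{\mathcal O_Y}\mathcal A\to\mathcal A$, and put $$\mathcal O_\Delta^{(k)}:=(\mathcal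 A\otimes_{\mathcal O_Y}\mathcal A)/\mathcal J^{k+1},\qquad \mathcal O_\Delta^{(\infty)}:=\varprojlim_k\mathcal O_\Delta^{(k)},$$ the limit being taken in graded sheaves. Let $T_{\widetilde X/Y}$ be the dg-Lie algebroid over $\mathcal A$ of graded $\mathcal O_Y$-linear derivations of $\mathcal A$, with the graded commutator bracket and the differential $[Q,-]$. Its universal enveloping algebra $\mathbf U(T_{\widetilde X/Y})$ is the quotient of the augmentation ideal of the enveloping algebra of the graded Lie algebra $\mathcal A\rtimes T_{\widetilde X/Y}$ by the relations $a\,x=a\cdot x$ for $a\in\mathcal A$ and $x\in\mathcal A\oplus T_{\widetilde X/Y}$. It acts on $\mathcal A$, and it has a coproduct $\mathbf U\to\mathbf U\otimes_{\mathcal A}\mathbf U$ (tensor product of left $\mathcal A$-modules) for which derivations are primitive. The jet algebra is the graded sheaf of left $\mathcal A$-linear maps $$\mathbf J(T_{\widetilde X/Y}):=\underline{\mathrm{Hom}}_{\mathcal A}\big(\mathbf U(T_{\widetilde X/Y}),\mathcal A\big),$$ with the product induced by the coproduct of $\mathbf U$, the differential $(d\varphi)(P)=Q(\varphi(P))-(-1)^{|\varphi|}\varphi(dP)$,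 and the morphism of dg-algebras $$\mathcal A\otimes_{\mathcal O_Y}\mathcal A\to\mathbf J(T_{\widetilde X/Y}),\qquad a\otimes a'\mapsto\big(P\mapsto(-1)^{|P||a'|}\,a\,P(a')\big).$$ Then there is an isomorphism of sheaves of dg-algebras on $Y$ $$\mathcal O_\Delta^{(\infty)}\;\cong\;\mathbf J(T_{\widetilde X/Y})$$ which is an isomorphism of $\mathcal O_{\widetilde X\times_Y\widetilde X}=\mathcal A\otimes_{\mathcal O_Y}\mathcal A$-algebras: it carries the image of $a\otimes a'$ in $\mathcal O_\Delta^{(\infty)}$ to its image in $\mathbf J(T_{\widetilde X/Y})$ for all local sections $a,a'$ of $\mathcal A$. -/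

import Mathlib

universe u
open scoped TensorProduct DirectSum

namespace DGJet

section GSym
variable (R : Type u) [CommRing R] (M : ℕ → Type u) [∀ n, AddCommGroup (M n)] [∀ n, Module R (M n)]

/-- The degree, in `E[1]`, of the summand `M n` of `E` that sits in degree `-n`. -/
def genDeg (n : ℕ) : ℤ := -((n : ℤ) + 1)

/-- The relations of the graded symmetric algebra: linearity and graded commutativity. -/
inductive GSymRel : FreeAlgebra R (Σ n, M n) → FreeAlgebra R (Σ n, M n) → Prop
  | add (n : ℕ) (x y : M n) :
      GSymRel (FreeAlgebra.ι R ⟨n, x + y⟩) (FreeAlgebra.ι R ⟨n, x⟩ + FreeAlgebra.ι R ⟨n, y⟩)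
  | smul (n : ℕ) (r : R) (x : M n) :
      GSymRel (FreeAlgebra.ι R ⟨n, r • x⟩) (r • FreeAlgebra.ι R ⟨n, x⟩)
  | comm (m n : ℕ) (x : M m) (y : M n) :
      GSymRel (FreeAlgebra.ι R ⟨m, x⟩ * FreeAlgebra.ι R ⟨n, y⟩)
        ((genDeg m * genDeg n).negOnePow • (FreeAlgebra.ι R ⟨n, y⟩ * FreeAlgebra.ι R ⟨m, x⟩))

/-- The graded symmetric algebra `S_R(E[1])` of the graded module `E = ⨁ₙ M n`, with `M n` in
degree `-n`. (When `2` is invertible, odd elements square to zero.) -/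
def GSym : Type u := RingQuot (GSymRel R M)

noncomputable instance : Ring (GSym R M) := inferInstanceAs (Ring (RingQuot (GSymRel R M)))
noncomputable instance : Algebra R (GSym R M) :=
  inferInstanceAs (Algebra R (RingQuot (GSymRel R M)))

variable {M} in
/-- The generator of `S_R(E[1])` given by an element of `M n`. -/
noncomputable def GSym.gen (p : Σ n, M n) : GSym R M :=
  RingQuot.mkAlgHom R (GSymRel R M) (FreeAlgebra.ι R p)

lemma GSym.gen_add (n : ℕ) (x y : M n) : GSym.gen R ⟨n, x + y⟩ = GSym.gen R ⟨n, x⟩ + GSym.gen R ⟨n, y⟩ := by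
  have := RingQuot.mkAlgHom_rel R (GSymRel.add (R := R) n x y)
  rw [map_add] at this
  exact this

lemma GSym.gen_smul (n : ℕ) (r : R) (x : M n) : GSym.gen R ⟨n, r • x⟩ = r • GSym.gen R ⟨n, x⟩ := by
  have := RingQuot.mkAlgHom_rel R (GSymRel.smul (R := R) n r x)
  rw [map_smul] at this
  exact this

lemma GSym.gen_comm (p q : Σ n, M n) : GSym.gen R p * GSym.gen R q =
    (genDeg p.1 * genDeg q.1).negOnePow • (GSym.gen R q * GSym.gen R p) := by
  have := RingQuot.mkAlgHom_rel R (GSymRel.comm (R := R) p.1 q.1 p.2 q.2)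
  rw [Units.smul_def, map_zsmul, map_mul, map_mul] at this
  rw [Units.smul_def]
  exact this

/-- The degree `d` part of `S_R(E[1])`, spanned by the products of generators of total degree
`d`. -/
noncomputable def GSym.gr (d : ℤ) : Submodule R (GSym R M) :=
  Submodule.span R {x | ∃ l : List (Σ n, M n),
    (l.map fun p => genDeg p.1).sum = d ∧ (l.map (GSym.gen R)).prod = x}

lemma GSym.prod_mem (l : List (Σ n, M n)) :
    (l.map (GSym.gen R)).prod ∈ GSym.gr R M (l.map fun p => genDeg p.1).sum :=
  Submodule.subset_span ⟨l, rfl, rfl⟩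

lemma GSym.gen_mem (p : Σ n, M n) : GSym.gen R p ∈ GSym.gr R M (genDeg p.1) := by
  simpa using GSym.prod_mem R M [p]

noncomputable instance : SetLike.GradedMonoid (GSym.gr R M) where
  one_mem := Submodule.subset_span ⟨[], by simp, by simp⟩
  mul_mem i j a b ha hb := by
    have h : GSym.gr R M i * GSym.gr R M j ≤ GSym.gr R M (i + j) := by
      rw [GSym.gr, GSym.gr, Submodule.span_mul_span, Submodule.span_le]
      rintro _ ⟨_, ⟨l, rfl, rfl⟩, _, ⟨l', rfl, rfl⟩, rfl⟩
      exact Submodule.subset_span ⟨l ++ l', by simp, by simp⟩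
    exact h (Submodule.mul_mem_mul ha hb)

variable {R M} in
lemma GSym.algHom_ext {S : Type*} [Ring S] [Algebra R S] {f g : GSym R M →ₐ[R] S}
    (h : ∀ p, f (GSym.gen R p) = g (GSym.gen R p)) : f = g :=
  RingQuot.ringQuot_ext' _ f g (FreeAlgebra.hom_ext (funext h))

/-- The universal property of `S_R(E[1])`. -/
noncomputable def GSym.lift {S : Type*} [Ring S] [Algebra R S] (f : ∀ n, M n →ₗ[R] S)
    (hf : ∀ m n (x : M m) (y : M n), f m x * f n y =
      (genDeg m * genDeg n).negOnePow • (f n y * f m x)) : GSym R M →ₐ[R] S :=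
  RingQuot.liftAlgHom R ⟨FreeAlgebra.lift R fun p => f p.1 p.2, by
    intro a b h
    induction h with
    | add n x y => simp
    | smul n r x => simp
    | comm m n x y =>
      rw [Units.smul_def, map_zsmul, map_mul, map_mul]
      simpa [Units.smul_def] using hf m n x y⟩

@[simp] lemma GSym.lift_gen {S : Type*} [Ring S] [Algebra R S] (f : ∀ n, M n →ₗ[R] S) (hf)
    (p : Σ n, M n) : GSym.lift R M f hf (GSym.gen R p) = f p.1 p.2 := by
  have h := RingQuot.liftAlgHom_mkAlgHom_apply R (FreeAlgebra.lift R fun p : (Σ n, M n) => f p.1 p.2)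
    (s := GSymRel R M) (by
    intro a b h
    induction h with
    | add n x y => simp
    | smul n r x => simp
    | comm m n x y =>
      rw [Units.smul_def, map_zsmul, map_mul, map_mul]
      simpa [Units.smul_def] using hf m n x y) (FreeAlgebra.ι R p)
  rw [FreeAlgebra.lift_ι_apply] at h
  exact h

lemma GSym.of_congr {i j : ℤ} (h : i = j) (x : GSym.gr R M i) (y : GSym.gr R M j)
    (hxy : (x : GSym R M) = y) :
    DirectSum.of (fun i => GSym.gr R M i) i x = DirectSum.of (fun i => GSym.gr R M i) j y := by
  subst h
  congr 1
  exact Subtype.ext hxy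

/-- The decomposition of an element of `S_R(E[1])` into homogeneous parts. -/
noncomputable def GSym.decomp : GSym R M →ₐ[R] ⨁ i, GSym.gr R M i :=
  GSym.lift R M (fun n =>
    { toFun x := DirectSum.of (fun i => GSym.gr R M i) (genDeg n)
        ⟨GSym.gen R ⟨n, x⟩, GSym.gen_mem R M ⟨n, x⟩⟩
      map_add' x y := by
        rw [← map_add]
        exact congrArg _ (Subtype.ext (GSym.gen_add R M n x y))
      map_smul' r x := by
        rw [RingHom.id_apply, ← DirectSum.of_smul]
        exact congrArg _ (Subtype.ext (GSym.gen_smul R M n r x)) })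
    (by
      intro m n x y
      simp only [LinearMap.coe_mk, AddHom.coe_mk, DirectSum.of_mul_of]
      rw [Units.smul_def]
      refine Eq.trans ?_ (map_zsmul (DirectSum.of (fun i => GSym.gr R M i) _) _ _)
      refine GSym.of_congr R M (add_comm _ _) _ _ ?_
      simpa [Units.smul_def] using GSym.gen_comm R M ⟨m, x⟩ ⟨n, y⟩)

lemma GSym.decomp_prod (l : List (Σ n, M n)) : GSym.decomp R M (l.map (GSym.gen R)).prod =
    DirectSum.of (fun i => GSym.gr R M i) _ ⟨_, GSym.prod_mem R M l⟩ := by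
  induction l with
  | nil =>
    simp only [List.map_nil, List.prod_nil, map_one]
    rfl
  | cons p l ih =>
    simp only [List.map_cons, List.prod_cons, map_mul, ih]
    rw [GSym.decomp, GSym.lift_gen]
    simp only [LinearMap.coe_mk, AddHom.coe_mk, DirectSum.of_mul_of]
    exact GSym.of_congr R M (by simp) _ _ (by simp)

noncomputable instance : GradedAlgebra (GSym.gr R M) :=
  GradedAlgebra.ofAlgHom _ (GSym.decomp R M)
    (GSym.algHom_ext fun p => by simp [GSym.decomp])
    (by
      rintro i ⟨x, hx⟩
      simp only
      induction hx using Submodule.span_induction with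
      | mem x h =>
        obtain ⟨l, rfl, rfl⟩ := h
        exact GSym.decomp_prod R M l
      | zero =>
        rw [map_zero]
        exact (map_zero (DirectSum.of (fun i => GSym.gr R M i) i)).symm
      | add x y hx hy h1 h2 =>
        rw [map_add, h1, h2, ← map_add]
        rfl
      | smul r x hx h =>
        rw [map_smul, h, ← DirectSum.of_smul]
        rfl)

lemma GSym.prod_comm_gen (p : Σ n, M n) (l : List (Σ n, M n)) :
    GSym.gen R p * (l.map (GSym.gen R)).prod =
      (genDeg p.1 * (l.map fun p => genDeg p.1).sum).negOnePow •
        ((l.map (GSym.gen R)).prod * GSym.gen R p) := by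
  induction l with
  | nil => simp
  | cons q l ih =>
    simp only [List.map_cons, List.prod_cons, List.sum_cons]
    rw [← mul_assoc, GSym.gen_comm, smul_mul_assoc, mul_assoc, ih, mul_smul_comm, smul_smul,
      ← Int.negOnePow_add, ← mul_add, mul_assoc]

lemma GSym.graded_comm {i j : ℤ} {a b : GSym R M} (ha : a ∈ GSym.gr R M i)
    (hb : b ∈ GSym.gr R M j) : a * b = (i * j).negOnePow • (b * a) := by
  induction ha using Submodule.span_induction with
  | mem x h =>
    obtain ⟨l, rfl, rfl⟩ := h
    induction hb using Submodule.span_induction with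
    | mem y h' =>
      obtain ⟨l', rfl, rfl⟩ := h'
      induction l with
      | nil => simp
      | cons p l ih =>
        simp only [List.map_cons, List.prod_cons, List.sum_cons]
        rw [mul_assoc, ih, mul_smul_comm, ← mul_assoc, GSym.prod_comm_gen, smul_mul_assoc,
          smul_smul, ← Int.negOnePow_add, mul_assoc]
        congr 2
        ring
    | zero => simp
    | add x y hx hy h1 h2 => rw [mul_add, add_mul, h1, h2, smul_add]
    | smul r x hx h => rw [mul_smul_comm, smul_mul_assoc, h, smul_comm]
  | zero => simp
  | add x y hx hy h1 h2 => rw [mul_add, add_mul, h1, h2, smul_add]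
  | smul r x hx h => rw [mul_smul_comm, smul_mul_assoc, h, smul_comm]

variable {R M} {R' : Type u} [CommRing R'] {M₁ : ℕ → Type u} [∀ n, AddCommGroup (M₁ n)]
  [∀ n, Module R' (M₁ n)]
variable (σ : R →+* R') (f : ∀ n, M n →ₛₗ[σ] M₁ n)

/-- Functoriality of `S_R(E[1])` in the pair `(R, E)`. -/
noncomputable def GSym.map : GSym R M →+* GSym R' M₁ :=
  letI : Algebra R (GSym R' M₁) := Algebra.compHom _ σ
  (GSym.lift R M (fun n =>
    { toFun x := GSym.gen R' ⟨n, f n x⟩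
      map_add' x y := by rw [map_add, GSym.gen_add]
      map_smul' r x := by
        rw [map_smulₛₗ, GSym.gen_smul]
        rfl })
    (fun m n x y => GSym.gen_comm R' M₁ ⟨m, f m x⟩ ⟨n, f n y⟩)).toRingHom

@[simp] lemma GSym.map_gen (p : Σ n, M n) :
    GSym.map σ f (GSym.gen R p) = GSym.gen R' ⟨p.1, f p.1 p.2⟩ := by
  let _ : Algebra R (GSym R' M₁) := Algebra.compHom _ σ
  exact GSym.lift_gen R M _ _ p

@[simp] lemma GSym.map_algebraMap (r : R) :
    GSym.map σ f (algebraMap R _ r) = algebraMap R' _ (σ r) := by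
  let _ : Algebra R (GSym R' M₁) := Algebra.compHom _ σ
  exact AlgHom.commutes _ r

lemma GSym.map_smul (r : R) (x : GSym R M) :
    GSym.map σ f (r • x) = σ r • GSym.map σ f x := by
  rw [Algebra.smul_def, map_mul, GSym.map_algebraMap, ← Algebra.smul_def]

lemma GSym.map_mem {d : ℤ} {x : GSym R M}
    (hx : x ∈ GSym.gr R M d) : GSym.map σ f x ∈ GSym.gr R' M₁ d := by
  induction hx using Submodule.span_induction with
  | mem x h =>
    obtain ⟨l, rfl, rfl⟩ := h
    refine Submodule.subset_span ⟨l.map fun p => ⟨p.1, f p.1 p.2⟩, ?_, ?_⟩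
    · simp [Function.comp_def]
    · rw [map_list_prod, List.map_map, List.map_map]
      congr 1
      exact List.map_congr_left fun p _ => (GSym.map_gen σ f p).symm
  | zero => simp
  | add x y hx hy h1 h2 => rw [map_add]; exact add_mem h1 h2
  | smul r x hx h => rw [GSym.map_smul]; exact Submodule.smul_mem _ _ h

end GSym

section Square

lemma map_sign {G H F : Type*} [AddCommGroup G] [AddCommGroup H] [FunLike F G H]
    [AddMonoidHomClass F G H] (f : F) (c : ℤˣ) (x : G) : f (c • x) = c • f x := by
  rw [Units.smul_def, map_zsmul, ← Units.smul_def]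

variable {R A : Type u} [CommRing R] [Ring A] [Algebra R A] (𝒜 : ℤ → Submodule R A)

/-- Graded commutativity: `ab = (-1)^{|a||b|} ba`. -/
def IsGradedComm : Prop :=
  ∀ ⦃i j : ℤ⦄ ⦃a b : A⦄, a ∈ 𝒜 i → b ∈ 𝒜 j → a * b = (i * j).negOnePow • (b * a)

variable [GradedAlgebra 𝒜]

/-- The parity operator `a ↦ (-1)^{|a|} a`. -/
noncomputable def parity : A →ₗ[R] A :=
  (DirectSum.toModule R ℤ A fun i => i.negOnePow • (𝒜 i).subtype) ∘ₗ
    (DirectSum.decomposeLinearEquiv 𝒜).toLinearMap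

lemma parity_of_mem {i : ℤ} {a : A} (ha : a ∈ 𝒜 i) : parity 𝒜 a = i.negOnePow • a := by
  lift a to 𝒜 i using ha
  rw [parity, LinearMap.comp_apply, LinearEquiv.coe_coe, DirectSum.decomposeLinearEquiv_apply,
    DirectSum.decompose_coe, ← DirectSum.lof_eq_of R, DirectSum.toModule_lof]
  rfl

/-- The graded tensor square `A ⊗_R A`, with
`(a ⊗ b)(a' ⊗ b') = (-1)^{|b||a'|} aa' ⊗ bb'`. -/
def Square : Type u := GradedTensorProduct R 𝒜 𝒜

namespace Square

noncomputable instance : Ring (Square 𝒜) := inferInstanceAs (Ring (GradedTensorProduct R 𝒜 𝒜))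
noncomputable instance : Algebra R (Square 𝒜) :=
  inferInstanceAs (Algebra R (GradedTensorProduct R 𝒜 𝒜))

/-- The underlying additive group of `A ⊗_R A` is the usual tensor product. -/
noncomputable def ofTensor : TensorProduct R A A ≃+ Square 𝒜 :=
  { (GradedTensorProduct.of R 𝒜 𝒜).toAddEquiv with
    map_add' := fun _ _ => rfl }

/-- The pure tensor `a ⊗ b`. -/
noncomputable def tmul (a b : A) : Square 𝒜 := ofTensor 𝒜 (a ⊗ₜ[R] b)

lemma add_tmul (a a' b : A) : tmul 𝒜 (a + a') b = tmul 𝒜 a b + tmul 𝒜 a' b := by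
  rw [tmul, TensorProduct.add_tmul, map_add]; rfl

lemma tmul_add (a b b' : A) : tmul 𝒜 a (b + b') = tmul 𝒜 a b + tmul 𝒜 a b' := by
  rw [tmul, TensorProduct.tmul_add, map_add]; rfl

lemma neg_tmul (a b : A) : tmul 𝒜 (-a) b = -tmul 𝒜 a b := by
  rw [tmul, TensorProduct.neg_tmul, map_neg]; rfl

lemma tmul_neg (a b : A) : tmul 𝒜 a (-b) = -tmul 𝒜 a b := by
  rw [tmul, TensorProduct.tmul_neg, map_neg]; rfl

lemma sign_tmul (c : ℤˣ) (a b : A) : tmul 𝒜 (c • a) b = c • tmul 𝒜 a b := by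
  rcases Int.units_eq_one_or c with rfl | rfl
  · rw [one_smul, one_smul]
  · rw [Units.neg_smul, Units.neg_smul, one_smul, one_smul, neg_tmul]

lemma tmul_sign (c : ℤˣ) (a b : A) : tmul 𝒜 a (c • b) = c • tmul 𝒜 a b := by
  rcases Int.units_eq_one_or c with rfl | rfl
  · rw [one_smul, one_smul]
  · rw [Units.neg_smul, Units.neg_smul, one_smul, one_smul, tmul_neg]

lemma tmul_mul {j i : ℤ} (a : A) {b a' : A} (b' : A) (hb : b ∈ 𝒜 j) (ha' : a' ∈ 𝒜 i) :
    tmul 𝒜 a b * tmul 𝒜 a' b' = (j * i).negOnePow • tmul 𝒜 (a * a') (b * b') := by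
  refine (GradedTensorProduct.tmul_coe_mul_coe_tmul 𝒜 𝒜 a ⟨b, hb⟩ ⟨a', ha'⟩ b').trans ?_
  change (j * i).negOnePow • _ = _
  rcases Int.units_eq_one_or (j * i).negOnePow with h | h <;> rw [h]
  · rw [one_smul, one_smul]; rfl
  · rw [Units.neg_smul, Units.neg_smul, one_smul, one_smul]; rfl

lemma tmul_one_mul_one_tmul (a b : A) : tmul 𝒜 a 1 * tmul 𝒜 1 b = tmul 𝒜 a b :=
  GradedTensorProduct.tmul_one_mul_one_tmul 𝒜 𝒜 a b

variable {𝒜} in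
/-- Induction over homogeneous pure tensors. -/
lemma induction {P : Square 𝒜 → Prop} (h0 : P 0) (hadd : ∀ x y, P x → P y → P (x + y))
    (ht : ∀ i j (a b : A), a ∈ 𝒜 i → b ∈ 𝒜 j → P (tmul 𝒜 a b)) (x : Square 𝒜) : P x := by
  have h0' : P (ofTensor 𝒜 0) := by rwa [map_zero]
  obtain ⟨y, rfl⟩ := (ofTensor 𝒜).surjective x
  induction y using TensorProduct.induction_on with
  | zero => exact h0'
  | add y z h1 h2 => rw [map_add]; exact hadd _ _ h1 h2
  | tmul a b =>
    induction a using DirectSum.Decomposition.inductionOn 𝒜 with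
    | zero => rw [TensorProduct.zero_tmul]; exact h0'
    | add a a' h1 h2 => rw [TensorProduct.add_tmul, map_add]; exact hadd _ _ h1 h2
    | homogeneous a =>
      induction b using DirectSum.Decomposition.inductionOn 𝒜 with
      | zero => rw [TensorProduct.tmul_zero]; exact h0'
      | add a a' h1 h2 => rw [TensorProduct.tmul_add, map_add]; exact hadd _ _ h1 h2
      | homogeneous b => exact ht _ _ _ _ a.2 b.2

/-- The degree `n` part of `A ⊗_R A`. -/
noncomputable def gr (n : ℤ) : AddSubgroup (Square 𝒜) :=
  AddSubgroup.closure {x | ∃ i j : ℤ, i + j = n ∧ ∃ a ∈ 𝒜 i, ∃ b ∈ 𝒜 j, tmul 𝒜 a b = x}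

lemma tmul_mem {i j : ℤ} {a b : A} (ha : a ∈ 𝒜 i) (hb : b ∈ 𝒜 j) :
    (tmul 𝒜 a b : Square 𝒜) ∈ gr 𝒜 (i + j) :=
  AddSubgroup.subset_closure ⟨i, j, rfl, a, ha, b, hb, rfl⟩

lemma sign_smul_mem {n : ℤ} (c : ℤˣ) {x : Square 𝒜} (hx : x ∈ gr 𝒜 n) : c • x ∈ gr 𝒜 n := by
  rcases Int.units_eq_one_or c with rfl | rfl
  · rwa [one_smul]
  · rw [Units.neg_smul, one_smul]; exact neg_mem hx

lemma mul_mem {m n : ℤ} {x y : Square 𝒜} (hx : x ∈ gr 𝒜 m) (hy : y ∈ gr 𝒜 n) :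
    x * y ∈ gr 𝒜 (m + n) := by
  induction hx using AddSubgroup.closure_induction with
  | mem x h =>
    obtain ⟨i, j, rfl, a, ha, b, hb, rfl⟩ := h
    induction hy using AddSubgroup.closure_induction with
    | mem y h =>
      obtain ⟨i', j', rfl, a', ha', b', hb', rfl⟩ := h
      rw [tmul_mul 𝒜 a b' hb ha']
      refine sign_smul_mem _ _ ?_
      convert tmul_mem 𝒜 (SetLike.mul_mem_graded ha ha') (SetLike.mul_mem_graded hb hb') using 1
      ring_nf
    | zero => rw [mul_zero]; exact zero_mem _
    | add x y hx hy h1 h2 => rw [mul_add]; exact add_mem h1 h2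
    | neg x hx h => rw [mul_neg]; exact neg_mem h
  | zero => rw [zero_mul]; exact zero_mem _
  | add x y hx hy h1 h2 => rw [add_mul]; exact add_mem h1 h2
  | neg x hx h => rw [neg_mul]; exact neg_mem h

/-- The differential `d ⊗ 1 + (-1)^{|·|} ⊗ d` of `A ⊗_R A`. -/
noncomputable def diff (d : A →ₗ[R] A) : Square 𝒜 →+ Square 𝒜 :=
  (ofTensor 𝒜).toAddMonoidHom.comp
    ((TensorProduct.map d LinearMap.id + TensorProduct.map (parity 𝒜) d).toAddMonoidHom.comp
      (ofTensor 𝒜).symm.toAddMonoidHom)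

/-- The parity operator of `A ⊗_R A`. -/
noncomputable def par : Square 𝒜 →+ Square 𝒜 :=
  (ofTensor 𝒜).toAddMonoidHom.comp
    ((TensorProduct.map (parity 𝒜) (parity 𝒜)).toAddMonoidHom.comp
      (ofTensor 𝒜).symm.toAddMonoidHom)

lemma diff_tmul (d : A →ₗ[R] A) {i : ℤ} {a : A} (b : A) (ha : a ∈ 𝒜 i) :
    diff 𝒜 d (tmul 𝒜 a b) = tmul 𝒜 (d a) b + i.negOnePow • tmul 𝒜 a (d b) := by
  rw [← sign_tmul, ← parity_of_mem 𝒜 ha]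
  rfl

lemma par_tmul {i j : ℤ} {a b : A} (ha : a ∈ 𝒜 i) (hb : b ∈ 𝒜 j) :
    par 𝒜 (tmul 𝒜 a b) = (i + j).negOnePow • tmul 𝒜 a b := by
  rw [Int.negOnePow_add, mul_comm, mul_smul, ← sign_tmul, ← tmul_sign,
    ← parity_of_mem 𝒜 ha, ← parity_of_mem 𝒜 hb]
  rfl

variable {𝒜} (hc : IsGradedComm 𝒜)

/-- The multiplication map `A ⊗_R A → A`. -/
noncomputable def mulMap : Square 𝒜 →+* A :=
  (GradedTensorProduct.lift 𝒜 𝒜 (AlgHom.id R A) (AlgHom.id R A) fun i j a b => by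
    rw [mul_comm j i]; exact hc a.2 b.2).toRingHom

lemma mulMap_tmul (a b : A) : mulMap hc (tmul 𝒜 a b) = a * b := rfl

/-- The ideal of the diagonal, the kernel of the multiplication map. -/
noncomputable def diagIdeal : Ideal (Square 𝒜) := RingHom.ker (mulMap hc)

instance : (diagIdeal hc).IsTwoSided := inferInstanceAs (RingHom.ker (mulMap hc)).IsTwoSided

/-- A degree one `R`-linear derivation. -/
structure IsGradedDer (d : A →ₗ[R] A) : Prop where
  deg : ∀ ⦃i : ℤ⦄ ⦃a : A⦄, a ∈ 𝒜 i → d a ∈ 𝒜 (i + 1)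
  leib : ∀ ⦃i : ℤ⦄ ⦃a : A⦄ (b : A), a ∈ 𝒜 i → d (a * b) = d a * b + i.negOnePow • (a * d b)

variable {d : A →ₗ[R] A}

lemma diff_mul (hd : IsGradedDer (𝒜 := 𝒜) d) (x y : Square 𝒜) :
    diff 𝒜 d (x * y) = diff 𝒜 d x * y + par 𝒜 x * diff 𝒜 d y := by
  induction x using induction with
  | h0 => simp
  | hadd x x' h1 h2 => rw [add_mul, map_add, h1, h2, map_add, map_add, add_mul, add_mul]; abel
  | ht i j a b ha hb =>
    induction y using induction with
    | h0 => simp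
    | hadd x x' h1 h2 => rw [mul_add, map_add, h1, h2, map_add, mul_add, mul_add]; abel
    | ht i' j' a' b' ha' hb' =>
      rw [tmul_mul 𝒜 _ _ hb ha', par_tmul 𝒜 ha hb, map_sign,
        diff_tmul 𝒜 d _ (SetLike.mul_mem_graded ha ha'), diff_tmul 𝒜 d _ ha, diff_tmul 𝒜 d _ ha',
        hd.leib _ ha, hd.leib _ hb]
      have e1 : (tmul 𝒜 a b * tmul 𝒜 (d a') b' : Square 𝒜) = _ := tmul_mul 𝒜 _ _ hb (hd.deg ha')
      have e2 : (tmul 𝒜 a (d b) * tmul 𝒜 a' b' : Square 𝒜) = _ := tmul_mul 𝒜 _ _ (hd.deg hb) ha'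
      have e3 : (tmul 𝒜 a b * tmul 𝒜 a' (d b') : Square 𝒜) = _ := tmul_mul 𝒜 _ _ hb ha'
      have e4 : (tmul 𝒜 (d a) b * tmul 𝒜 a' b' : Square 𝒜) = _ := tmul_mul 𝒜 _ _ hb ha'
      simp only [add_mul, mul_add, Int.negOnePow_add, mul_one, one_mul] at e1 e2 e3 e4 ⊢
      generalize (j * i').negOnePow = c1 at *
      generalize i.negOnePow = c2 at *
      generalize i'.negOnePow = c3 at *
      generalize j.negOnePow = c4 at *
      rcases Int.units_eq_one_or c1 with rfl | rfl <;> rcases Int.units_eq_one_or c2 with rfl | rfl <;>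
      rcases Int.units_eq_one_or c3 with rfl | rfl <;> rcases Int.units_eq_one_or c4 with rfl | rfl <;>
      · simp only [one_smul, Units.neg_smul, neg_mul, mul_neg, mul_one, neg_neg,
          add_tmul, tmul_add, neg_tmul, tmul_neg, neg_add] at e1 e2 e3 e4 ⊢
        try simp only [e1, e2, e3, e4]
        abel

lemma mulMap_diff (hd : IsGradedDer (𝒜 := 𝒜) d) (x : Square 𝒜) :
    mulMap hc (diff 𝒜 d x) = d (mulMap hc x) := by
  induction x using induction with
  | h0 => simp
  | hadd x x' h1 h2 => simp only [map_add, h1, h2]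
  | ht i j a b ha hb =>
    rw [diff_tmul 𝒜 d _ ha, map_add, map_sign, mulMap_tmul,
      mulMap_tmul, mulMap_tmul, hd.leib _ ha]

lemma mulMap_par (x : Square 𝒜) : mulMap hc (par 𝒜 x) = parity 𝒜 (mulMap hc x) := by
  induction x using induction with
  | h0 => simp
  | hadd x x' h1 h2 => simp only [map_add, h1, h2]
  | ht i j a b ha hb =>
    rw [par_tmul 𝒜 ha hb, map_sign, mulMap_tmul,
      parity_of_mem 𝒜 (SetLike.mul_mem_graded ha hb)]

lemma par_mul (x y : Square 𝒜) : par 𝒜 (x * y) = par 𝒜 x * par 𝒜 y := by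
  induction x using induction with
  | h0 => simp
  | hadd x x' h1 h2 => rw [add_mul, map_add, h1, h2, map_add, add_mul]
  | ht i j a b ha hb =>
    induction y using induction with
    | h0 => simp
    | hadd x x' h1 h2 => rw [mul_add, map_add, h1, h2, map_add, mul_add]
    | ht i' j' a' b' ha' hb' =>
      rw [tmul_mul 𝒜 _ _ hb ha', map_sign, par_tmul 𝒜 ha hb,
        par_tmul 𝒜 ha' hb', par_tmul 𝒜 (SetLike.mul_mem_graded ha ha')
          (SetLike.mul_mem_graded hb hb')]
      have e : (tmul 𝒜 a b * tmul 𝒜 a' b' : Square 𝒜) = _ := tmul_mul 𝒜 _ _ hb ha'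
      simp only [Int.negOnePow_add]
      generalize (j * i').negOnePow = c1 at *
      generalize i.negOnePow = c2 at *
      generalize i'.negOnePow = c3 at *
      generalize j.negOnePow = c4 at *
      generalize j'.negOnePow = c5 at *
      rcases Int.units_eq_one_or c1 with rfl | rfl <;> rcases Int.units_eq_one_or c2 with rfl | rfl <;>
      rcases Int.units_eq_one_or c3 with rfl | rfl <;> rcases Int.units_eq_one_or c4 with rfl | rfl <;>
      rcases Int.units_eq_one_or c5 with rfl | rfl <;>
      simp only [one_smul, Units.neg_smul, neg_mul, mul_neg, mul_one, neg_neg, e]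

lemma par_mem_pow (k : ℕ) {x : Square 𝒜} (hx : x ∈ diagIdeal hc ^ k) :
    par 𝒜 x ∈ diagIdeal hc ^ k := by
  induction k generalizing x with
  | zero => rw [Submodule.pow_zero, Ideal.one_eq_top]; trivial
  | succ k ih =>
    rw [Submodule.pow_succ] at hx ⊢
    induction hx using Submodule.mul_induction_on' with
    | mem_mul_mem y hy z hz =>
      rw [par_mul]
      refine Ideal.mul_mem_mul (ih hy) ?_
      change mulMap hc _ = 0 at hz
      change mulMap hc _ = 0
      rw [mulMap_par, hz, map_zero]
    | add y _ z _ h1 h2 => rw [map_add]; exact add_mem h1 h2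

lemma diff_mem_pow (hd : IsGradedDer (𝒜 := 𝒜) d) (k : ℕ) {x : Square 𝒜}
    (hx : x ∈ diagIdeal hc ^ k) : diff 𝒜 d x ∈ diagIdeal hc ^ k := by
  induction k generalizing x with
  | zero => rw [Submodule.pow_zero, Ideal.one_eq_top]; trivial
  | succ k ih =>
    rw [Submodule.pow_succ] at hx ⊢
    induction hx using Submodule.mul_induction_on' with
    | mem_mul_mem y hy z hz =>
      rw [diff_mul hd]
      refine add_mem (Ideal.mul_mem_mul (ih hy) hz) (Ideal.mul_mem_mul (par_mem_pow hc k hy) ?_)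
      change mulMap hc _ = 0 at hz
      change mulMap hc _ = 0
      rw [mulMap_diff hc hd, hz, map_zero]
    | add y _ z _ h1 h2 => rw [map_add]; exact add_mem h1 h2

lemma diff_mem (hd : IsGradedDer (𝒜 := 𝒜) d) {n : ℤ} {x : Square 𝒜} (hx : x ∈ gr 𝒜 n) :
    diff 𝒜 d x ∈ gr 𝒜 (n + 1) := by
  induction hx using AddSubgroup.closure_induction with
  | mem x h =>
    obtain ⟨i, j, rfl, a, ha, b, hb, rfl⟩ := h
    rw [diff_tmul 𝒜 d b ha]
    refine add_mem ?_ (sign_smul_mem _ _ ?_)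
    · convert tmul_mem 𝒜 (hd.deg ha) hb using 1; ring_nf
    · convert tmul_mem 𝒜 ha (hd.deg hb) using 1; ring_nf
  | zero => rw [map_zero]; exact zero_mem _
  | add x y hx hy h1 h2 => rw [map_add]; exact add_mem h1 h2
  | neg x hx h => rw [map_neg]; exact neg_mem h

/-- The structure ring `(A ⊗_R A)/J^{k+1}` of the `k`-th neighbourhood of the diagonal. -/
abbrev Nbhd (k : ℕ) : Type u := Square 𝒜 ⧸ diagIdeal hc ^ (k + 1)

/-- The differential of `(A ⊗_R A)/J^{k+1}`. -/
noncomputable def Nbhd.diff (hd : IsGradedDer (𝒜 := 𝒜) d) (k : ℕ) : Nbhd hc k →+ Nbhd hc k :=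
  QuotientAddGroup.map _ _ (Square.diff 𝒜 d) fun _ hx =>
    diff_mem_pow hc hd (k + 1) hx

@[simp] lemma Nbhd.diff_mk (hd : IsGradedDer (𝒜 := 𝒜) d) (k : ℕ) (x : Square 𝒜) :
    Nbhd.diff hc hd k (Ideal.Quotient.mk _ x) = Ideal.Quotient.mk _ (Square.diff 𝒜 d x) := rfl

/-- The transition map `(A ⊗_R A)/J^{k+2} → (A ⊗_R A)/J^{k+1}`. -/
noncomputable def Nbhd.step (k : ℕ) : Nbhd hc (k + 1) →+* Nbhd hc k :=
  Ideal.Quotient.factor (Ideal.pow_le_pow_right (Nat.le_succ _))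

@[simp] lemma Nbhd.step_mk (k : ℕ) (x : Square 𝒜) :
    Nbhd.step hc k (Ideal.Quotient.mk _ x) = Ideal.Quotient.mk _ x := rfl

/-- The degree `n` part of the completion `lim_k (A ⊗_R A)/J^{k+1}`: compatible families of
elements of degree `n`. -/
noncomputable def Completion (n : ℤ) : AddSubgroup (∀ k, Nbhd hc k) where
  carrier := {x | (∀ k, Nbhd.step hc k (x (k + 1)) = x k) ∧
    ∀ k, ∃ t ∈ gr 𝒜 n, Ideal.Quotient.mk _ t = x k}
  zero_mem' := ⟨fun k => map_zero _, fun k => ⟨0, zero_mem _, map_zero _⟩⟩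
  add_mem' := by
    rintro x y ⟨h1, h2⟩ ⟨h3, h4⟩
    refine ⟨fun k => by rw [Pi.add_apply, Pi.add_apply, map_add, h1, h3], fun k => ?_⟩
    obtain ⟨s, hs, hs'⟩ := h2 k
    obtain ⟨t, ht, ht'⟩ := h4 k
    exact ⟨s + t, add_mem hs ht, by rw [map_add, hs', ht', Pi.add_apply]⟩
  neg_mem' := by
    rintro x ⟨h1, h2⟩
    refine ⟨fun k => by rw [Pi.neg_apply, Pi.neg_apply, map_neg, h1], fun k => ?_⟩
    obtain ⟨s, hs, hs'⟩ := h2 k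
    exact ⟨-s, neg_mem hs, by rw [map_neg, hs', Pi.neg_apply]⟩

/-- The product of the completion. -/
noncomputable def Completion.mul {m n : ℤ} (x : Completion hc m) (y : Completion hc n) :
    Completion hc (m + n) :=
  ⟨x.1 * y.1, fun k => by rw [Pi.mul_apply, Pi.mul_apply, map_mul, x.2.1, y.2.1], fun k => by
    obtain ⟨s, hs, hs'⟩ := x.2.2 k
    obtain ⟨t, ht, ht'⟩ := y.2.2 k
    exact ⟨s * t, mul_mem 𝒜 hs ht, by rw [map_mul, hs', ht', Pi.mul_apply]⟩⟩

/-- The image of an element of `A ⊗_R A` in the completion. -/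
noncomputable def Completion.of {n : ℤ} (t : Square 𝒜) (ht : t ∈ gr 𝒜 n) : Completion hc n :=
  ⟨fun _ => Ideal.Quotient.mk _ t, fun _ => rfl, fun _ => ⟨t, ht, rfl⟩⟩

/-- The differential of the completion. -/
noncomputable def Completion.diff (hd : IsGradedDer (𝒜 := 𝒜) d) {n : ℤ} (x : Completion hc n) :
    Completion hc (n + 1) :=
  ⟨fun k => Nbhd.diff hc hd k (x.1 k), fun k => by
    obtain ⟨s, hs, hs'⟩ := x.2.2 (k + 1)
    beta_reduce
    rw [← x.2.1 k, ← hs', Nbhd.step_mk, Nbhd.diff_mk, Nbhd.diff_mk, Nbhd.step_mk], fun k => by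
    obtain ⟨s, hs, hs'⟩ := x.2.2 k
    exact ⟨Square.diff 𝒜 d s, diff_mem hd hs, by beta_reduce; rw [← hs', Nbhd.diff_mk]⟩⟩

end Square

namespace Square
variable {𝒜} (hc : IsGradedComm 𝒜) {R' A' : Type u} [CommRing R'] [Ring A'] [Algebra R' A']
  {ℬ : ℤ → Submodule R' A'} [GradedAlgebra ℬ] (hc' : IsGradedComm ℬ)
  (σ : R →+* R') (f : A →+* A') (hσ : ∀ r, f (algebraMap R A r) = algebraMap R' A' (σ r))
  (hf : ∀ ⦃i a⦄, a ∈ 𝒜 i → f a ∈ ℬ i)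

/-- The map `A ⊗_R A → A' ⊗_{R'} A'` induced by a morphism `(R, A) → (R', A')`. -/
noncomputable def map : Square 𝒜 →+* Square ℬ :=
  letI : Algebra R (Square ℬ) := Algebra.compHom _ σ
  (GradedTensorProduct.lift 𝒜 𝒜 (C := Square ℬ)
    { (GradedTensorProduct.includeLeft ℬ ℬ).toRingHom.comp f with
      commutes' r := by
        change GradedTensorProduct.includeLeft ℬ ℬ (f _) = _
        rw [hσ, AlgHom.commutes]
        rfl }
    { (GradedTensorProduct.includeRight ℬ ℬ).toRingHom.comp f with
      commutes' r := by
        change GradedTensorProduct.includeRight ℬ ℬ (f _) = _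
        rw [hσ, AlgHom.commutes]
        rfl }
    (by
      intro i j a b
      change tmul ℬ (f a) 1 * tmul ℬ 1 (f b) =
        (j * i).negOnePow • (tmul ℬ 1 (f b) * tmul ℬ (f a) 1)
      rw [tmul_one_mul_one_tmul, tmul_mul ℬ _ _ (hf b.2) (hf a.2), one_mul, mul_one, smul_smul,
        Int.units_mul_self, one_smul])).toRingHom

@[simp] lemma map_tmul (a b : A) : map σ f hσ hf (tmul 𝒜 a b) = tmul ℬ (f a) (f b) :=
  tmul_one_mul_one_tmul ℬ (f a) (f b)

lemma map_mem {n : ℤ} {x : Square 𝒜} (hx : x ∈ gr 𝒜 n) : map σ f hσ hf x ∈ gr ℬ n := by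
  induction hx using AddSubgroup.closure_induction with
  | mem x h =>
    obtain ⟨i, j, rfl, a, ha, b, hb, rfl⟩ := h
    rw [map_tmul]
    exact tmul_mem ℬ (hf ha) (hf hb)
  | zero => rw [map_zero]; exact zero_mem _
  | add x y hx hy h1 h2 => rw [map_add]; exact add_mem h1 h2
  | neg x hx h => rw [map_neg]; exact neg_mem h

lemma mulMap_map (x : Square 𝒜) : mulMap hc' (map σ f hσ hf x) = f (mulMap hc x) := by
  induction x using induction with
  | h0 => simp
  | hadd x x' h1 h2 => simp only [map_add, h1, h2]
  | ht i j a b ha hb => rw [map_tmul, mulMap_tmul, mulMap_tmul, map_mul]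

lemma map_mem_pow (k : ℕ) {x : Square 𝒜} (hx : x ∈ diagIdeal hc ^ k) :
    map σ f hσ hf x ∈ diagIdeal hc' ^ k := by
  induction k generalizing x with
  | zero => rw [Submodule.pow_zero, Ideal.one_eq_top]; trivial
  | succ k ih =>
    rw [Submodule.pow_succ] at hx ⊢
    induction hx using Submodule.mul_induction_on' with
    | mem_mul_mem y hy z hz =>
      rw [map_mul]
      refine Ideal.mul_mem_mul (ih hy) ?_
      change mulMap hc _ = 0 at hz
      change mulMap hc' _ = 0
      rw [mulMap_map hc, hz, map_zero]
    | add y _ z _ h1 h2 => rw [map_add]; exact add_mem h1 h2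

/-- Functoriality of the infinitesimal neighbourhoods of the diagonal. -/
noncomputable def Nbhd.map (k : ℕ) : Nbhd hc k →+* Nbhd hc' k :=
  Ideal.quotientMap _ (Square.map σ f hσ hf) fun _ hx => map_mem_pow hc hc' σ f hσ hf (k + 1) hx

@[simp] lemma Nbhd.map_mk (k : ℕ) (x : Square 𝒜) : Nbhd.map hc hc' σ f hσ hf k
    (Ideal.Quotient.mk _ x) = Ideal.Quotient.mk _ (Square.map σ f hσ hf x) := rfl

/-- Functoriality of the completion. -/
noncomputable def Completion.map {n : ℤ} (x : Completion hc n) : Completion hc' n :=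
  ⟨fun k => Nbhd.map hc hc' σ f hσ hf k (x.1 k), fun k => by
    obtain ⟨s, hs, hs'⟩ := x.2.2 (k + 1)
    beta_reduce
    rw [← x.2.1 k, ← hs', Nbhd.step_mk, Nbhd.map_mk, Nbhd.map_mk, Nbhd.step_mk], fun k => by
    obtain ⟨s, hs, hs'⟩ := x.2.2 k
    exact ⟨Square.map σ f hσ hf s, map_mem σ f hσ hf hs, by beta_reduce; rw [← hs', Nbhd.map_mk]⟩⟩

end Square
end Square

/-- A sheaf of graded-commutative dg-algebras `(A, d)` over a sheaf of commutative rings `R`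
(placed in degree zero), given by its values on a basis of open sets indexed by `ι`, where `V ≤ U`
stands for inclusion of open sets. -/
structure DGSheaf (ι : Type u) [Preorder ι] where
  R : ι → Type u
  A : ι → Type u
  [commRing : ∀ U, CommRing (R U)]
  [ring : ∀ U, Ring (A U)]
  [algebra : ∀ U, Algebra (R U) (A U)]
  gr : ∀ U, ℤ → Submodule (R U) (A U)
  [graded : ∀ U, GradedAlgebra (gr U)]
  comm : ∀ U, IsGradedComm (gr U)
  resR : ∀ {U V}, V ≤ U → R U →+* R V
  res : ∀ {U V}, V ≤ U → A U →+* A V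
  resR_refl : ∀ U r, resR (le_refl U) r = r
  resR_trans : ∀ {U V W} (h : V ≤ U) (h' : W ≤ V) r, resR h' (resR h r) = resR (h'.trans h) r
  res_refl : ∀ U a, res (le_refl U) a = a
  res_trans : ∀ {U V W} (h : V ≤ U) (h' : W ≤ V) a, res h' (res h a) = res (h'.trans h) a
  res_algebraMap : ∀ {U V} (h : V ≤ U) (r : R U),
    res h (algebraMap (R U) (A U) r) = algebraMap (R V) (A V) (resR h r)
  res_mem : ∀ {U V} (h : V ≤ U) {i : ℤ} {a : A U}, a ∈ gr U i → res h a ∈ gr V i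
  d : ∀ U, A U →ₗ[R U] A U
  d_der : ∀ U, Square.IsGradedDer (𝒜 := gr U) (d U)
  d_d : ∀ U a, d U (d U a) = 0
  d_res : ∀ {U V} (h : V ≤ U) (a : A U), d V (res h a) = res h (d U a)

namespace DGSheaf
attribute [instance] DGSheaf.commRing DGSheaf.ring DGSheaf.algebra DGSheaf.graded

variable {ι : Type u} [Preorder ι] (X : DGSheaf ι)

/-- The basic open sets contained in `U`. -/
abbrev Below {ι : Type u} [Preorder ι] (U : ι) : Type u := {V : ι // V ≤ U}

/-- Degree `n` sections over `U` of the sheaf `Der_R(A)` of `R`-linear graded derivations of `A`: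
families of derivations of degree `n` over the `V ⊆ U`, compatible with restriction. -/
def Tan (U : ι) (n : ℤ) : AddSubgroup (∀ V : Below U, Module.End (X.R V) (X.A V)) where
  carrier := {D | (∀ (V W : Below U) (h : W.1 ≤ V.1) (a : X.A V),
      D W (X.res h a) = X.res h (D V a)) ∧
    (∀ (V : Below U) (i : ℤ) (a : X.A V), a ∈ X.gr V i → D V a ∈ X.gr V (i + n)) ∧
    (∀ (V : Below U) (i : ℤ) (a b : X.A V), a ∈ X.gr V i →
      D V (a * b) = D V a * b + (n * i).negOnePow • (a * D V b))}
  zero_mem' := ⟨fun _ _ _ _ => by simp, fun _ _ _ _ => zero_mem _, fun _ _ _ _ _ => by simp⟩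
  add_mem' := by
    rintro D D' ⟨h1, h2, h3⟩ ⟨h1', h2', h3'⟩
    refine ⟨fun V W h a => ?_, fun V i a ha => add_mem (h2 V i a ha) (h2' V i a ha),
      fun V i a b ha => ?_⟩
    · simp only [Pi.add_apply, LinearMap.add_apply, map_add, h1, h1']
    · simp only [Pi.add_apply, LinearMap.add_apply, h3 V i a b ha, h3' V i a b ha, add_mul, mul_add,
        smul_add]
      abel
  neg_mem' := by
    rintro D ⟨h1, h2, h3⟩
    refine ⟨fun V W h a => ?_, fun V i a ha => neg_mem (h2 V i a ha), fun V i a b ha => ?_⟩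
    · simp only [Pi.neg_apply, LinearMap.neg_apply, map_neg, h1]
    · simp only [Pi.neg_apply, LinearMap.neg_apply, h3 V i a b ha, neg_mul, mul_neg,
        smul_neg]
      abel

variable {X}

/-- The `A`-module structure of `Der_R(A)`. -/
def Tan.smul {U : ι} {i n : ℤ} (a : X.gr U i) (D : X.Tan U n) : X.Tan U (i + n) :=
  ⟨fun V => LinearMap.mulLeft (X.R V) (X.res V.2 (a : X.A U)) * D.1 V, by
    refine ⟨fun V W h b => ?_, fun V j b hb => ?_, fun V j b c hb => ?_⟩
    · simp only [Module.End.mul_apply, LinearMap.mulLeft_apply, D.2.1 V W h, map_mul]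
      rw [X.res_trans]
    · simp only [Module.End.mul_apply, LinearMap.mulLeft_apply]
      rw [add_left_comm]
      exact SetLike.mul_mem_graded (X.res_mem V.2 a.2) (D.2.2.1 V j b hb)
    · simp only [Module.End.mul_apply, LinearMap.mulLeft_apply]
      have hc := X.comm V (X.res_mem V.2 a.2) hb
      rw [D.2.2.2 V j b c hb, mul_add, mul_smul_comm, ← mul_assoc, ← mul_assoc, hc, smul_mul_assoc,
        smul_smul, ← Int.negOnePow_add, mul_assoc, mul_assoc, ← add_mul, add_comm n i]⟩

/-- The graded commutator of derivations. -/
def Tan.bracket {U : ι} {m n : ℤ} (D : X.Tan U m) (D' : X.Tan U n) : X.Tan U (m + n) :=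
  ⟨fun V => D.1 V * D'.1 V - (m * n).negOnePow • (D'.1 V * D.1 V), by
    have key : ∀ (V : Below U) b, (D.1 V * D'.1 V - (m * n).negOnePow • (D'.1 V * D.1 V)) b =
        D.1 V (D'.1 V b) - (m * n).negOnePow • D'.1 V (D.1 V b) := by
      intro V b
      rcases Int.units_eq_one_or (m * n).negOnePow with h | h <;> rw [h] <;> simp
    refine ⟨fun V W h b => ?_, fun V j b hb => ?_, fun V j b c hb => ?_⟩
    · rw [key, key, map_sub, map_sign, D.2.1 V W h, D'.2.1 V W h, D.2.1 V W h, D'.2.1 V W h]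
    · rw [key]
      refine sub_mem ?_ ?_
      · rw [add_comm m n, ← add_assoc]; exact D.2.2.1 _ _ _ (D'.2.2.1 _ _ _ hb)
      · rw [← add_assoc, Units.smul_def]; exact zsmul_mem (D'.2.2.1 _ _ _ (D.2.2.1 _ _ _ hb)) _
    · rw [key, key, key, D.2.2.2 _ _ _ _ hb, D'.2.2.2 _ _ _ _ hb, map_add, map_add, map_sign,
        map_sign, D.2.2.2 _ _ _ _ hb, D'.2.2.2 _ _ _ _ hb, D.2.2.2 _ _ _ _ (D'.2.2.1 _ _ _ hb),
        D'.2.2.2 _ _ _ _ (D.2.2.1 _ _ _ hb)]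
      simp only [mul_add, add_mul, Int.negOnePow_add, mul_comm n m]
      generalize (m * n).negOnePow = c1
      generalize (m * j).negOnePow = c2
      generalize (n * j).negOnePow = c3
      rcases Int.units_eq_one_or c1 with rfl | rfl <;> rcases Int.units_eq_one_or c2 with rfl | rfl <;>
      rcases Int.units_eq_one_or c3 with rfl | rfl <;>
      · simp only [one_smul, Units.neg_smul, neg_mul, mul_neg, mul_one, neg_neg, sub_mul, mul_sub]
        abel⟩

/-- Restriction of derivations to a smaller open set. -/
def Tan.res {U V : ι} (h : V ≤ U) {n : ℤ} (D : X.Tan U n) : X.Tan V n :=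
  ⟨fun W => D.1 ⟨W.1, W.2.trans h⟩, fun V' W' => D.2.1 ⟨V'.1, V'.2.trans h⟩ ⟨W'.1, W'.2.trans h⟩,
    fun W => D.2.2.1 ⟨W.1, W.2.trans h⟩, fun W => D.2.2.2 ⟨W.1, W.2.trans h⟩⟩

variable (X)

/-- The differential of `A`, as a section of `Der_R(A)` of degree one. -/
def Q (U : ι) : X.Tan U 1 :=
  ⟨fun V => X.d V, fun _ _ h a => X.d_res h a, fun V _ _ ha => (X.d_der V).deg ha,
    fun V i _ b ha => by rw [one_mul]; exact (X.d_der V).leib b ha⟩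

/-- Degree `n` sections of the semi-direct product `A ⋊ Der_R(A)`. -/
abbrev SemiDir (U : ι) (n : ℤ) : Type u := X.gr U n × X.Tan U n

variable {X}

/-- The value of a derivation over `U` on sections over `U`. -/
def Tan.app {U : ι} {n : ℤ} (D : X.Tan U n) : Module.End (X.R U) (X.A U) := D.1 ⟨U, le_refl U⟩

lemma Tan.app_mem {U : ι} {n : ℤ} (D : X.Tan U n) {i : ℤ} {a : X.A U} (ha : a ∈ X.gr U i) :
    Tan.app D a ∈ X.gr U (i + n) := D.2.2.1 ⟨U, le_refl U⟩ _ _ ha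

lemma Tan.app_mul {U : ι} {n : ℤ} (D : X.Tan U n) {i : ℤ} {a : X.A U} (b : X.A U)
    (ha : a ∈ X.gr U i) : Tan.app D (a * b) = Tan.app D a * b + (n * i).negOnePow • (a * Tan.app D b) :=
  D.2.2.2 ⟨U, le_refl U⟩ _ _ _ ha

lemma Tan.app_res {U V : ι} (h : V ≤ U) {n : ℤ} (D : X.Tan U n) (a : X.A U) :
    Tan.app (Tan.res h D) (X.res h a) = X.res h (Tan.app D a) := D.2.1 ⟨U, le_refl U⟩ ⟨V, h⟩ h a

lemma Tan.app_smul {U : ι} {i n : ℤ} (a : X.gr U i) (D : X.Tan U n) (b : X.A U) :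
    Tan.app (Tan.smul a D) b = a * Tan.app D b := by
  change X.res (le_refl U) a.1 * Tan.app D b = _
  rw [X.res_refl]

lemma Tan.app_bracket {U : ι} {m n : ℤ} (D : X.Tan U m) (D' : X.Tan U n) (b : X.A U) :
    Tan.app (Tan.bracket D D') b = Tan.app D (Tan.app D' b) - (m * n).negOnePow • Tan.app D' (Tan.app D b) := by
  change (Tan.app D * Tan.app D' - (m * n).negOnePow • (Tan.app D' * Tan.app D)) b = _
  rcases Int.units_eq_one_or (m * n).negOnePow with h | h <;> rw [h] <;> simp

/-- The graded Lie bracket of `A ⋊ Der_R(A)`: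
`[(a, D), (b, D')] = (D(b) - (-1)^{mn} D'(a), [D, D'])`. -/
def SemiDir.bracket {U : ι} {m n : ℤ} (x : X.SemiDir U m) (y : X.SemiDir U n) :
    X.SemiDir U (m + n) :=
  (⟨Tan.app x.2 y.1 - (m * n).negOnePow • Tan.app y.2 x.1, by
    refine sub_mem ?_ ?_
    · rw [add_comm]; exact Tan.app_mem x.2 y.1.2
    · rw [Units.smul_def]; exact zsmul_mem (Tan.app_mem y.2 x.1.2) _⟩, Tan.bracket x.2 y.2)

/-- The `A`-module structure of `A ⊕ Der_R(A)`. -/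
def SemiDir.smul {U : ι} {i n : ℤ} (a : X.gr U i) (x : X.SemiDir U n) : X.SemiDir U (i + n) :=
  (⟨a * x.1, SetLike.mul_mem_graded a.2 x.1.2⟩, Tan.smul a x.2)

/-- Restriction of sections of `A ⋊ Der_R(A)`. -/
def SemiDir.res {U V : ι} (h : V ≤ U) {n : ℤ} (x : X.SemiDir U n) : X.SemiDir V n :=
  (⟨X.res h x.1, X.res_mem h x.1.2⟩, Tan.res h x.2)

/-- The unit of `A`, in degree zero. -/
def oneGr (U : ι) : X.gr U 0 := ⟨1, SetLike.one_mem_graded _⟩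

/-- The relations of the universal enveloping algebra: linearity, the graded Lie bracket of
`A ⋊ Der_R(A)`, the relations `a x = a · x` for `a ∈ A` and `x ∈ A ⊕ Der_R(A)`, and `1_A = 1`. -/
inductive EnvRel (U : ι) : FreeAlgebra ℤ (Σ n, X.SemiDir U n) →
    FreeAlgebra ℤ (Σ n, X.SemiDir U n) → Prop
  | add (n : ℤ) (x y : X.SemiDir U n) : EnvRel U (FreeAlgebra.ι ℤ ⟨n, x + y⟩)
      (FreeAlgebra.ι ℤ ⟨n, x⟩ + FreeAlgebra.ι ℤ ⟨n, y⟩)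
  | lie (m n : ℤ) (x : X.SemiDir U m) (y : X.SemiDir U n) :
      EnvRel U (FreeAlgebra.ι ℤ ⟨m, x⟩ * FreeAlgebra.ι ℤ ⟨n, y⟩)
        ((m * n).negOnePow • (FreeAlgebra.ι ℤ ⟨n, y⟩ * FreeAlgebra.ι ℤ ⟨m, x⟩) +
          FreeAlgebra.ι ℤ ⟨m + n, x.bracket y⟩)
  | smul (i n : ℤ) (a : X.gr U i) (x : X.SemiDir U n) :
      EnvRel U (FreeAlgebra.ι ℤ ⟨i, (a, 0)⟩ * FreeAlgebra.ι ℤ ⟨n, x⟩)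
        (FreeAlgebra.ι ℤ ⟨i + n, x.smul a⟩)
  | one : EnvRel U (FreeAlgebra.ι ℤ ⟨0, (oneGr U, 0)⟩) 1

variable (X) in
/-- The sections over `U` of the (presheaf) universal enveloping algebra `U(Der_R(A))` of the
Lie algebroid `(A, Der_R(A))`. It is the quotient of the augmentation ideal of the enveloping
algebra of the graded Lie algebra `A ⋊ Der_R(A)` by the relations `a x = a · x`; in that quotient
`1_A` is a two-sided unit, so that it is also the quotient of the whole tensor algebra by the
relations below. Because of the relation for `smul` the ground ring of the tensor algebra plays no
role. -/
def Env (U : ι) : Type u := RingQuot (EnvRel (X := X) U)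

namespace Env
variable {U V : ι}

noncomputable instance : Ring (X.Env U) := inferInstanceAs (Ring (RingQuot (EnvRel U)))

variable (X U) in
/-- The universal enveloping algebra is a quotient of a free algebra. -/
noncomputable def mk : FreeAlgebra ℤ (Σ n, X.SemiDir U n) →+* X.Env U :=
  RingQuot.mkRingHom (EnvRel U)

lemma mk_surjective : Function.Surjective (mk X U) := RingQuot.mkRingHom_surjective (EnvRel U)

/-- The canonical map from `A ⋊ Der_R(A)` to the universal enveloping algebra. -/
noncomputable def gen (n : ℤ) (x : X.SemiDir U n) : X.Env U := mk X U (FreeAlgebra.ι ℤ ⟨n, x⟩)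

lemma gen_add (n : ℤ) (x y : X.SemiDir U n) : gen n (x + y) = gen n x + gen n y := by
  have := RingQuot.mkRingHom_rel (EnvRel.add (X := X) n x y)
  rwa [map_add] at this

lemma gen_lie {m n : ℤ} (x : X.SemiDir U m) (y : X.SemiDir U n) : gen m x * gen n y =
    (m * n).negOnePow • (gen n y * gen m x) + gen (m + n) (x.bracket y) := by
  have := RingQuot.mkRingHom_rel (EnvRel.lie (X := X) m n x y)
  rwa [map_mul, map_add, map_sign, map_mul] at this

lemma gen_smul {i n : ℤ} (a : X.gr U i) (x : X.SemiDir U n) :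
    gen i (a, 0) * gen n x = gen (i + n) (x.smul a) := by
  have := RingQuot.mkRingHom_rel (EnvRel.smul (X := X) i n a x)
  rwa [map_mul] at this

lemma gen_one : gen 0 (oneGr U, 0) = (1 : X.Env U) := by
  have := RingQuot.mkRingHom_rel (EnvRel.one (X := X) (U := U))
  rwa [map_one] at this

/-- The universal property of the universal enveloping algebra. -/
noncomputable def lift {S : Type*} [Ring S] (f : ∀ n, X.SemiDir U n → S)
    (hadd : ∀ n x y, f n (x + y) = f n x + f n y)
    (hlie : ∀ m n (x : X.SemiDir U m) (y : X.SemiDir U n), f m x * f n y =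
      (m * n).negOnePow • (f n y * f m x) + f (m + n) (x.bracket y))
    (hsmul : ∀ i n (a : X.gr U i) (x : X.SemiDir U n),
      f i (a, 0) * f n x = f (i + n) (x.smul a))
    (hone : f 0 (oneGr U, 0) = 1) : X.Env U →+* S :=
  RingQuot.lift ⟨(FreeAlgebra.lift ℤ fun p : (Σ n, X.SemiDir U n) => f p.1 p.2).toRingHom, by
    intro a b h
    induction h with
    | add n x y => simpa using hadd n x y
    | lie m n x y =>
      simp only [AlgHom.toRingHom_eq_coe, RingHom.coe_coe, map_mul, map_add, map_sign,
        FreeAlgebra.lift_ι_apply]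
      exact hlie m n x y
    | smul i n a x => simpa using hsmul i n a x
    | one => simpa using hone⟩

@[simp] lemma lift_gen {S : Type*} [Ring S] (f : ∀ n, X.SemiDir U n → S) (hadd) (hlie) (hsmul)
    (hone) (n : ℤ) (x : X.SemiDir U n) :
    lift f hadd hlie hsmul hone (gen n x) = f n x := by
  refine (RingQuot.lift_mkRingHom_apply _ _ _).trans ?_
  simp

end Env

namespace Env
variable {U V : ι}

/-- The product of a list of generators. -/
noncomputable def mono (l : List (Σ n, X.SemiDir U n)) : X.Env U :=
  (l.map fun p => gen p.1 p.2).prod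

@[simp] lemma mono_nil : mono ([] : List (Σ n, X.SemiDir U n)) = 1 := rfl

@[simp] lemma mono_cons (p : Σ n, X.SemiDir U n) (l : List (Σ n, X.SemiDir U n)) :
    mono (p :: l) = gen p.1 p.2 * mono l := by simp [mono]

lemma mono_append (l l' : List (Σ n, X.SemiDir U n)) : mono (l ++ l') = mono l * mono l' := by
  simp [mono]

/-- Products of generators span the universal enveloping algebra. -/
lemma induction {P : X.Env U → Prop} (h0 : P 0) (hadd : ∀ x y, P x → P y → P (x + y))
    (hneg : ∀ x, P x → P (-x)) (hm : ∀ l, P (mono l)) (u : X.Env U) : P u := by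
  suffices h : u ∈ AddSubgroup.closure (Set.range (mono (X := X) (U := U))) by
    induction h using AddSubgroup.closure_induction with
    | mem x h => obtain ⟨l, rfl⟩ := h; exact hm l
    | zero => exact h0
    | add x y _ _ h1 h2 => exact hadd _ _ h1 h2
    | neg x _ h => exact hneg _ h
  obtain ⟨x, rfl⟩ := mk_surjective u
  induction x using FreeAlgebra.induction with
  | grade0 r =>
    have e : mk X U (algebraMap ℤ _ r) = r • (1 : X.Env U) := by
      rw [eq_intCast, map_intCast, zsmul_one]
    rw [e]
    have e1 : (1 : X.Env U) ∈ Set.range (mono (X := X) (U := U)) := ⟨[], rfl⟩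
    exact zsmul_mem (AddSubgroup.subset_closure e1) r
  | grade1 p => exact AddSubgroup.subset_closure ⟨[p], by simp [gen]⟩
  | add a b h1 h2 => rw [map_add]; exact add_mem h1 h2
  | mul a b h1 h2 =>
    rw [map_mul]
    generalize mk X U a = a' at *
    generalize mk X U b = b' at *
    induction h1 using AddSubgroup.closure_induction with
    | mem x h =>
      obtain ⟨l, rfl⟩ := h
      induction h2 using AddSubgroup.closure_induction with
      | mem x h =>
        obtain ⟨l', rfl⟩ := h
        exact AddSubgroup.subset_closure ⟨l ++ l', mono_append l l'⟩
      | zero => rw [mul_zero]; exact zero_mem _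
      | add x y _ _ h1 h2 => rw [mul_add]; exact add_mem h1 h2
      | neg x _ h => rw [mul_neg]; exact neg_mem h
    | zero => rw [zero_mul]; exact zero_mem _
    | add x y _ _ h1 h2 => rw [add_mul]; exact add_mem h1 h2
    | neg x _ h => rw [neg_mul]; exact neg_mem h

variable (X U) in
/-- The degree `d` part of the universal enveloping algebra. -/
noncomputable def gr (d : ℤ) : AddSubgroup (X.Env U) :=
  AddSubgroup.closure {u | ∃ l : List (Σ n, X.SemiDir U n), (l.map Sigma.fst).sum = d ∧ mono l = u}

lemma mono_mem (l : List (Σ n, X.SemiDir U n)) : mono l ∈ gr X U (l.map Sigma.fst).sum :=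
  AddSubgroup.subset_closure ⟨l, rfl, rfl⟩

lemma gen_zero (n : ℤ) : gen n (0 : X.SemiDir U n) = 0 := by
  have := gen_add n (0 : X.SemiDir U n) 0
  rwa [add_zero, left_eq_add] at this

lemma gen_split (n : ℤ) (x : X.SemiDir U n) : gen n x = gen n (x.1, 0) + gen n (0, x.2) := by
  rw [← gen_add]; simp

/-- The automorphism `u ↦ (-1)^{i|u|} u`. -/
noncomputable def par (i : ℤ) : X.Env U →+* X.Env U :=
  lift (fun n x => (i * n).negOnePow • gen n x)
    (fun n x y => by rw [gen_add, smul_add])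
    (fun m n x y => by
      rw [smul_mul_smul_comm, smul_mul_smul_comm, gen_lie, mul_add, Int.negOnePow_add, smul_add,
        smul_smul, smul_smul, mul_comm (i * n).negOnePow (i * m).negOnePow, mul_comm])
    (fun i' n a x => by
      rw [smul_mul_smul_comm, gen_smul, mul_add, Int.negOnePow_add])
    (by simp [gen_one])

@[simp] lemma par_gen (i n : ℤ) (x : X.SemiDir U n) :
    par i (gen n x) = (i * n).negOnePow • gen n x := lift_gen _ _ _ _ _ _ _

lemma par_mono (i : ℤ) (l : List (Σ n, X.SemiDir U n)) :
    par i (mono l) = (i * (l.map Sigma.fst).sum).negOnePow • mono l := by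
  induction l with
  | nil => simp
  | cons p l ih =>
    rw [mono_cons, map_mul, par_gen, ih, smul_mul_smul_comm, List.map_cons, List.sum_cons, mul_add,
      Int.negOnePow_add]

lemma par_add (i j : ℤ) (u : X.Env U) : par (i + j) u = par i (par j u) := by
  induction u using induction with
  | h0 => simp
  | hadd x y h1 h2 => rw [map_add, h1, h2, map_add, map_add]
  | hneg x h => rw [map_neg, h, map_neg, map_neg]
  | hm l =>
    rw [par_mono, par_mono, map_sign, par_mono, smul_smul, add_mul, Int.negOnePow_add, mul_comm]

/-- The action of the universal enveloping algebra on `A`: functions act by multiplication and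
vector fields act by derivations. -/
noncomputable def act : X.Env U →+* Module.End (X.R U) (X.A U) :=
  lift (fun n x => LinearMap.mulLeft (X.R U) (x.1 : X.A U) + Tan.app x.2)
    (fun n x y => by
      refine LinearMap.ext fun b => ?_
      change ((x.1 : X.A U) + y.1) * b + (Tan.app x.2 b + Tan.app y.2 b) =
        x.1 * b + Tan.app x.2 b + (y.1 * b + Tan.app y.2 b)
      rw [add_mul]; abel)
    (fun m n x y => by
      refine LinearMap.ext fun c => ?_
      have e1 := Tan.app_mul x.2 c y.1.2
      have e2 := Tan.app_mul y.2 c x.1.2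
      have e3 := X.comm U x.1.2 y.1.2
      have e4 := Tan.app_bracket x.2 y.2 c
      have e5 : ((x.bracket y).1 : X.A U) =
        Tan.app x.2 y.1 - (m * n).negOnePow • Tan.app y.2 x.1 := rfl
      have e6 : (x.bracket y).2 = Tan.bracket x.2 y.2 := rfl
      rw [mul_comm n m] at e2
      generalize (m * n).negOnePow = s at *
      rcases Int.units_eq_one_or s with rfl | rfl <;>
      · simp only [one_smul, Units.neg_smul] at e1 e2 e3 e4 e5 ⊢
        have e3c : (x.1 : X.A U) * y.1 * c = _ * c := congrArg (· * c) e3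
        try simp only [neg_mul] at e3c
        simp only [Module.End.mul_apply, LinearMap.add_apply, LinearMap.mulLeft_apply, e4, e5, e6,
          LinearMap.neg_apply, e1, e2, mul_add, add_mul, sub_mul, neg_mul, ← mul_assoc, e3c]
        abel)
    (fun i n a x => by
      refine LinearMap.ext fun c => ?_
      change (a : X.A U) * ((x.1 : X.A U) * c + Tan.app x.2 c) + 0 =
        (a : X.A U) * x.1 * c + Tan.app (Tan.smul a x.2) c
      rw [Tan.app_smul, mul_add, add_zero, mul_assoc])
    (by
      refine LinearMap.ext fun c => ?_
      change (1 : X.A U) * c + 0 = c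
      simp)

lemma act_gen (n : ℤ) (x : X.SemiDir U n) (b : X.A U) :
    act (gen n x) b = x.1 * b + Tan.app x.2 b := by
  rw [act, lift_gen]; rfl

lemma act_mem {p : ℤ} {u : X.Env U} (hu : u ∈ gr X U p) {j : ℤ} {b : X.A U} (hb : b ∈ X.gr U j) :
    act u b ∈ X.gr U (j + p) := by
  induction hu using AddSubgroup.closure_induction with
  | mem u h =>
    obtain ⟨l, rfl, rfl⟩ := h
    induction l with
    | nil => simpa using hb
    | cons q l ih =>
      rw [mono_cons, map_mul, Module.End.mul_apply, act_gen, List.map_cons, List.sum_cons]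
      refine add_mem ?_ ?_
      · rw [add_left_comm]; exact SetLike.mul_mem_graded q.2.1.2 ih
      · rw [add_comm q.1, ← add_assoc]; exact Tan.app_mem _ ih
  | zero => rw [map_zero]; exact zero_mem _
  | add x y _ _ h1 h2 => rw [map_add]; exact add_mem h1 h2
  | neg x _ h => rw [map_neg]; exact neg_mem h

/-- Restriction maps of the presheaf of universal enveloping algebras. -/
noncomputable def res (h : V ≤ U) : X.Env U →+* X.Env V :=
  lift (fun n x => gen n (x.res h))
    (fun n x y => by
      rw [← gen_add]
      congr 1
      refine Prod.ext (Subtype.ext ?_) rfl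
      exact map_add (X.res h) x.1.1 y.1.1)
    (fun m n x y => by
      rw [gen_lie]
      congr 2
      refine Prod.ext (Subtype.ext ?_) rfl
      change Tan.app (Tan.res h x.2) (X.res h y.1) -
        (m * n).negOnePow • Tan.app (Tan.res h y.2) (X.res h x.1) =
        X.res h (Tan.app x.2 y.1 - (m * n).negOnePow • Tan.app y.2 x.1)
      rw [Tan.app_res, Tan.app_res, map_sub, map_sign])
    (fun i n a x => by
      have h1 : SemiDir.res h ((a, 0) : X.SemiDir U i) = (⟨X.res h a, X.res_mem h a.2⟩, 0) := rfl
      rw [h1, gen_smul]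
      congr 1
      refine Prod.ext (Subtype.ext ?_) (Subtype.ext (funext fun W => LinearMap.ext fun b => ?_))
      · exact (map_mul (X.res h) a.1 x.1.1).symm
      · change X.res W.2 (X.res h a.1) * _ = X.res (W.2.trans h) a.1 * _
        rw [X.res_trans]
        rfl)
    (by
      rw [← gen_one]
      congr 1
      refine Prod.ext (Subtype.ext ?_) rfl
      exact map_one (X.res h))

@[simp] lemma res_gen (h : V ≤ U) (n : ℤ) (x : X.SemiDir U n) :
    res h (gen n x) = gen n (x.res h) := lift_gen _ _ _ _ _ _ _

lemma res_mono (h : V ≤ U) (l : List (Σ n, X.SemiDir U n)) :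
    res h (mono l) = mono (l.map fun p => ⟨p.1, p.2.res h⟩) := by
  induction l with
  | nil => simp
  | cons p l ih => simp [ih]

lemma res_par (h : V ≤ U) (i : ℤ) (u : X.Env U) : res h (par i u) = par i (res h u) := by
  induction u using induction with
  | h0 => simp
  | hadd x y h1 h2 => simp only [map_add, h1, h2]
  | hneg x h => simp only [map_neg, h]
  | hm l => rw [par_mono, map_sign, res_mono, par_mono, List.map_map]; rfl

lemma act_res (h : V ≤ U) (u : X.Env U) (b : X.A U) :
    act (res h u) (X.res h b) = X.res h (act u b) := by
  induction u using induction with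
  | h0 => simp
  | hadd x y h1 h2 => simp only [map_add, LinearMap.add_apply, h1, h2]
  | hneg x h => simp only [map_neg, LinearMap.neg_apply, h]
  | hm l =>
    induction l with
    | nil => simp
    | cons p l ih =>
      rw [mono_cons, map_mul, map_mul, map_mul, Module.End.mul_apply, Module.End.mul_apply, ih,
        res_gen, act_gen, act_gen, map_add, map_mul]
      congr 1
      exact Tan.app_res h p.2.2 _

/-- The differential of the universal enveloping algebra, the derivation extending the differential
of `A` and the differential `[d, -]` of `Der_R(A)`; it is the graded commutator with `d`. -/
noncomputable def diff : X.Env U →+ X.Env U :=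
  AddMonoidHom.mulLeft (gen 1 (0, X.Q U)) -
    (AddMonoidHom.mulRight (gen 1 (0, X.Q U))).comp (par 1).toAddMonoidHom

lemma diff_apply (u : X.Env U) :
    diff u = gen 1 (0, X.Q U) * u - par 1 u * gen 1 (0, X.Q U) := rfl

lemma diff_gen (n : ℤ) (x : X.SemiDir U n) :
    diff (gen n x) = gen (1 + n) (SemiDir.bracket (m := 1) (0, X.Q U) x) := by
  rw [diff_apply, gen_lie, par_gen, smul_mul_assoc, one_mul, add_sub_cancel_left]

lemma diff_func_mul {i : ℤ} (a : X.gr U i) (u : X.Env U) : diff (gen i (a, 0) * u) =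
    gen (i + 1) (⟨X.d U a, (X.d_der U).deg a.2⟩, 0) * u + i.negOnePow • (gen i (a, 0) * diff u) := by
  have h := gen_lie ((0, X.Q U) : X.SemiDir U 1) ((a, 0) : X.SemiDir U i)
  have e : gen (1 + i) (SemiDir.bracket ((0, X.Q U) : X.SemiDir U 1) ((a, 0) : X.SemiDir U i)) =
      gen (i + 1) (⟨X.d U a, (X.d_der U).deg a.2⟩, 0) := by
    have key : ∀ (m : ℤ) (hm : m = i + 1) (y : X.SemiDir U m), (y.1 : X.A U) = X.d U a →
        (∀ V b, y.2.1 V b = 0) → gen m y = gen (i + 1) (⟨X.d U a, (X.d_der U).deg a.2⟩, 0) := by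
      rintro m rfl y h1 h2
      congr 1
      exact Prod.ext (Subtype.ext h1) (Subtype.ext (funext fun V => LinearMap.ext (h2 V)))
    refine key _ (add_comm _ _) _ ?_ ?_
    · change Tan.app (X.Q U) (a : X.A U) - (1 * i).negOnePow • (0 : X.A U) = _
      rw [smul_zero, sub_zero]; rfl
    · intro V b
      change ((X.Q U).1 V * (0 : Module.End (X.R V) (X.A V)) - (1 * i).negOnePow •
        ((0 : Module.End (X.R V) (X.A V)) * (X.Q U).1 V) : Module.End (X.R V) (X.A V)) b = 0
      rw [mul_zero, zero_mul, smul_zero, sub_zero]; rfl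
  rw [diff_apply, diff_apply, map_mul, par_gen, ← mul_assoc, h, e, one_mul, add_mul, mul_sub,
    smul_sub, smul_mul_assoc, smul_mul_assoc, smul_mul_assoc, mul_assoc, mul_assoc]
  abel

lemma mono_mul_mem {p q : ℤ} {u v : X.Env U} (hu : u ∈ gr X U p) (hv : v ∈ gr X U q) :
    u * v ∈ gr X U (p + q) := by
  induction hu using AddSubgroup.closure_induction with
  | mem x h =>
    obtain ⟨l, rfl, rfl⟩ := h
    induction hv using AddSubgroup.closure_induction with
    | mem x h =>
      obtain ⟨l', rfl, rfl⟩ := h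
      exact AddSubgroup.subset_closure ⟨l ++ l', by simp, mono_append l l'⟩
    | zero => rw [mul_zero]; exact zero_mem _
    | add x y _ _ h1 h2 => rw [mul_add]; exact add_mem h1 h2
    | neg x _ h => rw [mul_neg]; exact neg_mem h
  | zero => rw [zero_mul]; exact zero_mem _
  | add x y _ _ h1 h2 => rw [add_mul]; exact add_mem h1 h2
  | neg x _ h => rw [neg_mul]; exact neg_mem h

lemma gen_mem (n : ℤ) (x : X.SemiDir U n) : gen n x ∈ gr X U n := by
  simpa using mono_mem [(⟨n, x⟩ : Σ n, X.SemiDir U n)]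

lemma par_of_mem (i : ℤ) {p : ℤ} {u : X.Env U} (hu : u ∈ gr X U p) :
    par i u = (i * p).negOnePow • u := by
  induction hu using AddSubgroup.closure_induction with
  | mem x h => obtain ⟨l, rfl, rfl⟩ := h; exact par_mono i l
  | zero => simp
  | add x y _ _ h1 h2 => rw [map_add, h1, h2, smul_add]
  | neg x _ h => rw [map_neg, h, smul_neg]

lemma diff_mem {p : ℤ} {u : X.Env U} (hu : u ∈ gr X U p) : diff u ∈ gr X U (p + 1) := by
  rw [diff_apply, par_of_mem 1 hu, smul_mul_assoc]
  refine sub_mem ?_ ?_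
  · rw [add_comm]; exact mono_mul_mem (gen_mem _ _) hu
  · rw [Units.smul_def]; exact zsmul_mem (mono_mul_mem hu (gen_mem _ _)) _

lemma res_diff (h : V ≤ U) (u : X.Env U) : res h (diff u) = diff (res h u) := by
  have e : res h (gen 1 (0, X.Q U)) = gen 1 (0, X.Q V) := by
    rw [res_gen]
    congr 1
    exact Prod.ext (Subtype.ext (map_zero (X.res h))) rfl
  rw [diff_apply, diff_apply, map_sub, map_mul, map_mul, res_par, e]

end Env


namespace Env
variable {U V : ι}

variable (X U) in
/-- The relations defining `U ⊗_A U`, the tensor product of left `A`-modules. -/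
noncomputable def relT : Submodule ℤ (X.Env U ⊗[ℤ] X.Env U) :=
  Submodule.span ℤ {t | ∃ (i : ℤ) (a : X.gr U i) (u v : X.Env U),
    t = (gen i (a, 0) * u) ⊗ₜ[ℤ] v - (par i u) ⊗ₜ[ℤ] (gen i (a, 0) * v)}

variable (X U) in
/-- The tensor product `U ⊗_A U` of left `A`-modules, where `U` is the universal enveloping
algebra: `a u ⊗ v = (-1)^{|a||u|} u ⊗ a v`. -/
abbrev CoT : Type u := (X.Env U ⊗[ℤ] X.Env U) ⧸ relT X U

/-- The class of `u ⊗ v` in `U ⊗_A U`. -/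
noncomputable def ct (u v : X.Env U) : CoT X U := (relT X U).mkQ (u ⊗ₜ[ℤ] v)

lemma ct_rel {i : ℤ} (a : X.gr U i) (u v : X.Env U) :
    ct (gen i (a, 0) * u) v = ct (par i u) (gen i (a, 0) * v) := by
  rw [ct, ct, ← sub_eq_zero, ← map_sub]
  exact (Submodule.Quotient.mk_eq_zero _).2 (Submodule.subset_span ⟨i, a, u, v, rfl⟩)

lemma ct_add_left (u u' v : X.Env U) : ct (u + u') v = ct u v + ct u' v := by
  rw [ct, TensorProduct.add_tmul, map_add]; rfl
lemma ct_add_right (u v v' : X.Env U) : ct u (v + v') = ct u v + ct u v' := by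
  rw [ct, TensorProduct.tmul_add, map_add]; rfl
lemma ct_neg_left (u v : X.Env U) : ct (-u) v = -ct u v := by
  rw [ct, TensorProduct.neg_tmul, map_neg]; rfl
lemma ct_neg_right (u v : X.Env U) : ct u (-v) = -ct u v := by
  rw [ct, TensorProduct.tmul_neg, map_neg]; rfl
lemma ct_sign_left (c : ℤˣ) (u v : X.Env U) : ct (c • u) v = c • ct u v := by
  rcases Int.units_eq_one_or c with rfl | rfl
  · rw [one_smul, one_smul]
  · rw [Units.neg_smul, Units.neg_smul, one_smul, one_smul, ct_neg_left]
lemma ct_sign_right (c : ℤˣ) (u v : X.Env U) : ct u (c • v) = c • ct u v := by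
  rcases Int.units_eq_one_or c with rfl | rfl
  · rw [one_smul, one_smul]
  · rw [Units.neg_smul, Units.neg_smul, one_smul, one_smul, ct_neg_right]

lemma ct_induction {P : CoT X U → Prop} (h0 : P 0) (hadd : ∀ x y, P x → P y → P (x + y))
    (ht : ∀ u v, P (ct u v)) (z : CoT X U) : P z := by
  obtain ⟨t, rfl⟩ := (relT X U).mkQ_surjective z
  induction t using TensorProduct.induction_on with
  | zero => rw [map_zero]; exact h0
  | add x y h1 h2 => rw [map_add]; exact hadd _ _ h1 h2
  | tmul u v => exact ht u v

lemma ct_hom_ext {G : Type*} [AddCommGroup G] {f g : CoT X U →ₗ[ℤ] G}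
    (h : ∀ u v, f (ct u v) = g (ct u v)) : f = g := by
  refine LinearMap.ext fun z => ?_
  induction z using ct_induction with
  | h0 => rw [map_zero, map_zero]
  | hadd x y h1 h2 => rw [map_add, map_add, h1, h2]
  | ht u v => exact h u v

/-- The additive map on `U ⊗_A U` induced by an additive map on `U ⊗_ℤ U` which respects the
relations. -/
noncomputable def ctLift {G : Type*} [AddCommGroup G] (f : X.Env U ⊗[ℤ] X.Env U →ₗ[ℤ] G)
    (hf : ∀ (i : ℤ) (a : X.gr U i) (u v : X.Env U),
      f ((gen i (a, 0) * u) ⊗ₜ[ℤ] v) = f ((par i u) ⊗ₜ[ℤ] (gen i (a, 0) * v))) :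
    CoT X U →ₗ[ℤ] G :=
  (relT X U).liftQ f <| by
    rw [relT, Submodule.span_le]
    rintro _ ⟨i, a, u, v, rfl⟩
    change f _ = 0
    rw [map_sub, hf, sub_self]

@[simp] lemma ctLift_ct {G : Type*} [AddCommGroup G] (f : X.Env U ⊗[ℤ] X.Env U →ₗ[ℤ] G) (hf)
    (u v : X.Env U) : ctLift f hf (ct u v) = f (u ⊗ₜ[ℤ] v) := rfl

lemma par_par (i j : ℤ) (u : X.Env U) : par i (par j u) = par j (par i u) := by
  rw [← par_add, add_comm, par_add]

lemma gen_field_func {n i : ℤ} (D : X.Tan U n) (a : X.gr U i) :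
    (gen n (0, D) * gen i (a, 0) : X.Env U) = (n * i).negOnePow • (gen i (a, 0) * gen n (0, D)) +
      gen (n + i) (⟨Tan.app D a, by rw [add_comm]; exact Tan.app_mem D a.2⟩, 0) := by
  rw [gen_lie]
  congr 2
  refine Prod.ext (Subtype.ext ?_) (Subtype.ext (funext fun V => LinearMap.ext fun b => ?_))
  · change Tan.app D a.1 - (n * i).negOnePow • (0 : X.A U) = _
    rw [smul_zero, sub_zero]
  · change (D.1 V * (0 : Module.End (X.R V) (X.A V)) - (n * i).negOnePow •
        ((0 : Module.End (X.R V) (X.A V)) * D.1 V) : Module.End (X.R V) (X.A V)) b = 0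
    rw [mul_zero, zero_mul, smul_zero, sub_zero]; rfl

lemma gen_func_func {n i : ℤ} (b : X.gr U n) (a : X.gr U i) :
    (gen n (b, 0) * gen i (a, 0) : X.Env U) =
      (n * i).negOnePow • (gen i (a, 0) * gen n (b, 0)) := by
  rw [gen_lie]
  have h : gen (n + i) (SemiDir.bracket ((b, 0) : X.SemiDir U n) ((a, 0) : X.SemiDir U i)) = 0 := by
    rw [← gen_zero]
    congr 1
    refine Prod.ext (Subtype.ext ?_) (Subtype.ext (funext fun V => LinearMap.ext fun b => ?_))
    · change (0 : X.A U) - (n * i).negOnePow • (0 : X.A U) = 0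
      rw [smul_zero, sub_zero]
    · change ((0 : Module.End (X.R V) (X.A V)) * 0 - (n * i).negOnePow •
        ((0 : Module.End (X.R V) (X.A V)) * 0) : Module.End (X.R V) (X.A V)) b = 0
      rw [mul_zero, smul_zero, sub_zero]; rfl
  rw [h, add_zero]

/-- The action of an element `x` of degree `n` of `A ⋊ Der_R(A)` on `U ⊗_A U`; a derivation acts by
`u ⊗ v ↦ D u ⊗ v + (-1)^{n|u|} u ⊗ D v`, a function acts by multiplication. -/
noncomputable def coactGen (n : ℤ) (x : X.SemiDir U n) : Module.End ℤ (CoT X U) :=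
  ctLift ((relT X U).mkQ ∘ₗ (TensorProduct.map (LinearMap.mulLeft ℤ (gen n x)) LinearMap.id +
    TensorProduct.map (par n).toAddMonoidHom.toIntLinearMap
      (LinearMap.mulLeft ℤ (gen n (0, x.2))))) (by
    intro i a u v
    change ct (gen n x * (gen i (a, 0) * u)) v + ct (par n (gen i (a, 0) * u)) (gen n (0, x.2) * v) =
      ct (gen n x * par i u) (gen i (a, 0) * v) +
        ct (par n (par i u)) (gen n (0, x.2) * (gen i (a, 0) * v))
    have e1 := ct_rel a (gen n (x.1, 0) * u) v
    have e2 := ct_rel a (gen n (0, x.2) * u) v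
    have e3 := ct_rel a (par n u) (gen n (0, x.2) * v)
    have e4 := ct_rel (⟨Tan.app x.2 a, by rw [add_comm]; exact Tan.app_mem x.2 a.2⟩ :
      X.gr U (n + i)) u v
    rw [map_mul, par_gen] at e1 e2
    rw [gen_split n x, ← mul_assoc, ← mul_assoc (gen n (0, x.2)), add_mul, gen_field_func,
      gen_func_func, map_mul, par_gen, par_par]
    simp only [add_mul, ct_add_left, ct_add_right, smul_mul_assoc, ct_sign_left, ct_sign_right,
      mul_assoc, e1, e2, e3, e4, par_add, par_par i n, smul_smul, mul_comm i n,
      Int.units_mul_self, one_smul]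
    abel)

@[simp] lemma coactGen_ct (n : ℤ) (x : X.SemiDir U n) (u v : X.Env U) :
    coactGen n x (ct u v) = ct (gen n x * u) v + ct (par n u) (gen n (0, x.2) * v) := rfl

/-- The left action of the universal enveloping algebra on `U ⊗_A U`. -/
noncomputable def coact : X.Env U →+* Module.End ℤ (CoT X U) :=
  lift coactGen
    (fun n x y => ct_hom_ext fun u v => by
      have h : ((0, (x + y).2) : X.SemiDir U n) = (0, x.2) + (0, y.2) := by simp
      rw [LinearMap.add_apply, coactGen_ct, coactGen_ct, coactGen_ct, h, gen_add, gen_add, add_mul,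
        add_mul, ct_add_left, ct_add_right]
      abel)
    (fun m n x y => ct_hom_ext fun u v => by
      have e : coactGen (m + n) (x.bracket y) (ct u v) =
          ct (gen (m + n) (x.bracket y) * u) v +
          ct (par m (par n u)) (gen (m + n) (SemiDir.bracket (0, x.2) (0, y.2)) * v) := by
        rw [coactGen_ct, par_add]
        congr 4
        refine Prod.ext (Subtype.ext ?_) rfl
        change (0 : X.A U) = Tan.app x.2 0 - (m * n).negOnePow • Tan.app y.2 0
        rw [map_zero, map_zero, smul_zero, sub_zero]
      have h : ((m * n).negOnePow • (coactGen n y * coactGen m x) : Module.End ℤ (CoT X U)) (ct u v) =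
          (m * n).negOnePow • coactGen n y (coactGen m x (ct u v)) := by
        rcases Int.units_eq_one_or (m * n).negOnePow with h | h <;> rw [h] <;>
          simp only [one_smul, Units.neg_smul, LinearMap.neg_apply, Module.End.mul_apply]
      rw [LinearMap.add_apply, e, h, Module.End.mul_apply]
      simp only [coactGen_ct, map_add, map_mul, par_gen, ct_add_left, ct_add_right, smul_add,
        smul_mul_assoc, ct_sign_left, smul_smul, mul_comm n m, Int.units_mul_self, one_smul,
        ← mul_assoc]
      rw [gen_lie x y, gen_lie ((0, x.2) : X.SemiDir U m) ((0, y.2) : X.SemiDir U n)]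
      simp only [add_mul, ct_add_left, ct_add_right, smul_mul_assoc, ct_sign_left, ct_sign_right,
        par_par n m]
      abel)
    (fun i n a x => ct_hom_ext fun u v => by
      have e0 : gen i ((0, 0) : X.SemiDir U i) = 0 := gen_zero i
      have e := ct_rel a (par n u) (gen n (0, x.2) * v)
      rw [← par_add, ← mul_assoc, gen_smul] at e
      have e' : (SemiDir.smul a ((0, x.2) : X.SemiDir U n)) = (0, (SemiDir.smul a x).2) := by
        refine Prod.ext (Subtype.ext ?_) rfl
        exact mul_zero _
      rw [e'] at e
      simp only [Module.End.mul_apply, coactGen_ct, map_add, e0, zero_mul]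
      rw [e, ← mul_assoc, gen_smul]
      simp [ct])
    (ct_hom_ext fun u v => by
      have e0 : gen 0 ((0, 0) : X.SemiDir U 0) = 0 := gen_zero 0
      rw [coactGen_ct, gen_one, e0]
      simp [ct])

lemma coact_gen (n : ℤ) (x : X.SemiDir U n) (u v : X.Env U) :
    coact (gen n x) (ct u v) = ct (gen n x * u) v + ct (par n u) (gen n (0, x.2) * v) := by
  rw [coact, lift_gen, coactGen_ct]

/-- The coproduct of the universal enveloping algebra: it is compatible with products, functions
act by multiplication, and derivations are primitive. -/
noncomputable def coprod (u : X.Env U) : CoT X U := coact u (ct 1 1)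

lemma coprod_gen_mul (n : ℤ) (x : X.SemiDir U n) (u : X.Env U) :
    coprod (gen n x * u) = coact (gen n x) (coprod u) := by
  rw [coprod, map_mul]; rfl

variable (X U) in
/-- The degree `p` part of `U ⊗_A U`. -/
noncomputable def ctGr (p : ℤ) : AddSubgroup (CoT X U) :=
  AddSubgroup.closure {z | ∃ i j, i + j = p ∧ ∃ u ∈ gr X U i, ∃ v ∈ gr X U j, ct u v = z}

lemma ct_mem {i j : ℤ} {u v : X.Env U} (hu : u ∈ gr X U i) (hv : v ∈ gr X U j) :
    ct u v ∈ ctGr X U (i + j) := AddSubgroup.subset_closure ⟨i, j, rfl, u, hu, v, hv, rfl⟩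

lemma coprod_mem {p : ℤ} {u : X.Env U} (hu : u ∈ gr X U p) : coprod u ∈ ctGr X U p := by
  induction hu using AddSubgroup.closure_induction with
  | mem u h =>
    obtain ⟨l, rfl, rfl⟩ := h
    induction l with
    | nil =>
      have h1 : (1 : X.Env U) ∈ gr X U 0 := by simpa using mono_mem (X := X) (U := U) []
      have e : coprod (mono ([] : List (Σ n, X.SemiDir U n))) = ct 1 1 := by
        rw [mono_nil, coprod, map_one]; rfl
      rw [e]
      have h2 := ct_mem h1 h1
      rwa [add_zero] at h2
    | cons q l ih =>
      rw [mono_cons, coprod_gen_mul, List.map_cons, List.sum_cons]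
      generalize coprod (mono l) = z at ih
      generalize (l.map Sigma.fst).sum = s at ih
      induction ih using AddSubgroup.closure_induction with
      | mem z h =>
        obtain ⟨i, j, rfl, u, hu, v, hv, rfl⟩ := h
        rw [coact_gen, par_of_mem _ hu, ct_sign_left]
        refine add_mem ?_ ?_
        · exact AddSubgroup.subset_closure ⟨q.1 + i, j, by ring, _, mono_mul_mem (gen_mem _ _) hu,
            _, hv, rfl⟩
        · rw [Units.smul_def]
          refine zsmul_mem ?_ _
          exact AddSubgroup.subset_closure ⟨i, q.1 + j, by ring, _, hu,
            _, mono_mul_mem (gen_mem _ _) hv, rfl⟩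
      | zero => rw [map_zero]; exact zero_mem _
      | add x y _ _ h1 h2 => rw [map_add]; exact add_mem h1 h2
      | neg x _ h => rw [map_neg]; exact neg_mem h
  | zero => rw [coprod, map_zero]; exact zero_mem _
  | add x y _ _ h1 h2 => rw [coprod, map_add]; exact add_mem h1 h2
  | neg x _ h => rw [coprod, map_neg]; exact neg_mem h

/-- Restriction maps of `U ⊗_A U`. -/
noncomputable def ctRes (h : V ≤ U) : CoT X U →ₗ[ℤ] CoT X V :=
  ctLift ((relT X V).mkQ ∘ₗ TensorProduct.map (res h).toAddMonoidHom.toIntLinearMap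
    (res h).toAddMonoidHom.toIntLinearMap) (by
    intro i a u v
    change ct (res h (gen i (a, 0) * u)) (res h v) = ct (res h (par i u)) (res h (gen i (a, 0) * v))
    rw [map_mul, map_mul, res_gen, res_par]
    exact ct_rel _ _ _)

@[simp] lemma ctRes_ct (h : V ≤ U) (u v : X.Env U) : ctRes h (ct u v) = ct (res h u) (res h v) := rfl

lemma ctRes_coprod (h : V ≤ U) (u : X.Env U) : ctRes h (coprod u) = coprod (res h u) := by
  induction u using induction with
  | h0 => simp [coprod]
  | hadd x y h1 h2 =>
    have e : ∀ W (x y : X.Env W), coprod (x + y) = coprod x + coprod y := fun W x y => by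
      rw [coprod, map_add]; rfl
    rw [e, map_add, h1, h2, map_add, e]
  | hneg x h =>
    have e : ∀ W (x : X.Env W), coprod (-x) = -coprod x := fun W x => by
      rw [coprod, map_neg]; rfl
    rw [e, map_neg, h, map_neg, e]
  | hm l =>
    induction l with
    | nil => simp [coprod]
    | cons p l ih =>
      rw [mono_cons, coprod_gen_mul, map_mul, res_gen, coprod_gen_mul, ← ih]
      generalize coprod (mono l) = z
      induction z using ct_induction with
      | h0 => simp
      | hadd x y h1 h2 => simp only [map_add, h1, h2]
      | ht u v =>
        have e : gen p.1 ((0, (SemiDir.res h p.2).2) : X.SemiDir V p.1) =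
            res h (gen p.1 (0, p.2.2)) := by
          rw [res_gen]
          congr 1
          exact Prod.ext (Subtype.ext (map_zero (X.res h)).symm) rfl
        rw [coact_gen, map_add, ctRes_ct, ctRes_ct, ctRes_ct, coact_gen, map_mul, map_mul, res_gen,
          res_par, e]

end Env

variable (X) in
/-- Degree `n` sections over `U` of the jet algebra `J(Der_R(A)) = Hom_A(U(Der_R(A)), A)`: families
of additive maps `φ : U(Der_R(A))(V) → A(V)` of degree `n`, for `V ⊆ U`, compatible with
restriction, which are left `A`-linear: `φ(a u) = (-1)^{n|a|} a φ(u)`. -/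
noncomputable def Jet (U : ι) (n : ℤ) : AddSubgroup (∀ V : Below U, X.Env V.1 →+ X.A V.1) where
  carrier := {φ | (∀ (V W : Below U) (h : W.1 ≤ V.1) (u : X.Env V.1),
      φ W (Env.res h u) = X.res h (φ V u)) ∧
    (∀ (V : Below U) (p : ℤ) (u : X.Env V.1), u ∈ Env.gr X V.1 p → φ V u ∈ X.gr V (p + n)) ∧
    (∀ (V : Below U) (i : ℤ) (a : X.gr V.1 i) (u : X.Env V.1),
      φ V (Env.gen i (a, 0) * u) = (n * i).negOnePow • ((a : X.A V.1) * φ V u))}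
  zero_mem' := ⟨fun _ _ _ _ => by simp, fun _ _ _ _ => zero_mem _, fun _ _ _ _ => by simp⟩
  add_mem' := by
    rintro φ ψ ⟨h1, h2, h3⟩ ⟨h1', h2', h3'⟩
    refine ⟨fun V W h a => ?_, fun V i a ha => add_mem (h2 V i a ha) (h2' V i a ha),
      fun V i a u => ?_⟩
    · simp only [Pi.add_apply, AddMonoidHom.add_apply, map_add, h1, h1']
    · simp only [Pi.add_apply, AddMonoidHom.add_apply, h3, h3', mul_add, smul_add]
  neg_mem' := by
    rintro φ ⟨h1, h2, h3⟩
    refine ⟨fun V W h a => ?_, fun V i a ha => neg_mem (h2 V i a ha), fun V i a u => ?_⟩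
    · simp only [Pi.neg_apply, AddMonoidHom.neg_apply, map_neg, h1]
    · simp only [Pi.neg_apply, AddMonoidHom.neg_apply, h3, mul_neg, smul_neg]

namespace Jet
open Env
variable {U V : ι}

/-- The map `u ⊗ v ↦ (-1)^{n|u|} φ(u) ψ(v)` on `U ⊗_A U`, for `ψ` of degree `n`. -/
noncomputable def conv {m n : ℤ} (φ : X.Jet U m) (ψ : X.Jet U n) (V : Below U) :
    CoT X V.1 →ₗ[ℤ] X.A V.1 :=
  ctLift (LinearMap.mul' ℤ (X.A V.1) ∘ₗ
    TensorProduct.map ((φ.1 V).comp (par n).toAddMonoidHom).toIntLinearMap (ψ.1 V).toIntLinearMap) (by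
    intro i a u v
    change φ.1 V (par n (gen i (a, 0) * u)) * ψ.1 V v =
      φ.1 V (par n (par i u)) * ψ.1 V (gen i (a, 0) * v)
    induction u using Env.induction with
    | h0 => simp
    | hadd x y h1 h2 => simp only [mul_add, map_add, add_mul, h1, h2]
    | hneg x h => simp only [mul_neg, map_neg, neg_mul, h]
    | hm l =>
      have hl : mono l ∈ Env.gr X V.1 (l.map Sigma.fst).sum := mono_mem l
      have hd := φ.2.2.1 V _ _ hl
      generalize (l.map Sigma.fst).sum = s at *
      generalize mono l = u at *
      have e := X.comm V a.2 hd
      rw [map_mul, par_gen, par_of_mem i hl, par_of_mem n hl, map_sign (par n), par_of_mem n hl,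
        smul_mul_smul_comm, map_sign, map_sign, map_sign, φ.2.2.2, ψ.2.2.2, e]
      simp only [smul_mul_assoc, mul_smul_comm, smul_smul, mul_assoc, ← Int.negOnePow_add]
      congr 1
      rw [Int.negOnePow_eq_iff]
      exact ⟨m * i, by ring⟩)

lemma conv_ct {m n : ℤ} (φ : X.Jet U m) (ψ : X.Jet U n) (V : Below U) (u v : X.Env V.1) :
    conv φ ψ V (ct u v) = φ.1 V (par n u) * ψ.1 V v := rfl

lemma conv_mem {m n : ℤ} (φ : X.Jet U m) (ψ : X.Jet U n) (V : Below U) {p : ℤ} {z : CoT X V.1}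
    (hz : z ∈ ctGr X V.1 p) : conv φ ψ V z ∈ X.gr V (p + (m + n)) := by
  induction hz using AddSubgroup.closure_induction with
  | mem z h =>
    obtain ⟨i, j, rfl, u, hu, v, hv, rfl⟩ := h
    rw [conv_ct, par_of_mem n hu, map_sign, smul_mul_assoc, Units.smul_def]
    refine zsmul_mem ?_ _
    convert SetLike.mul_mem_graded (φ.2.2.1 V _ _ hu) (ψ.2.2.1 V _ _ hv) using 1
    ring_nf
  | zero => rw [map_zero]; exact zero_mem _
  | add x y _ _ h1 h2 => rw [map_add]; exact add_mem h1 h2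
  | neg x _ h => rw [map_neg]; exact neg_mem h

lemma conv_res {m n : ℤ} (φ : X.Jet U m) (ψ : X.Jet U n) (V W : Below U) (h : W.1 ≤ V.1)
    (z : CoT X V.1) : conv φ ψ W (ctRes h z) = X.res h (conv φ ψ V z) := by
  induction z using ct_induction with
  | h0 => simp
  | hadd x y h1 h2 => simp only [map_add, h1, h2]
  | ht u v => rw [ctRes_ct, conv_ct, conv_ct, ← res_par, φ.2.1 V W h, ψ.2.1 V W h, map_mul]

lemma conv_func {m n : ℤ} (φ : X.Jet U m) (ψ : X.Jet U n) (V : Below U) (i : ℤ) (a : X.gr V.1 i)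
    (z : CoT X V.1) : conv φ ψ V (coact (gen i (a, 0)) z) =
      ((m + n) * i).negOnePow • ((a : X.A V.1) * conv φ ψ V z) := by
  induction z using ct_induction with
  | h0 => simp
  | hadd x y h1 h2 => simp only [map_add, h1, h2, mul_add, smul_add]
  | ht u v =>
    have e0 : gen i ((0, 0) : X.SemiDir V.1 i) = 0 := gen_zero i
    have e1 : ct (par i u) (0 : X.Env V.1) = 0 := by simp [ct]
    rw [coact_gen, e0, zero_mul, e1, add_zero, conv_ct, conv_ct, map_mul, par_gen, smul_mul_assoc,
      map_sign, φ.2.2.2, smul_smul, smul_mul_assoc, mul_assoc, ← Int.negOnePow_add, ← add_mul,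
      add_comm n m]

/-- The product of the jet algebra, given by the coproduct of the universal enveloping algebra:
`(φ ψ)(u) = ∑ (-1)^{|ψ||u'|} φ(u') ψ(u'')` if `u ↦ ∑ u' ⊗ u''`. -/
noncomputable def mul {m n : ℤ} (φ : X.Jet U m) (ψ : X.Jet U n) : X.Jet U (m + n) :=
  ⟨fun V => (conv φ ψ V).toAddMonoidHom.comp
    ((LinearMap.applyₗ (ct 1 1)).toAddMonoidHom.comp (coact (X := X)).toAddMonoidHom),
   fun V W h u => by
    change conv φ ψ W (coprod (Env.res h u)) = X.res h (conv φ ψ V (coprod u))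
    rw [← ctRes_coprod, conv_res], fun V p u hu => conv_mem φ ψ V (coprod_mem hu),
   fun V i a u => by
    change conv φ ψ V (coprod (gen i (a, 0) * u)) = _ • (_ * conv φ ψ V (coprod u))
    rw [coprod_gen_mul, conv_func]⟩

lemma mul_apply {m n : ℤ} (φ : X.Jet U m) (ψ : X.Jet U n) (V : Below U) (u : X.Env V.1) :
    (mul φ ψ).1 V u = conv φ ψ V (coprod u) := rfl

/-- The differential of the jet algebra: `(dφ)(u) = d(φ(u)) - (-1)^{|φ|} φ(d u)`. -/
noncomputable def diff {n : ℤ} (φ : X.Jet U n) : X.Jet U (n + 1) :=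
  ⟨fun V => (X.d V.1).toAddMonoidHom.comp (φ.1 V) - n.negOnePow • (φ.1 V).comp Env.diff, by
    have key : ∀ (V : Below U) u, ((X.d V.1).toAddMonoidHom.comp (φ.1 V) -
        n.negOnePow • (φ.1 V).comp Env.diff) u =
        X.d V.1 (φ.1 V u) - n.negOnePow • φ.1 V (Env.diff u) := by
      intro V u
      rcases Int.units_eq_one_or n.negOnePow with h | h <;> rw [h] <;> simp
    refine ⟨fun V W h u => ?_, fun V p u hu => ?_, fun V i a u => ?_⟩
    · rw [key, key, ← res_diff, φ.2.1 V W h, φ.2.1 V W h, X.d_res, map_sub, map_sign]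
    · rw [key, ← add_assoc]
      refine sub_mem ((X.d_der V).deg (φ.2.2.1 V _ _ hu)) ?_
      rw [Units.smul_def, add_right_comm]
      exact zsmul_mem (φ.2.2.1 V _ _ (diff_mem hu)) _
    · rw [key, key, diff_func_mul, φ.2.2.2, map_add, map_sign (X.d V.1), map_sign (φ.1 V), φ.2.2.2,
        φ.2.2.2,
        (X.d_der V).leib _ a.2, mul_sub, smul_sub, smul_add, smul_add, mul_add, add_mul]
      simp only [Int.negOnePow_add, mul_smul_comm, smul_smul, mul_one, one_mul]
      generalize (n * i).negOnePow = c1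
      generalize i.negOnePow = c2
      generalize n.negOnePow = c3
      rcases Int.units_eq_one_or c1 with rfl | rfl <;> rcases Int.units_eq_one_or c2 with rfl | rfl <;>
      rcases Int.units_eq_one_or c3 with rfl | rfl <;>
      · simp only [one_smul, Units.neg_smul, mul_one, mul_neg, neg_mul, neg_neg]
        abel⟩

lemma diff_apply {n : ℤ} (φ : X.Jet U n) (V : Below U) (u : X.Env V.1) :
    (diff φ).1 V u = X.d V.1 (φ.1 V u) - n.negOnePow • φ.1 V (Env.diff u) := by
  change ((X.d V.1).toAddMonoidHom.comp (φ.1 V) - n.negOnePow • (φ.1 V).comp Env.diff) u = _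
  rcases Int.units_eq_one_or n.negOnePow with h | h <;> rw [h] <;> simp

/-- The structure map `A ⊗_R A → J`: the jet `u ↦ (-1)^{|u||b|} a u(b)` of `a ⊗ b`. -/
noncomputable def ofTensor {i j : ℤ} (a : X.gr U i) (b : X.gr U j) : X.Jet U (i + j) :=
  ⟨fun V => (AddMonoidHom.mulLeft (X.res V.2 (a : X.A U))).comp
    (((LinearMap.applyₗ (X.res V.2 (b : X.A U))).toAddMonoidHom.comp (act (X := X)).toAddMonoidHom).comp
      (par j).toAddMonoidHom), by
    refine ⟨fun V W h u => ?_, fun V p u hu => ?_, fun V k c u => ?_⟩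
    · change X.res W.2 a.1 * act (par j (Env.res h u)) (X.res W.2 b.1) =
        X.res h (X.res V.2 a.1 * act (par j u) (X.res V.2 b.1))
      rw [map_mul, ← act_res, res_par, X.res_trans, X.res_trans]
    · change X.res V.2 a.1 * act (par j u) (X.res V.2 b.1) ∈ _
      rw [par_of_mem j hu, map_sign act]
      have e : ((j * p).negOnePow • act u : Module.End (X.R V.1) (X.A V.1)) (X.res V.2 b.1) =
        (j * p).negOnePow • act u (X.res V.2 b.1) := by
        rcases Int.units_eq_one_or (j * p).negOnePow with h | h <;> rw [h] <;> simp
      rw [e, mul_smul_comm, Units.smul_def]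
      refine zsmul_mem ?_ _
      convert SetLike.mul_mem_graded (X.res_mem V.2 a.2) (act_mem hu (X.res_mem V.2 b.2)) using 1
      ring_nf
    · change X.res V.2 a.1 * act (par j (gen k (c, 0) * u)) (X.res V.2 b.1) = _ •
        ((c : X.A V.1) * (X.res V.2 a.1 * act (par j u) (X.res V.2 b.1)))
      have hc := X.comm V (X.res_mem V.2 a.2) c.2
      have e : ∀ (s : ℤˣ) (f : Module.End (X.R V.1) (X.A V.1)) x, (s • f) x = s • f x := by
        intro s f x
        rcases Int.units_eq_one_or s with h | h <;> rw [h] <;> simp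
      rw [map_mul, par_gen, map_mul, map_sign, Module.End.mul_apply, e, act_gen, ← mul_assoc,
        mul_smul_comm]
      simp only [mul_add, Tan.app]
      change _ • (_ + X.res V.2 a.1 * 0) = _
      rw [mul_zero, add_zero, ← mul_assoc, hc, smul_mul_assoc, smul_smul, ← Int.negOnePow_add,
        ← add_mul, add_comm j i, mul_assoc]⟩

lemma ofTensor_apply {i j : ℤ} (a : X.gr U i) (b : X.gr U j) (V : Below U) (u : X.Env V.1) :
    (ofTensor a b).1 V u = X.res V.2 a.1 * act (par j u) (X.res V.2 b.1) := rfl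

/-- Restriction of jets to a smaller open set. -/
noncomputable def res (h : V ≤ U) {n : ℤ} (φ : X.Jet U n) : X.Jet V n :=
  ⟨fun W => φ.1 ⟨W.1, W.2.trans h⟩, fun V' W' => φ.2.1 ⟨V'.1, V'.2.trans h⟩ ⟨W'.1, W'.2.trans h⟩,
    fun W => φ.2.2.1 ⟨W.1, W.2.trans h⟩, fun W => φ.2.2.2 ⟨W.1, W.2.trans h⟩⟩

end Jet

end DGSheaf
section Scheme
open AlgebraicGeometry CategoryTheory

variable {Y : Scheme.{u}}

/-- A sheaf of modules is locally free of finite rank if every point has an open neighbourhood `U`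
with sections `b₁, …, bₙ` over `U` whose restrictions form a basis of `Γ(M, V)` for every open
`V ⊆ U`. -/
def IsLocallyFree (M : Y.Modules) : Prop :=
  ∀ y : Y, ∃ U : Y.Opens, y ∈ U ∧ ∃ (n : ℕ) (b : Fin n → Γ(M, U)), ∀ (V : Y.Opens) (h : V ≤ U),
    Function.Bijective fun c : Fin n → Γ(Y, V) =>
      ∑ i, c i • (M.presheaf.map (homOfLE h).op (b i) : Γ(M, V))

/-- Restriction of sections of `O_Y`. -/
noncomputable def resO {U V : Y.Opens} (h : V ≤ U) : Γ(Y, U) →+* Γ(Y, V) :=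
  (Y.presheaf.map (homOfLE h).op).hom

lemma resO_refl (U : Y.Opens) (r : Γ(Y, U)) : resO (le_refl U) r = r := by
  simp [resO]

lemma resO_trans {U V W : Y.Opens} (h : V ≤ U) (h' : W ≤ V) (r : Γ(Y, U)) :
    resO h' (resO h r) = resO (h'.trans h) r := by
  have : (homOfLE (h'.trans h)).op = (homOfLE h).op ≫ (homOfLE h').op := rfl
  simp [resO, this]

/-- Restriction of sections of a sheaf of modules. -/
noncomputable def resM (M : Y.Modules) {U V : Y.Opens} (h : V ≤ U) :
    Γ(M, U) →ₛₗ[resO h] Γ(M, V) where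
  toFun x := M.presheaf.map (homOfLE h).op x
  map_add' x y := map_add _ x y
  map_smul' r x := M.map_smul (homOfLE h) r x

lemma resM_refl (M : Y.Modules) (U : Y.Opens) (x : Γ(M, U)) : resM M (le_refl U) x = x := by
  simp [resM]

lemma resM_trans (M : Y.Modules) {U V W : Y.Opens} (h : V ≤ U) (h' : W ≤ V) (x : Γ(M, U)) :
    resM M h' (resM M h x) = resM M (h'.trans h) x := by
  have : (homOfLE (h'.trans h)).op = (homOfLE h).op ≫ (homOfLE h').op := rfl
  change M.presheaf.map (homOfLE h').op (M.presheaf.map (homOfLE h).op x) =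
    M.presheaf.map (homOfLE (h'.trans h)).op x
  rw [this, M.presheaf.map_comp]; rfl

/-- The sections over an affine open set `U` of the graded algebra `S_{O_Y}(E[1])`, for the graded
sheaf of modules `E` with `E n` in degree `-n`. -/
abbrev SymE (E : ℕ → Y.Modules) (U : Y.Opens) : Type u := GSym Γ(Y, U) (fun n => Γ(E n, U))

/-- Restriction maps of `S_{O_Y}(E[1])`. -/
noncomputable def resS (E : ℕ → Y.Modules) {U V : Y.Opens} (h : V ≤ U) : SymE E U →+* SymE E V :=
  GSym.map (resO h) fun n => resM (E n) h

lemma GSym.hom_ext {R : Type u} [CommRing R] {M : ℕ → Type u} [∀ n, AddCommGroup (M n)]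
    [∀ n, Module R (M n)] {S : Type*} [Ring S] {f g : GSym R M →+* S}
    (h0 : ∀ r, f (algebraMap R _ r) = g (algebraMap R _ r))
    (h : ∀ p, f (GSym.gen R p) = g (GSym.gen R p)) (x : GSym R M) : f x = g x := by
  induction x using DirectSum.Decomposition.inductionOn (GSym.gr R M) with
  | zero => rw [map_zero, map_zero]
  | add x y h1 h2 => rw [map_add, map_add, h1, h2]
  | homogeneous x =>
    obtain ⟨x, hx⟩ := x
    change f x = g x
    induction hx using Submodule.span_induction with
    | mem x h' =>
      obtain ⟨l, -, rfl⟩ := h'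
      rw [map_list_prod, map_list_prod, List.map_map, List.map_map]
      congr 1
      exact List.map_congr_left fun p _ => h p
    | zero => rw [map_zero, map_zero]
    | add x y _ _ h1 h2 => rw [map_add, map_add, h1, h2]
    | smul r x _ h1 => rw [Algebra.smul_def, map_mul, map_mul, h0, h1]

lemma resS_refl (E : ℕ → Y.Modules) (U : Y.Opens) (x : SymE E U) : resS E (le_refl U) x = x := by
  change resS E (le_refl U) x = RingHom.id _ x
  refine GSym.hom_ext (fun r => ?_) (fun p => ?_) x
  · rw [resS, GSym.map_algebraMap, resO_refl]; rfl
  · rw [resS, GSym.map_gen, resM_refl]; rfl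

lemma resS_trans (E : ℕ → Y.Modules) {U V W : Y.Opens} (h : V ≤ U) (h' : W ≤ V) (x : SymE E U) :
    resS E h' (resS E h x) = resS E (h'.trans h) x := by
  change ((resS E h').comp (resS E h)) x = _
  refine GSym.hom_ext (fun r => ?_) (fun p => ?_) x
  · rw [RingHom.comp_apply, resS, resS, resS, GSym.map_algebraMap, GSym.map_algebraMap,
      GSym.map_algebraMap, resO_trans]
  · rw [RingHom.comp_apply, resS, resS, resS, GSym.map_gen, GSym.map_gen, GSym.map_gen, resM_trans]

/-- An `O_Y`-linear differential on the sheaf of graded algebras `S_{O_Y}(E[1])`: a derivation of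
degree one and of square zero, given on the affine open sets of `Y` (on which the sheaf is
determined by its sections). -/
structure Differential (E : ℕ → Y.Modules) where
  d : ∀ U : Y.affineOpens, SymE E U.1 →ₗ[Γ(Y, U.1)] SymE E U.1
  d_der : ∀ U, Square.IsGradedDer (𝒜 := GSym.gr Γ(Y, U.1) (fun n => Γ(E n, U.1))) (d U)
  d_d : ∀ U a, d U (d U a) = 0
  d_res : ∀ {U V : Y.affineOpens} (h : V.1 ≤ U.1) (a : SymE E U.1),
    d V (resS E h a) = resS E h (d U a)

/-- The structure sheaf `(S_{O_Y}(E[1]), Q)` of the dg-scheme over `Y` defined by `E` and `Q`, as a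
sheaf on the affine open sets of `Y`. -/
noncomputable def structureSheaf (E : ℕ → Y.Modules) (Q : Differential E) :
    DGSheaf Y.affineOpens where
  R U := Γ(Y, U.1)
  A U := SymE E U.1
  gr U := GSym.gr Γ(Y, U.1) (fun n => Γ(E n, U.1))
  comm _ _ _ _ _ ha hb := GSym.graded_comm _ _ ha hb
  resR h := resO h
  res h := resS E h
  resR_refl U := resO_refl U.1
  resR_trans h h' := resO_trans h h'
  res_refl U := resS_refl E U.1
  res_trans h h' := resS_trans E h h'
  res_algebraMap _ r := GSym.map_algebraMap _ _ r
  res_mem _ _ _ ha := GSym.map_mem _ _ ha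
  d := Q.d
  d_der := Q.d_der
  d_d := Q.d_d
  d_res := Q.d_res

end Scheme

namespace DGSheaf
variable {ι : Type u} [Preorder ι] (X : DGSheaf ι)

/-- Degree `n` sections over `U` of the completed formal neighbourhood of the diagonal
`O_Δ^{(∞)} = lim_k (A ⊗_R A)/J^{k+1}`. (For `structureSheaf`, each degree of the sheaves
`(A ⊗_R A)/J^{k+1}` is quasi-coherent, so that over an affine open set the sections of the quotient
are the quotient of the sections, and the sections of the limit are the limit of the sections.) -/
abbrev Formal (U : ι) (n : ℤ) : Type u := Square.Completion (X.comm U) n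

variable {X} {U V : ι}

/-- The image in `O_Δ^{(∞)}` of the element `a ⊗ b` of `A ⊗_R A`. -/
noncomputable def Formal.ofTensor {i j : ℤ} (a : X.gr U i) (b : X.gr U j) : X.Formal U (i + j) :=
  Square.Completion.of (X.comm U) (Square.tmul (X.gr U) a b) (Square.tmul_mem _ a.2 b.2)

/-- The product of `O_Δ^{(∞)}`. -/
noncomputable def Formal.mul {m n : ℤ} (x : X.Formal U m) (y : X.Formal U n) :
    X.Formal U (m + n) := Square.Completion.mul (X.comm U) x y

/-- The differential of `O_Δ^{(∞)}`, induced by that of `A ⊗_R A`. -/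
noncomputable def Formal.diff {n : ℤ} (x : X.Formal U n) : X.Formal U (n + 1) :=
  Square.Completion.diff (X.comm U) (X.d_der U) x

/-- Restriction maps of `O_Δ^{(∞)}`. -/
noncomputable def Formal.res (h : V ≤ U) {n : ℤ} (x : X.Formal U n) : X.Formal V n :=
  Square.Completion.map (X.comm U) (X.comm V) (X.resR h) (X.res h) (X.res_algebraMap h)
    (fun _ _ ha => X.res_mem h ha) x

end DGSheaf

end DGJet

open AlgebraicGeometry DGJet DGSheaf

/-!
Write `A` for the sections of `S_{O_Y}(E[1])` over an affine open set and `R` for the functions on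
it. All generators of `A` have negative degree, so `A` is concentrated in nonpositive degrees with
`A⁰ = R`, and the ideal of the diagonal sits in negative degrees. Its `k`-th power then sits in
degrees at most `-k`, and in each single degree the completion is `A ⊗_R A` itself
(`Square.Completion.ofHom_bijective`). It remains to show that the map from `A ⊗_R A` to jets,
`a ⊗ b ↦ (u ↦ ± a u(b))`, is an isomorphism in each degree. Its compatibility with products,
differentials and restrictions is formal (`toJet_mul`, `toJet_diff`, `toJet_res`, `toJet_tmul`);
the point is its bijectivity (`toJet_bijective`).

The sections of each `E n` over an affine open set have a finite dual basis, compatible with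
restriction (`IsLocallyFree.exists_frame`). As a derivation of `S_R(E[1])` may be prescribed on the
generators (`GSym.exists_derivation`), a dual basis gives coordinate derivations `∂/∂x` of positive
degree, and the Euler vector field `∑ x ∂/∂x`, which counts generators. Right translation of jets
by a derivation `v` corresponds to the operator `1 ⊗ v` on `A ⊗_R A` (`trans_jetFun`) and raises
the degree by that of `v`. There is nothing in positive degrees, so one can argue by descending
induction on the degree: what is known about the translates by the coordinate derivations gives
information on the translate by the Euler vector field, from which an element is recovered, up to
its part without generators, on dividing by the number of generators. This is possible in
characteristic zero, and gives injectivity (`eq_zero_of_jetFun`) and surjectivity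
(`exists_jetFun_eq`), as in the proof of the Poincaré lemma.

For surjectivity one has to know that a jet which vanishes at `1`, together with all its translates
by coordinate derivations, is zero (`Jet.eq_zero_of_stable`). If infinitely many `E n` are nonzero,
a derivation is an infinite combination of coordinate derivations, and linearity does not suffice.
Suppose that over an open set there are coprime functions `a` and `b` such that no nonzero function
is divisible by all powers of `a`, or by all powers of `b`. Write `1 = a ^ m * s m + b ^ m * t m`
for every `m` and split a derivation into two parts, whose coefficients at the generators of `E m`
are divisible by `a ^ m` and by `b ^ m`. Modulo `a ^ N` the first part is a finite combination of
coordinate derivations, so a jet that vanishes on these takes a value on the first part that is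
divisible by all `a ^ N`, hence zero; similarly for the second part (`Jet.apply_vf_mul`). Such `a`
and `b` exist, by Krull's intersection theorem, if the functions form a finitely generated domain
over `k` that is not a field (`isField_or_exists_isCoprime`). Since `Y` is reduced, a function is
zero if it is zero on all affine open sets that either are of this kind or consist of one isolated
point (`exists_basicOpen_resO_ne_zero`); over the latter only finitely many `E n` are nonzero by
hypothesis.

The argument is carried out for any sheaf of dg-algebras with the properties collected in
`SymStructure`, which `nonempty_symStructure` establishes for `S_{O_Y}(E[1])`.
-/

/-! ### Sheaves of graded symmetric algebras and their enveloping algebras -/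

namespace DGJet
namespace DGSheaf

variable {ι : Type u} [Preorder ι] {X : DGSheaf ι}

/-- A dual basis over `U` for the generators `G` of `A`: finitely many generators `x m j` in each
degree and derivations `vf m j`, playing the role of `∂/∂(x m j)`, such that
`∑ j, vf m j g * x m j = g` for the generators `g` over the open subsets of `U`. The `x m j` need
not be linearly independent, so that such a family exists when the module of generators is finite
projective. -/
structure Frame (X : DGSheaf ι) (G : ∀ U, ℕ → Set (X.A U)) (U : ι) where
  /-- The number of generators of degree `-m - 1`. -/
  J : ℕ → ℕ
  x : ∀ m, Fin (J m) → X.A U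
  x_mem : ∀ m j, x m j ∈ G U m
  vf : ∀ m, Fin (J m) → X.Tan U ((m : ℤ) + 1)
  vf_ne : ∀ (V : Below U) (m m' : ℕ) (j : Fin (J m)), m' ≠ m → ∀ g ∈ G V.1 m', (vf m j).1 V g = 0
  vf_range : ∀ (V : Below U) (m m' : ℕ) (j : Fin (J m)), ∀ g ∈ G V.1 m',
    ∃ r, (vf m j).1 V g = algebraMap (X.R V.1) (X.A V.1) r
  sum : ∀ (V : Below U) (m : ℕ), ∀ g ∈ G V.1 m, ∑ j, (vf m j).1 V g * X.res V.2 (x m j) = g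

/-- An open set is thin if the ring of functions on it has two coprime elements to whose powers
no nonzero function is infinitely divisible, or if there are no generators of large degree on it. -/
def Thin (X : DGSheaf ι) (G : ∀ U, ℕ → Set (X.A U)) (V : ι) : Prop :=
  (∃ a b : X.R V, IsCoprime a b ∧ (∀ r, (∀ n : ℕ, a ^ n ∣ r) → r = 0) ∧
    ∀ r, (∀ n : ℕ, b ^ n ∣ r) → r = 0) ∨
  ∃ N : ℕ, ∀ V' ≤ V, ∀ m ≥ N, ∀ g ∈ G V' m, g = 0

/-- The properties of the sheaf of algebras `S_{O_Y}(E[1])` on which the comparison of formal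
functions and jets depends, expressed through the generating sections `G U m` of `E m`. -/
structure SymStructure (X : DGSheaf ι) where
  /-- The sections of `E m`, which have degree `-m - 1`. -/
  G : ∀ U, ℕ → Set (X.A U)
  deg : ∀ {U m g}, g ∈ G U m → g ∈ X.gr U (genDeg m)
  span : ∀ {U d s}, s ∈ X.gr U d → s ∈ Submodule.span (X.R U)
    {x | ∃ l : List (Σ m, G U m), (l.map fun p => genDeg p.1).sum = d ∧
      (l.map fun p => (p.2 : X.A U)).prod = x}
  algebraMap_injective : ∀ U, Function.Injective (algebraMap (X.R U) (X.A U))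
  isUnit_natCast : ∀ U (n : ℕ), n ≠ 0 → IsUnit (n : X.R U)
  /-- The algebra is graded by the number of generators. -/
  weight : ∀ U (c : ℕ → X.R U), ∃ W : X.A U →ₗ[X.R U] X.A U, ∀ l : List (Σ m, G U m),
    W (l.map fun p => (p.2 : X.A U)).prod = c l.length • (l.map fun p => (p.2 : X.A U)).prod
  /-- The coefficients of a derivation may be multiplied by functions, independently for the
  different `E m`. With infinitely many nonzero `E m` this is not a consequence of the `A`-module
  structure. -/
  scale : ∀ {U p} (c : ℕ → X.R U) (D : X.Tan U p), ∃ D' : X.Tan U p, ∀ (V : Below U) m,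
    ∀ g ∈ G V.1 m, D'.1 V g = X.resR V.2 (c m) • D.1 V g
  frame : ∀ U, Frame X G U
  /-- Functions are determined by their restrictions to the thin open sets. -/
  detect : ∀ {U} (r : X.R U), (∀ V (h : V ≤ U), Thin X G V → X.resR h r = 0) → r = 0

variable (S : SymStructure X)

namespace SymStructure
variable {U : ι}

/-- A product of generators. -/
def gprod (l : List (Σ m, S.G U m)) : X.A U := (l.map fun p => (p.2 : X.A U)).prod

lemma gprod_nil : S.gprod ([] : List (Σ m, S.G U m)) = 1 := rfl

lemma gprod_cons (p : Σ m, S.G U m) (l : List (Σ m, S.G U m)) :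
    S.gprod (p :: l) = p.2 * S.gprod l := by simp [gprod]

/-- The degree of a product of generators. -/
def gdeg (l : List (Σ m, S.G U m)) : ℤ := (l.map fun p => genDeg p.1).sum

lemma gdeg_cons (p : Σ m, S.G U m) (l : List (Σ m, S.G U m)) :
    S.gdeg (p :: l) = genDeg p.1 + S.gdeg l := by simp [gdeg]

lemma gdeg_le (l : List (Σ m, S.G U m)) : S.gdeg l ≤ -(l.length : ℤ) := by
  induction l with
  | nil => simp [gdeg]
  | cons p l ih =>
    rw [gdeg_cons, List.length_cons, genDeg]
    push_cast
    omega

lemma lt_of_mem {l : List (Σ m, S.G U m)} {M : ℕ} (h : -(M : ℤ) ≤ S.gdeg l) :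
    ∀ p ∈ l, p.1 < M := by
  induction l generalizing M with
  | nil => simp
  | cons p l ih =>
    have h1 := S.gdeg_le l
    rw [gdeg_cons, genDeg] at h
    intro q hq
    rcases List.mem_cons.1 hq with rfl | hq
    · omega
    · exact ih (by omega) q hq

lemma gprod_mem (l : List (Σ m, S.G U m)) : S.gprod l ∈ X.gr U (S.gdeg l) := by
  induction l with
  | nil => exact SetLike.one_mem_graded _
  | cons p l ih => rw [gprod_cons, gdeg_cons]; exact SetLike.mul_mem_graded (S.deg p.2.2) ih

/-- Induction over the products of generators of a given degree. -/
lemma gr_induction {d : ℤ} {P : X.A U → Prop} (h0 : P 0) (hadd : ∀ x y, P x → P y → P (x + y))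
    (hsmul : ∀ (r : X.R U) x, P x → P (r • x)) (hl : ∀ l, S.gdeg l = d → P (S.gprod l))
    {s : X.A U} (hs : s ∈ X.gr U d) : P s := by
  have h := S.span hs
  clear hs
  induction h using Submodule.span_induction with
  | mem x h => obtain ⟨l, h1, rfl⟩ := h; exact hl l h1
  | zero => exact h0
  | add x y _ _ h1 h2 => exact hadd _ _ h1 h2
  | smul r x _ h => exact hsmul r x h

lemma eq_zero_of_pos (S : SymStructure X) {d : ℤ} (hd : 0 < d) {s : X.A U}
    (hs : s ∈ X.gr U d) : s = 0 := by
  refine S.gr_induction (P := fun s : X.A U => s = 0) rfl (fun x y hx hy => by rw [hx, hy, add_zero])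
    (fun r x hx => by rw [hx, smul_zero]) (fun l hl => ?_) hs
  have := S.gdeg_le l
  omega

lemma exists_algebraMap (S : SymStructure X) {s : X.A U} (hs : s ∈ X.gr U 0) :
    ∃ r, s = algebraMap (X.R U) _ r := by
  refine S.gr_induction (P := fun s => ∃ r, s = algebraMap (X.R U) _ r) ⟨0, by simp⟩ ?_ ?_ ?_ hs
  · rintro _ _ ⟨r, rfl⟩ ⟨r', rfl⟩; exact ⟨r + r', by simp⟩
  · rintro r _ ⟨r', rfl⟩; exact ⟨r * r', by simp [Algebra.smul_def]⟩
  · intro l hl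
    have := S.gdeg_le l
    have h : l = [] := List.length_eq_zero_iff.1 (by omega)
    subst h
    exact ⟨1, by simp [gprod_nil]⟩

end SymStructure

namespace Tan
variable {U : ι} {p : ℤ}

lemma map_one (D : X.Tan U p) (V : Below U) : D.1 V 1 = 0 := by
  have h := D.2.2.2 V 0 1 1 (SetLike.one_mem_graded _)
  simpa using h

lemma map_algebraMap (D : X.Tan U p) (V : Below U) (r : X.R V.1) :
    D.1 V (algebraMap (X.R V.1) (X.A V.1) r) = 0 := by
  rw [Algebra.algebraMap_eq_smul_one, map_smul, map_one, smul_zero]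

/-- A derivation is determined, on the part of `A` of degree at least `-M`, by its values on the
generators of degree at least `-M`. -/
lemma eq_of_gen_le (D D' : X.Tan U p) (V : Below U) (M : ℕ)
    (h : ∀ m < M, ∀ g ∈ S.G V.1 m, D.1 V g = D'.1 V g) {q : ℤ} (hq : -(M : ℤ) ≤ q) {s : X.A V.1}
    (hs : s ∈ X.gr V.1 q) : D.1 V s = D'.1 V s := by
  refine S.gr_induction (P := fun s => D.1 V s = D'.1 V s) (by simp)
    (fun x y h1 h2 => by simp [h1, h2])
    (fun r x h1 => by simp [h1]) (fun l hl => ?_) hs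
  have hM := S.lt_of_mem (hl ▸ hq)
  clear hl
  induction l with
  | nil => rw [S.gprod_nil, map_one, map_one]
  | cons a l ih =>
    rw [S.gprod_cons, D.2.2.2 V _ _ _ (S.deg a.2.2), D'.2.2.2 V _ _ _ (S.deg a.2.2),
      ih fun q hq => hM q (List.mem_cons_of_mem _ hq),
      h _ (hM a (List.mem_cons_self ..)) _ a.2.2]

lemma ext_gen {D D' : X.Tan U p} (h : ∀ (V : Below U) m, ∀ g ∈ S.G V.1 m, D.1 V g = D'.1 V g) :
    D = D' := by
  refine Subtype.ext (funext fun V => LinearMap.ext fun a => ?_)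
  induction a using DirectSum.Decomposition.inductionOn (X.gr V.1) with
  | zero => simp
  | add x y h1 h2 => simp [h1, h2]
  | @homogeneous i a =>
    exact eq_of_gen_le S D D' V i.natAbs (fun m _ => h V m) (by omega) a.2

/-- A derivation of degree `p`, seen as a derivation of degree `q = p`. -/
def cast {q : ℤ} (h : p = q) (D : X.Tan U p) : X.Tan U q := ⟨D.1, h ▸ D.2⟩

end Tan

namespace Env
variable {U V : ι}

/-- A function, as an element of the universal enveloping algebra. -/
noncomputable def fn {i : ℤ} (a : X.gr U i) : X.Env U := gen i (a, 0)

/-- A vector field, as an element of the universal enveloping algebra. -/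
noncomputable def vf {n : ℤ} (D : X.Tan U n) : X.Env U := gen n (0, D)

lemma gen_eq (n : ℤ) (x : X.SemiDir U n) : gen n x = fn x.1 + vf x.2 := gen_split n x

lemma vf_add {n : ℤ} (D D' : X.Tan U n) : vf (D + D') = vf D + vf D' := by
  rw [vf, vf, vf, ← gen_add]; simp

/-- The map from vector fields of degree `n` to the universal enveloping algebra. -/
noncomputable def vfHom (U : ι) (n : ℤ) : X.Tan U n →+ X.Env U := AddMonoidHom.mk' vf vf_add

lemma vf_sum {n : ℤ} {κ : Type*} (s : Finset κ) (D : κ → X.Tan U n) :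
    vf (∑ i ∈ s, D i) = ∑ i ∈ s, vf (D i) := map_sum (vfHom U n) D s

lemma vf_cast {n q : ℤ} (h : n = q) (D : X.Tan U n) : vf (Tan.cast h D) = vf D := by
  subst h; rfl

lemma fn_mul_vf {i n : ℤ} (a : X.gr U i) (D : X.Tan U n) : fn a * vf D = vf (Tan.smul a D) := by
  rw [fn, vf, gen_smul]
  congr 1
  exact Prod.ext (Subtype.ext (mul_zero _)) rfl

lemma fn_mul_fn {i j : ℤ} (a : X.gr U i) (b : X.gr U j) :
    fn a * fn b = fn (⟨a * b, SetLike.mul_mem_graded a.2 b.2⟩ : X.gr U (i + j)) := by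
  rw [fn, fn, gen_smul]
  congr 1
  refine Prod.ext rfl (Subtype.ext (funext fun V => LinearMap.ext fun b => ?_))
  exact mul_zero _

lemma vf_mul_fn {n i : ℤ} (D : X.Tan U n) (a : X.gr U i) :
    vf D * fn a = (n * i).negOnePow • (fn a * vf D) +
      fn (⟨Tan.app D a, by rw [add_comm]; exact Tan.app_mem D a.2⟩ : X.gr U (n + i)) :=
  gen_field_func D a

lemma vf_mul_vf {m n : ℤ} (D : X.Tan U m) (D' : X.Tan U n) :
    vf D * vf D' = (m * n).negOnePow • (vf D' * vf D) + vf (Tan.bracket D D') := by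
  rw [vf, vf, gen_lie, vf]
  congr 2
  refine Prod.ext (Subtype.ext ?_) rfl
  change Tan.app D (0 : X.A U) - (m * n).negOnePow • Tan.app D' (0 : X.A U) = 0
  simp

lemma vf_mem {n : ℤ} (D : X.Tan U n) : vf D ∈ gr X U n := gen_mem _ _
lemma fn_mem {n : ℤ} (a : X.gr U n) : fn a ∈ gr X U n := gen_mem _ _

lemma res_vf (h : V ≤ U) {n : ℤ} (D : X.Tan U n) : res h (vf D) = vf (Tan.res h D) := by
  rw [vf, res_gen]
  congr 1
  exact Prod.ext (Subtype.ext (map_zero (X.res h))) rfl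

lemma act_vf {n : ℤ} (D : X.Tan U n) (b : X.A U) : act (vf D) b = Tan.app D b := by
  rw [vf, act_gen]; simp

lemma par_zero (u : X.Env U) : par 0 u = u := by
  induction u using induction with
  | h0 => simp
  | hadd x y h1 h2 => rw [map_add, h1, h2]
  | hneg x h => rw [map_neg, h]
  | hm l => rw [par_mono]; simp

/-- The product of a list of vector fields. -/
noncomputable def vprod (l : List (Σ n, X.Tan U n)) : X.Env U := (l.map fun p => vf p.2).prod

lemma vprod_nil : vprod ([] : List (Σ n, X.Tan U n)) = 1 := rfl

lemma vprod_cons (p : Σ n, X.Tan U n) (l : List (Σ n, X.Tan U n)) :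
    vprod (p :: l) = vf p.2 * vprod l := by simp [vprod]

lemma vprod_mem (l : List (Σ n, X.Tan U n)) : vprod l ∈ gr X U (l.map Sigma.fst).sum := by
  induction l with
  | nil => exact mono_mem (X := X) (U := U) []
  | cons p l ih => rw [vprod_cons, List.map_cons, List.sum_cons]; exact mono_mul_mem (vf_mem _) ih

lemma res_vprod (h : V ≤ U) (l : List (Σ n, X.Tan U n)) :
    res h (vprod l) = vprod (l.map fun p => ⟨p.1, Tan.res h p.2⟩) := by
  induction l with
  | nil => simp [vprod]
  | cons p l ih => simp only [List.map_cons, vprod_cons, map_mul, ih, res_vf]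

lemma sign_mem {G : Type*} [AddCommGroup G] (H : AddSubgroup G) (c : ℤˣ) {x : G} (hx : x ∈ H) :
    c • x ∈ H := by
  rw [Units.smul_def]; exact zsmul_mem hx _

/-- The universal enveloping algebra is spanned, as a left `A`-module, by the products of vector
fields. -/
lemma mem_closure_vprod (u : X.Env U) :
    u ∈ AddSubgroup.closure {u | ∃ (i : ℤ) (a : X.gr U i) (l : List (Σ n, X.Tan U n)),
      u = fn a * vprod l} := by
  induction u using induction with
  | h0 => exact zero_mem _
  | hadd x y h1 h2 => exact add_mem h1 h2
  | hneg x h => exact neg_mem h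
  | hm l =>
    induction l with
    | nil =>
      refine AddSubgroup.subset_closure ⟨0, oneGr U, [], ?_⟩
      rw [fn, gen_one, vprod_nil, one_mul, mono_nil]
    | cons p l ih =>
      rw [mono_cons]
      generalize mono l = u at ih
      induction ih using AddSubgroup.closure_induction with
      | mem u h =>
        obtain ⟨i, a, l, rfl⟩ := h
        rw [gen_eq, add_mul, ← mul_assoc, ← mul_assoc, fn_mul_fn, vf_mul_fn, add_mul,
          smul_mul_assoc, mul_assoc]
        refine add_mem (AddSubgroup.subset_closure ⟨_, _, l, rfl⟩) (add_mem (sign_mem _ _ ?_) ?_)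
        · exact AddSubgroup.subset_closure ⟨_, a, ⟨p.1, p.2.2⟩ :: l, by rw [vprod_cons]⟩
        · exact AddSubgroup.subset_closure ⟨_, _, l, rfl⟩
      | zero => rw [mul_zero]; exact zero_mem _
      | add x y _ _ h1 h2 => rw [mul_add]; exact add_mem h1 h2
      | neg x _ h => rw [mul_neg]; exact neg_mem h

/-- Moving a vector field past a product of `k` vector fields changes the result by products of
`k` vector fields. -/
lemma vf_mul_vprod_sub_mem {n : ℤ} (D : X.Tan U n) (l : List (Σ n, X.Tan U n)) :
    ∃ c : ℤˣ, vf D * vprod l - c • (vprod l * vf D) ∈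
      AddSubgroup.closure {u | ∃ l' : List (Σ n, X.Tan U n), l'.length = l.length ∧ u = vprod l'} := by
  induction l with
  | nil => exact ⟨1, by rw [vprod_nil, one_smul, one_mul, mul_one, sub_self]; exact zero_mem _⟩
  | cons p l ih =>
    obtain ⟨c, hc⟩ := ih
    refine ⟨(n * p.1).negOnePow * c, ?_⟩
    have e : vf D * vprod (p :: l) - ((n * p.1).negOnePow * c) • (vprod (p :: l) * vf D) =
        (n * p.1).negOnePow • (vf p.2 * (vf D * vprod l - c • (vprod l * vf D))) +
          vprod (⟨_, Tan.bracket D p.2⟩ :: l) := by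
      rw [vprod_cons, vprod_cons, ← mul_assoc, vf_mul_vf, add_mul, mul_sub, smul_sub,
        smul_mul_assoc, mul_smul_comm, smul_smul, mul_assoc, mul_assoc]
      abel
    rw [e]
    refine add_mem (sign_mem _ _ ?_)
      (AddSubgroup.subset_closure ⟨⟨_, Tan.bracket D p.2⟩ :: l, rfl, rfl⟩)
    generalize vf D * vprod l - c • (vprod l * vf D) = u at hc
    induction hc using AddSubgroup.closure_induction with
    | mem u h =>
      obtain ⟨l', h', rfl⟩ := h
      exact AddSubgroup.subset_closure ⟨p :: l', by simp [h'], by rw [vprod_cons]⟩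
    | zero => rw [mul_zero]; exact zero_mem _
    | add x y _ _ h1 h2 => rw [mul_add]; exact add_mem h1 h2
    | neg x _ h => rw [mul_neg]; exact neg_mem h

end Env

end DGSheaf
end DGJet

/-! ### The pairing of the enveloping algebra with `A ⊗_R A` -/

namespace DGJet

section SquareAux
variable {R A : Type u} [CommRing R] [Ring A] [Algebra R A] (𝒜 : ℤ → Submodule R A)
  [GradedAlgebra 𝒜]

namespace Square

/-- The additive map `1 ⊗ f` on `A ⊗_R A`. -/
noncomputable def rmap (f : A →ₗ[R] A) : Square 𝒜 →+ Square 𝒜 :=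
  (ofTensor 𝒜).toAddMonoidHom.comp
    ((TensorProduct.map LinearMap.id f).toAddMonoidHom.comp (ofTensor 𝒜).symm.toAddMonoidHom)

@[simp] lemma rmap_tmul (f : A →ₗ[R] A) (a b : A) :
    rmap 𝒜 f (tmul 𝒜 a b) = tmul 𝒜 a (f b) := rfl

/-- The additive map `a ⊗ b ↦ a f(b)` on `A ⊗_R A`. -/
noncomputable def mulRight (f : A →ₗ[R] A) : Square 𝒜 →+ A :=
  (LinearMap.mul' R A ∘ₗ TensorProduct.map LinearMap.id f).toAddMonoidHom.comp
    (ofTensor 𝒜).symm.toAddMonoidHom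

@[simp] lemma mulRight_tmul (f : A →ₗ[R] A) (a b : A) : mulRight 𝒜 f (tmul 𝒜 a b) = a * f b := rfl

variable {𝒜}

/-- Two additive maps on the degree `n` part of `A ⊗_R A` agree if they agree on the homogeneous
pure tensors. -/
lemma eq_of_mem_gr {G : Type*} [AddCommGroup G] {f g : Square 𝒜 →+ G} {n : ℤ}
    (h : ∀ i j, i + j = n → ∀ a ∈ 𝒜 i, ∀ b ∈ 𝒜 j, f (tmul 𝒜 a b) = g (tmul 𝒜 a b))
    {t : Square 𝒜} (ht : t ∈ gr 𝒜 n) : f t = g t := by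
  induction ht using AddSubgroup.closure_induction with
  | mem x hx => obtain ⟨i, j, hij, a, ha, b, hb, rfl⟩ := hx; exact h i j hij a ha b hb
  | zero => simp
  | add x y _ _ h1 h2 => simp only [map_add, h1, h2]
  | neg x _ h1 => simp only [map_neg, h1]

lemma hom_ext {G : Type*} [AddCommGroup G] {f g : Square 𝒜 →+ G}
    (h : ∀ i j, ∀ a ∈ 𝒜 i, ∀ b ∈ 𝒜 j, f (tmul 𝒜 a b) = g (tmul 𝒜 a b)) (t : Square 𝒜) :
    f t = g t := by
  induction t using induction with
  | h0 => simp
  | hadd x y h1 h2 => simp only [map_add, h1, h2]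
  | ht i j a b ha hb => exact h i j a ha b hb

lemma rmap_mem {f : A →ₗ[R] A} {p : ℤ} (hf : ∀ i, ∀ a ∈ 𝒜 i, f a ∈ 𝒜 (i + p)) {n : ℤ}
    {t : Square 𝒜} (ht : t ∈ gr 𝒜 n) : rmap 𝒜 f t ∈ gr 𝒜 (n + p) := by
  induction ht using AddSubgroup.closure_induction with
  | mem x hx =>
    obtain ⟨i, j, rfl, a, ha, b, hb, rfl⟩ := hx
    rw [rmap_tmul, add_assoc]
    exact tmul_mem 𝒜 ha (hf j b hb)
  | zero => simp
  | add x y _ _ h1 h2 => rw [map_add]; exact add_mem h1 h2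
  | neg x _ h => rw [map_neg]; exact neg_mem h

end Square
end SquareAux

namespace DGSheaf

variable {ι : Type u} [Preorder ι] {X : DGSheaf ι} {U V : ι}

namespace Env

lemma res_res {W : ι} (h : V ≤ U) (h' : W ≤ V) (u : X.Env U) :
    res h' (res h u) = res (h'.trans h) u := by
  induction u using induction with
  | h0 => simp
  | hadd x y h1 h2 => simp only [map_add, h1, h2]
  | hneg x h => simp only [map_neg, h]
  | hm l =>
    rw [res_mono, res_mono, res_mono, List.map_map]
    congr 1
    refine List.map_congr_left fun p _ => ?_
    refine congrArg (Sigma.mk p.1) (Prod.ext (Subtype.ext ?_) rfl)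
    exact X.res_trans h h' _

lemma res_mem (h : V ≤ U) {q : ℤ} {v : X.Env U} (hv : v ∈ gr X U q) : res h v ∈ gr X V q := by
  induction hv using AddSubgroup.closure_induction with
  | mem x h =>
    obtain ⟨l, rfl, rfl⟩ := h
    rw [res_mono]
    have := mono_mem (l.map fun p => (⟨p.1, p.2.res h⟩ : Σ n, X.SemiDir V n))
    rwa [List.map_map] at this
  | zero => rw [map_zero]; exact zero_mem _
  | add x y _ _ h1 h2 => rw [map_add]; exact add_mem h1 h2
  | neg x _ h => rw [map_neg]; exact neg_mem h

lemma sign_smul_apply {M : Type*} [AddCommGroup M] {R : Type*} [CommRing R] [Module R M] (c : ℤˣ)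
    (f : Module.End R M) (b : M) : (c • f) b = c • f b := by
  rcases Int.units_eq_one_or c with rfl | rfl <;> simp

lemma act_sign (c : ℤˣ) (u : X.Env U) (b : X.A U) : act (c • u) b = c • act u b := by
  rcases Int.units_eq_one_or c with rfl | rfl <;> simp

/-- The map `b ↦ (-1)^{|u||b|} u(b)` on `A`, for `u` in the universal enveloping algebra. -/
noncomputable def sact (u : X.Env U) : X.A U →ₗ[X.R U] X.A U :=
  (DirectSum.toModule (X.R U) ℤ (X.A U) fun j => (act (par j u)) ∘ₗ (X.gr U j).subtype) ∘ₗ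
    (DirectSum.decomposeLinearEquiv (X.gr U)).toLinearMap

lemma sact_of_mem (u : X.Env U) {j : ℤ} {b : X.A U} (hb : b ∈ X.gr U j) :
    sact u b = act (par j u) b := by
  lift b to X.gr U j using hb
  rw [sact, LinearMap.comp_apply, LinearEquiv.coe_coe, DirectSum.decomposeLinearEquiv_apply,
    DirectSum.decompose_coe, ← DirectSum.lof_eq_of (X.R U), DirectSum.toModule_lof]
  rfl

/-- Linear maps on `A` which agree on homogeneous elements are equal. -/
lemma linearMap_ext_gr {f g : X.A U →ₗ[X.R U] X.A U}
    (h : ∀ j, ∀ b ∈ X.gr U j, f b = g b) : f = g := by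
  refine LinearMap.ext fun a => ?_
  induction a using DirectSum.Decomposition.inductionOn (X.gr U) with
  | zero => simp
  | add x y h1 h2 => simp [h1, h2]
  | homogeneous a => exact h _ _ a.2

lemma sact_add (u v : X.Env U) : sact (u + v) = sact u + sact v :=
  linearMap_ext_gr fun j b hb => by
    rw [LinearMap.add_apply, sact_of_mem _ hb, sact_of_mem _ hb, sact_of_mem _ hb, map_add, map_add]
    rfl

@[simp] lemma sact_zero : sact (0 : X.Env U) = 0 := by
  have h0 := sact_add (0 : X.Env U) 0
  rwa [add_zero, left_eq_add] at h0

lemma sact_neg (u : X.Env U) : sact (-u) = -sact u := by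
  have h := sact_add u (-u)
  rw [add_neg_cancel, sact_zero] at h
  exact (neg_eq_of_add_eq_zero_right h.symm).symm

lemma sact_sign (c : ℤˣ) (u : X.Env U) (b : X.A U) : sact (c • u) b = c • sact u b := by
  induction b using DirectSum.Decomposition.inductionOn (X.gr U) with
  | zero => simp
  | add x y h1 h2 => simp [h1, h2]
  | homogeneous b => rw [sact_of_mem _ b.2, sact_of_mem _ b.2, map_sign, act_sign]

lemma sact_mem {p : ℤ} {u : X.Env U} (hu : u ∈ gr X U p) (j : ℤ) (b : X.A U)
    (hb : b ∈ X.gr U j) : sact u b ∈ X.gr U (j + p) := by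
  rw [sact_of_mem u hb, par_of_mem j hu, act_sign, Units.smul_def]
  exact zsmul_mem (act_mem hu hb) _

lemma sact_sact {q : ℤ} (u : X.Env U) {v : X.Env U} (hv : v ∈ gr X U q) (b : X.A U) :
    sact u (sact v b) = sact (par q u * v) b := by
  induction b using DirectSum.Decomposition.inductionOn (X.gr U) with
  | zero => simp
  | add x y h1 h2 => simp only [map_add, h1, h2]
  | @homogeneous j b =>
    rw [sact_of_mem _ (sact_mem hv j b b.2), sact_of_mem v b.2, sact_of_mem _ b.2, map_mul, map_mul,
      Module.End.mul_apply, par_add]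

lemma sact_one_right {u : X.Env U} : sact u 1 = act u 1 := by
  rw [sact_of_mem u (SetLike.one_mem_graded (X.gr U)), par_zero]

lemma sact_one (b : X.A U) : sact 1 b = b := by
  induction b using DirectSum.Decomposition.inductionOn (X.gr U) with
  | zero => simp
  | add x y h1 h2 => simp only [map_add, h1, h2]
  | @homogeneous j b => rw [sact_of_mem _ b.2]; simp

lemma sact_res (h : V ≤ U) (u : X.Env U) (b : X.A U) :
    sact (res h u) (X.res h b) = X.res h (sact u b) := by
  induction b using DirectSum.Decomposition.inductionOn (X.gr U) with
  | zero => simp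
  | add x y h1 h2 => simp only [map_add, h1, h2]
  | @homogeneous j b =>
    rw [sact_of_mem _ b.2, sact_of_mem _ (X.res_mem h b.2), ← res_par, act_res]

lemma sact_even {u : X.Env U} (hu : u ∈ gr X U 0) (b : X.A U) : sact u b = act u b := by
  induction b using DirectSum.Decomposition.inductionOn (X.gr U) with
  | zero => simp
  | add x y h1 h2 => simp only [map_add, h1, h2]
  | @homogeneous j b => rw [sact_of_mem _ b.2, par_of_mem j hu]; simp

/-- The pairing of the universal enveloping algebra with `A ⊗_R A`,
`(u, a ⊗ b) ↦ (-1)^{|u||b|} a u(b)`. -/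
noncomputable def pair (u : X.Env U) : Square (X.gr U) →+ X.A U := Square.mulRight _ (sact u)

@[simp] lemma pair_tmul (u : X.Env U) (a b : X.A U) :
    pair u (Square.tmul _ a b) = a * sact u b := rfl

lemma pair_add (u v : X.Env U) (t : Square (X.gr U)) : pair (u + v) t = pair u t + pair v t := by
  rw [← AddMonoidHom.add_apply]
  refine Square.hom_ext (fun i j a ha b hb => ?_) t
  rw [AddMonoidHom.add_apply, pair_tmul, pair_tmul, pair_tmul, sact_add, LinearMap.add_apply,
    mul_add]

/-- The pairing as a biadditive map. -/
noncomputable def pairHom (U : ι) : X.Env U →+ Square (X.gr U) →+ X.A U :=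
  AddMonoidHom.mk' pair fun u v => AddMonoidHom.ext (pair_add u v)

/-- The operator `1 ⊗ v` on `A ⊗_R A`, for `v` in the universal enveloping algebra. -/
noncomputable def shift (v : X.Env U) : Square (X.gr U) →+ Square (X.gr U) :=
  Square.rmap _ (sact v)

@[simp] lemma shift_tmul (v : X.Env U) (a b : X.A U) :
    shift v (Square.tmul _ a b) = Square.tmul _ a (sact v b) := rfl

lemma shift_add (u v : X.Env U) (t : Square (X.gr U)) : shift (u + v) t = shift u t + shift v t := by
  rw [← AddMonoidHom.add_apply]
  refine Square.hom_ext (fun i j a ha b hb => ?_) t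
  rw [AddMonoidHom.add_apply, shift_tmul, shift_tmul, shift_tmul, sact_add, LinearMap.add_apply,
    Square.tmul_add]

/-- The operators `1 ⊗ v`, additively in `v`. -/
noncomputable def shiftHom (U : ι) : X.Env U →+ Square (X.gr U) →+ Square (X.gr U) :=
  AddMonoidHom.mk' shift fun u v => AddMonoidHom.ext (shift_add u v)

lemma shift_mem {q : ℤ} {v : X.Env U} (hv : v ∈ gr X U q) {n : ℤ} {t : Square (X.gr U)}
    (ht : t ∈ Square.gr (X.gr U) n) : shift v t ∈ Square.gr (X.gr U) (n + q) :=
  Square.rmap_mem (sact_mem hv) ht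

lemma pair_shift {q : ℤ} (u : X.Env U) {v : X.Env U} (hv : v ∈ gr X U q) (t : Square (X.gr U)) :
    pair u (shift v t) = pair (par q u * v) t := by
  rw [← AddMonoidHom.comp_apply]
  refine Square.hom_ext (fun i j a ha b hb => ?_) t
  rw [AddMonoidHom.comp_apply, shift_tmul, pair_tmul, pair_tmul, sact_sact u hv]

lemma shift_shift {q : ℤ} (u : X.Env U) {v : X.Env U} (hv : v ∈ gr X U q) (t : Square (X.gr U)) :
    shift u (shift v t) = shift (par q u * v) t := by
  rw [← AddMonoidHom.comp_apply]
  refine Square.hom_ext (fun i j a ha b hb => ?_) t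
  rw [AddMonoidHom.comp_apply, shift_tmul, shift_tmul, shift_tmul, sact_sact u hv]

end Env

/-- The restriction map of `A ⊗_R A`. -/
noncomputable def sqRes (h : V ≤ U) : Square (X.gr U) →+* Square (X.gr V) :=
  Square.map (X.resR h) (X.res h) (X.res_algebraMap h) (fun _ _ ha => X.res_mem h ha)

@[simp] lemma sqRes_tmul (h : V ≤ U) (a b : X.A U) :
    sqRes h (Square.tmul (X.gr U) a b) = Square.tmul (X.gr V) (X.res h a) (X.res h b) :=
  Square.map_tmul ..

lemma sqRes_sqRes {W : ι} (h : V ≤ U) (h' : W ≤ V) (t : Square (X.gr U)) :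
    sqRes h' (sqRes h t) = sqRes (h'.trans h) t := by
  rw [← RingHom.comp_apply]
  refine Square.hom_ext (f := ((sqRes h').comp (sqRes h)).toAddMonoidHom)
    (g := (sqRes (h'.trans h)).toAddMonoidHom) (fun i j a ha b hb => ?_) t
  change sqRes h' (sqRes h _) = sqRes (h'.trans h) _
  rw [sqRes_tmul, sqRes_tmul, sqRes_tmul, X.res_trans, X.res_trans]

lemma sqRes_shift (h : V ≤ U) (v : X.Env U) (t : Square (X.gr U)) :
    sqRes h (Env.shift v t) = Env.shift (Env.res h v) (sqRes h t) := by
  refine Square.hom_ext (f := (sqRes h).toAddMonoidHom.comp (Env.shift v))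
    (g := (Env.shift (Env.res h v)).comp (sqRes h).toAddMonoidHom) (fun i j a ha b hb => ?_) t
  change sqRes h (Env.shift v (Square.tmul _ a b)) = Env.shift _ (sqRes h (Square.tmul _ a b))
  rw [Env.shift_tmul, sqRes_tmul, sqRes_tmul, Env.shift_tmul, Env.sact_res]

/-- Families of additive maps from the universal enveloping algebras over the open subsets of `U` to
`A`, of which the jets are special cases. -/
abbrev Fam (X : DGSheaf ι) (U : ι) : Type u := ∀ V : Below U, X.Env V.1 →+ X.A V.1

/-- The jet of an element of `A ⊗_R A`, as a family of maps. -/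
noncomputable def jetFun (U : ι) : Square (X.gr U) →+ X.Fam U :=
  AddMonoidHom.mk' (fun t V => (Env.pairHom V.1).flip (sqRes V.2 t)) fun t t' => by
    funext V
    rw [map_add, map_add]
    rfl

lemma jetFun_apply (t : Square (X.gr U)) (V : Below U) (u : X.Env V.1) :
    jetFun U t V u = Env.pair u (sqRes V.2 t) := rfl

lemma jetFun_tmul {i j : ℤ} (a : X.gr U i) (b : X.gr U j) :
    jetFun U (Square.tmul _ a.1 b.1) = (Jet.ofTensor a b).1 := by
  funext V
  refine AddMonoidHom.ext fun u => ?_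
  rw [jetFun_apply, sqRes_tmul, Env.pair_tmul, Env.sact_of_mem u (X.res_mem V.2 b.2),
    Jet.ofTensor_apply]

lemma jetFun_mem {n : ℤ} {t : Square (X.gr U)} (ht : t ∈ Square.gr (X.gr U) n) :
    jetFun U t ∈ X.Jet U n := by
  induction ht using AddSubgroup.closure_induction with
  | mem x h =>
    obtain ⟨i, j, rfl, a, ha, b, hb, rfl⟩ := h
    rw [jetFun_tmul ⟨a, ha⟩ ⟨b, hb⟩]
    exact (Jet.ofTensor (⟨a, ha⟩ : X.gr U i) (⟨b, hb⟩ : X.gr U j)).2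
  | zero => rw [map_zero]; exact zero_mem _
  | add x y _ _ h1 h2 => rw [map_add]; exact add_mem h1 h2
  | neg x _ h => rw [map_neg]; exact neg_mem h

/-- The right translate `u ↦ (-1)^{q|u|} φ(u v)` of a family `φ`, for `v` of degree `q`. -/
noncomputable def trans (q : ℤ) (v : X.Env U) : X.Fam U →+ X.Fam U :=
  AddMonoidHom.mk' (fun φ V => (φ V).comp ((AddMonoidHom.mulRight (Env.res V.2 v)).comp
    (Env.par q).toAddMonoidHom)) fun _ _ => rfl

lemma trans_apply (q : ℤ) (v : X.Env U) (φ : X.Fam U) (V : Below U) (u : X.Env V.1) :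
    trans q v φ V u = φ V (Env.par q u * Env.res V.2 v) := rfl

lemma trans_mem {q : ℤ} {v : X.Env U} (hv : v ∈ Env.gr X U q) {n : ℤ} {φ : X.Fam U}
    (hφ : φ ∈ X.Jet U n) : trans q v φ ∈ X.Jet U (n + q) := by
  refine ⟨fun V W h u => ?_, fun V p u hu => ?_, fun V i a u => ?_⟩
  · rw [trans_apply, trans_apply, ← Env.res_res V.2 h, ← Env.res_par, ← map_mul, hφ.1 V W h]
  · rw [trans_apply, Env.par_of_mem q hu, smul_mul_assoc, map_sign, Units.smul_def]
    refine zsmul_mem ?_ _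
    rw [add_comm n q, ← add_assoc]
    exact hφ.2.1 V _ _ (Env.mono_mul_mem hu (Env.res_mem V.2 hv))
  · rw [trans_apply, trans_apply, map_mul (Env.par q), Env.par_gen, smul_mul_assoc, smul_mul_assoc,
      map_sign, mul_assoc, hφ.2.2, smul_smul, add_mul, Int.negOnePow_add, mul_comm]

lemma trans_trans {q q' : ℤ} (v : X.Env U) {w : X.Env U} (hw : w ∈ Env.gr X U q) (φ : X.Fam U) :
    trans q w (trans q' v φ) = (q' * q).negOnePow • trans (q + q') (w * v) φ := by
  funext V
  refine AddMonoidHom.ext fun u => ?_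
  have e : ((q' * q).negOnePow • trans (q + q') (w * v) φ) V u =
      (q' * q).negOnePow • trans (q + q') (w * v) φ V u := by
    rcases Int.units_eq_one_or (q' * q).negOnePow with h | h <;> rw [h] <;> simp
  rw [e, trans_apply, trans_apply, trans_apply, map_mul (Env.par q'),
    Env.par_of_mem q' (Env.res_mem V.2 hw), map_mul (Env.res V.2), mul_smul_comm, smul_mul_assoc,
    map_sign, mul_assoc, add_comm q q', Env.par_add]

lemma trans_add (q : ℤ) (v w : X.Env U) (φ : X.Fam U) :
    trans q (v + w) φ = trans q v φ + trans q w φ := by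
  funext V
  refine AddMonoidHom.ext fun u => ?_
  change φ V (_ * Env.res V.2 (v + w)) = φ V (_ * Env.res V.2 v) + φ V (_ * Env.res V.2 w)
  rw [map_add, mul_add, map_add]

/-- Right translates of a family, additively in the translating element. -/
noncomputable def transHom (q : ℤ) (φ : X.Fam U) : X.Env U →+ X.Fam U :=
  AddMonoidHom.mk' (fun v => trans q v φ) fun v w => trans_add q v w φ

lemma trans_jetFun {q : ℤ} {v : X.Env U} (hv : v ∈ Env.gr X U q) (t : Square (X.gr U)) :
    trans q v (jetFun U t) = jetFun U (Env.shift v t) := by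
  funext V
  refine AddMonoidHom.ext fun u => ?_
  rw [trans_apply, jetFun_apply, jetFun_apply, sqRes_shift, Env.pair_shift u (Env.res_mem V.2 hv)]

end DGSheaf
end DGJet

/-! ### The jet map is a morphism of dg-algebras -/

namespace DGJet

namespace Square
variable {R A : Type u} [CommRing R] [Ring A] [Algebra R A] {𝒜 : ℤ → Submodule R A}
  [GradedAlgebra 𝒜]

/-- Induction over the homogeneous pure tensors of degree `n`. -/
lemma gr_induction {n : ℤ} {P : ∀ t : Square 𝒜, t ∈ gr 𝒜 n → Prop} (h0 : P 0 (zero_mem _))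
    (hadd : ∀ x y hx hy, P x hx → P y hy → P (x + y) (add_mem hx hy))
    (hneg : ∀ x hx, P x hx → P (-x) (neg_mem hx))
    (ht : ∀ i j (a b : A) (_ : a ∈ 𝒜 i) (_ : b ∈ 𝒜 j) (h : tmul 𝒜 a b ∈ gr 𝒜 n),
      i + j = n → P (tmul 𝒜 a b) h) {t : Square 𝒜} (h : t ∈ gr 𝒜 n) : P t h := by
  induction h using AddSubgroup.closure_induction with
  | mem x hx => obtain ⟨i, j, hij, a, ha, b, hb, rfl⟩ := hx; exact ht i j a b ha hb _ hij
  | zero => exact h0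
  | add x y hx hy h1 h2 => exact hadd x y hx hy h1 h2
  | neg x hx h1 => exact hneg x hx h1

lemma one_tmul_mem {j : ℤ} {b : A} (hb : b ∈ 𝒜 j) : tmul 𝒜 1 b ∈ gr 𝒜 j := by
  have h := tmul_mem 𝒜 (SetLike.one_mem_graded 𝒜) hb
  rwa [zero_add] at h

lemma tmul_one_mem {j : ℤ} {b : A} (hb : b ∈ 𝒜 j) : tmul 𝒜 b 1 ∈ gr 𝒜 j := by
  have h := tmul_mem 𝒜 hb (SetLike.one_mem_graded 𝒜)
  rwa [add_zero] at h

end Square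

namespace DGSheaf
variable {ι : Type u} [Preorder ι] {X : DGSheaf ι} {U V : ι}

/-- The jet of an element of degree `n` of `A ⊗_R A`. -/
noncomputable def toJet (U : ι) (n : ℤ) : Square.gr (X.gr U) n →+ X.Jet U n :=
  AddMonoidHom.mk' (fun t => ⟨jetFun U t.1, jetFun_mem t.2⟩) fun t t' =>
    Subtype.ext (map_add (jetFun U) t.1 t'.1)

lemma toJet_apply {n : ℤ} (t : Square.gr (X.gr U) n) (V : Below U) (u : X.Env V.1) :
    (toJet U n t).1 V u = Env.pair u (sqRes V.2 t.1) := rfl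

lemma sqRes_diff (h : V ≤ U) (t : Square (X.gr U)) :
    sqRes h (Square.diff _ (X.d U) t) = Square.diff _ (X.d V) (sqRes h t) := by
  refine Square.hom_ext (f := (sqRes h).toAddMonoidHom.comp (Square.diff _ (X.d U)))
    (g := (Square.diff _ (X.d V)).comp (sqRes h).toAddMonoidHom) (fun i j a ha b hb => ?_) t
  change sqRes h (Square.diff _ _ (Square.tmul _ a b)) = Square.diff _ _ (sqRes h (Square.tmul _ a b))
  rw [sqRes_tmul, Square.diff_tmul _ _ _ ha, Square.diff_tmul _ _ _ (X.res_mem h ha), map_add,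
    map_sign, sqRes_tmul, sqRes_tmul, X.d_res, X.d_res]

/-- The jet map is compatible with the differentials. -/
lemma toJet_diff {n : ℤ} (t : Square.gr (X.gr U) n) :
    toJet U (n + 1) ⟨Square.diff _ (X.d U) t.1, Square.diff_mem (X.d_der U) t.2⟩ =
      Jet.diff (toJet U n t) := by
  refine Subtype.ext (funext fun V => AddMonoidHom.ext fun u => ?_)
  rw [Jet.diff_apply]
  obtain ⟨t, ht⟩ := t
  change Env.pair u (sqRes V.2 (Square.diff _ (X.d U) t)) = X.d V.1 (Env.pair u (sqRes V.2 t)) -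
    n.negOnePow • Env.pair (Env.diff u) (sqRes V.2 t)
  rw [sqRes_diff]
  induction ht using Square.gr_induction with
  | h0 => simp
  | hadd x y hx hy h1 h2 => simp only [map_add, h1, h2, smul_add]; abel
  | hneg x hx h => simp only [map_neg, h, smul_neg]; abel
  | ht i j a b ha hb _ hn =>
    subst hn
    have ha' := X.res_mem V.2 ha
    have hb' := X.res_mem V.2 hb
    rw [sqRes_tmul, Square.diff_tmul _ _ _ ha', map_add, map_sign, Env.pair_tmul, Env.pair_tmul,
      Env.pair_tmul, Env.pair_tmul, (X.d_der V.1).leib _ ha', Env.sact_of_mem _ hb',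
      Env.sact_of_mem _ hb', Env.sact_of_mem _ ((X.d_der V.1).deg hb'), Env.diff_apply, map_sub, map_sub,
      map_mul, map_mul, map_mul, map_mul, Env.par_gen, LinearMap.sub_apply,
      Module.End.mul_apply, Module.End.mul_apply,
      map_sign, Env.sign_smul_apply, Env.sign_smul_apply, ← Env.par_add, map_sign (Env.act _)]
    have e : ∀ c, Env.act (Env.gen 1 ((0, X.Q V.1) : X.SemiDir V.1 1)) c = X.d V.1 c := by
      intro c
      rw [Env.act_gen]
      change 0 * c + X.d V.1 c = _
      rw [zero_mul, zero_add]
    rw [e, e, mul_one, Int.negOnePow_add, mul_sub, smul_sub, mul_smul_comm, mul_smul_comm, smul_smul,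
      smul_smul, mul_assoc, Int.units_mul_self, mul_one]
    abel

/-- The jet map is compatible with restriction. -/
lemma toJet_res (h : V ≤ U) {n : ℤ} (t : Square.gr (X.gr U) n) :
    toJet V n ⟨sqRes h t.1, Square.map_mem _ _ _ _ t.2⟩ = Jet.res h (toJet U n t) := by
  refine Subtype.ext (funext fun W => AddMonoidHom.ext fun u => ?_)
  change Env.pair u (sqRes W.2 (sqRes h t.1)) = Env.pair u (sqRes _ t.1)
  rw [sqRes_sqRes]

lemma toJet_tmul {i j : ℤ} (a : X.gr U i) (b : X.gr U j) :
    toJet U (i + j) ⟨Square.tmul _ a.1 b.1, Square.tmul_mem _ a.2 b.2⟩ = Jet.ofTensor a b :=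
  Subtype.ext (jetFun_tmul a b)

namespace Jet
open Env

/-- The convolution of the jets of `1 ⊗ b` and `1 ⊗ d` intertwines the actions of the universal
enveloping algebra on `U ⊗_A U` and on `A`, up to the Koszul sign. -/
lemma conv_one_tmul_coact {j l : ℤ} {b d : X.A U} (hb : b ∈ X.gr U j) (hd : d ∈ X.gr U l)
    (V : Below U) {q : ℤ} (x : X.SemiDir V.1 q) (z : CoT X V.1) :
    conv (toJet U j ⟨_, Square.one_tmul_mem hb⟩) (toJet U l ⟨_, Square.one_tmul_mem hd⟩) V
      (coact (gen q x) z) = ((j + l) * q).negOnePow • act (gen q x)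
        (conv (toJet U j ⟨_, Square.one_tmul_mem hb⟩) (toJet U l ⟨_, Square.one_tmul_mem hd⟩) V z) := by
  induction z using ct_induction with
  | h0 => simp
  | hadd x y h1 h2 => simp only [map_add, h1, h2, smul_add]
  | ht u v =>
    have hb' := X.res_mem V.2 hb
    have hd' := X.res_mem V.2 hd
    rw [coact_gen, map_add, conv_ct, conv_ct, conv_ct]
    simp only [toJet_apply, sqRes_tmul, pair_tmul, _root_.map_one, one_mul]
    induction u using Env.induction with
    | h0 => simp
    | hadd x y h1 h2 =>
      simp only [mul_add, map_add, add_mul, sact_add, LinearMap.add_apply, smul_add] at h1 h2 ⊢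
      rw [← h1, ← h2]; abel
    | hneg x h =>
      simp only [map_neg, mul_neg, neg_mul, sact_neg, LinearMap.neg_apply, smul_neg] at h ⊢
      rw [← h]; abel
    | hm m =>
      have hm := mono_mem m
      generalize (m.map Sigma.fst).sum = p at hm
      generalize mono m = u at hm
      generalize X.res V.2 b = b' at *
      generalize X.res V.2 d = d' at *
      have hB : sact (par l u) b' ∈ X.gr V.1 (j + p) := by
        rw [par_of_mem _ hm, sact_sign]
        exact sign_mem (X.gr V.1 _).toAddSubgroup _ (sact_mem hm _ _ hb')
      have e1 : sact (par l (gen q x * u)) b' =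
          ((j + l) * q).negOnePow • act (gen q x) (sact (par l u) b') := by
        rw [sact_of_mem _ hb', sact_of_mem _ hb', map_mul, map_mul, map_mul, par_gen, map_sign,
          par_gen, smul_smul, map_sign, Module.End.mul_apply, sign_smul_apply, add_mul, add_comm,
          Int.negOnePow_add]
      have e2 : sact (par l (par q u)) b' = (q * p).negOnePow • sact (par l u) b' := by
        rw [par_of_mem q hm, map_sign, sact_sign]
      have e3 : sact (gen q (0, x.2) * v) d' = (l * q).negOnePow • Tan.app x.2 (sact v d') := by
        rw [sact_of_mem _ hd', sact_of_mem _ hd', map_mul, par_gen, map_mul, Module.End.mul_apply,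
          map_sign, sign_smul_apply, act_gen]
        simp
      rw [e1, e2, e3, act_gen, act_gen, Tan.app_mul _ _ hB, smul_mul_assoc, smul_mul_assoc,
        mul_smul_comm, smul_smul, add_mul ((x.1 : X.A V.1) * _), ← add_assoc,
        smul_add _ (_ + _), smul_smul, mul_assoc]
      congr 2
      rw [← Int.negOnePow_add, ← Int.negOnePow_add, Int.negOnePow_eq_iff]
      exact ⟨-(j * q), by ring⟩

/-- The coproduct of the universal enveloping algebra computes its action on products. -/
lemma conv_one_tmul_coprod {j l : ℤ} {b d : X.A U} (hb : b ∈ X.gr U j) (hd : d ∈ X.gr U l)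
    (V : Below U) (u : X.Env V.1) :
    conv (toJet U j ⟨_, Square.one_tmul_mem hb⟩) (toJet U l ⟨_, Square.one_tmul_mem hd⟩) V
      (coprod u) = sact u (X.res V.2 (b * d)) := by
  have h0 : ∀ u v : X.Env V.1, coprod (u + v) = coprod u + coprod v := fun u v => by
    rw [coprod, map_add]; rfl
  have hbd := X.res_mem V.2 (SetLike.mul_mem_graded hb hd)
  induction u using Env.induction with
  | h0 => rw [coprod, map_zero]; simp
  | hadd x y h1 h2 => rw [h0, map_add, h1, h2, sact_add]; rfl
  | hneg x h =>
    have e : coprod (-x) = -coprod x := by rw [coprod, map_neg]; rfl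
    rw [e, map_neg, h, sact_neg]; rfl
  | hm m =>
    induction m with
    | nil =>
      have e : coprod (1 : X.Env V.1) = ct 1 1 := by rw [coprod, map_one]; rfl
      rw [mono_nil, e, conv_ct, toJet_apply, toJet_apply, sqRes_tmul, sqRes_tmul, pair_tmul,
        pair_tmul, map_one, map_one, sact_one, sact_one, sact_one, one_mul, one_mul, map_mul]
    | cons a m ih =>
      rw [mono_cons, coprod_gen_mul, conv_one_tmul_coact hb hd, ih, sact_of_mem _ hbd, sact_of_mem _ hbd,
        map_mul (par _), par_gen, map_mul act, map_sign, Module.End.mul_apply, sign_smul_apply]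

lemma conv_tmul {i j k l : ℤ} {a b c d : X.A U} (ha : a ∈ X.gr U i) (hb : b ∈ X.gr U j)
    (hc : c ∈ X.gr U k) (hd : d ∈ X.gr U l) (V : Below U) (z : CoT X V.1) :
    conv (toJet U (i + j) ⟨_, Square.tmul_mem _ ha hb⟩) (toJet U (k + l) ⟨_, Square.tmul_mem _ hc hd⟩)
      V z = (j * k).negOnePow • (X.res V.2 (a * c) *
        conv (toJet U j ⟨_, Square.one_tmul_mem hb⟩) (toJet U l ⟨_, Square.one_tmul_mem hd⟩) V z) := by
  induction z using ct_induction with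
  | h0 => simp
  | hadd x y h1 h2 => simp only [map_add, h1, h2, smul_add, mul_add]
  | ht u v =>
    have hb' := X.res_mem V.2 hb
    have hc' := X.res_mem V.2 hc
    rw [conv_ct, conv_ct, toJet_apply, toJet_apply, toJet_apply, toJet_apply, sqRes_tmul, sqRes_tmul,
      sqRes_tmul, sqRes_tmul, map_mul, _root_.map_one]
    simp only [pair_tmul, one_mul]
    generalize X.res V.2 a = a' at *
    generalize X.res V.2 b = b' at *
    generalize X.res V.2 c = c' at *
    generalize X.res V.2 d = d' at *
    induction u using Env.induction with
    | h0 => simp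
    | hadd x y h1 h2 =>
      simp only [mul_add, map_add, add_mul, sact_add, LinearMap.add_apply, smul_add] at h1 h2 ⊢
      rw [← h1, ← h2]
    | hneg x h =>
      simp only [map_neg, mul_neg, neg_mul, sact_neg, LinearMap.neg_apply, smul_neg] at h ⊢
      rw [← h]
    | hm m =>
      have hm := mono_mem m
      generalize (m.map Sigma.fst).sum = p at hm
      generalize mono m = u at hm
      have e := X.comm V.1 (sact_mem hm _ _ hb') hc'
      rw [par_of_mem _ hm, par_of_mem _ hm, sact_sign, sact_sign, mul_smul_comm, smul_mul_assoc,
        smul_mul_assoc, mul_smul_comm, smul_smul, mul_assoc a', ← mul_assoc _ c', e, smul_mul_assoc,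
        mul_smul_comm, smul_smul, mul_assoc c', mul_assoc a']
      congr 1
      rw [← Int.negOnePow_add, ← Int.negOnePow_add, Int.negOnePow_eq_iff]
      exact ⟨p * k, by ring⟩

lemma conv_add_left {m n : ℤ} (φ φ' : X.Jet U m) (ψ : X.Jet U n) (V : Below U) (z : CoT X V.1) :
    conv (φ + φ') ψ V z = conv φ ψ V z + conv φ' ψ V z := by
  induction z using ct_induction with
  | h0 => simp
  | hadd x y h1 h2 => rw [map_add, h1, h2, map_add, map_add]; abel
  | ht u v => exact add_mul _ _ _

lemma conv_add_right {m n : ℤ} (φ : X.Jet U m) (ψ ψ' : X.Jet U n) (V : Below U) (z : CoT X V.1) :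
    conv φ (ψ + ψ') V z = conv φ ψ V z + conv φ ψ' V z := by
  induction z using ct_induction with
  | h0 => simp
  | hadd x y h1 h2 => rw [map_add, h1, h2, map_add, map_add]; abel
  | ht u v => exact mul_add _ _ _

/-- The convolution of jets, as a biadditive map. -/
noncomputable def convHom (m n : ℤ) (V : Below U) (z : CoT X V.1) :
    X.Jet U m →+ X.Jet U n →+ X.A V.1 :=
  AddMonoidHom.mk' (fun φ => AddMonoidHom.mk' (fun ψ => conv φ ψ V z)
    fun ψ ψ' => conv_add_right φ ψ ψ' V z) fun φ φ' =>
    AddMonoidHom.ext fun ψ => conv_add_left φ φ' ψ V z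

end Jet

/-- The jet map is multiplicative. -/
lemma toJet_mul {m n : ℤ} (s : Square.gr (X.gr U) m) (t : Square.gr (X.gr U) n) :
    toJet U (m + n) ⟨s.1 * t.1, Square.mul_mem _ s.2 t.2⟩ = Jet.mul (toJet U m s) (toJet U n t) := by
  refine Subtype.ext (funext fun V => AddMonoidHom.ext fun u => ?_)
  rw [toJet_apply, Jet.mul_apply, map_mul]
  change _ = Jet.convHom m n V (Env.coprod u) (toJet U m s) (toJet U n t)
  obtain ⟨s, hs⟩ := s
  obtain ⟨t, ht⟩ := t
  have add_mk : ∀ (n : ℤ) x y (hx : x ∈ Square.gr (X.gr U) n) (hy : y ∈ Square.gr (X.gr U) n),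
      (⟨x + y, add_mem hx hy⟩ : Square.gr (X.gr U) n) = ⟨x, hx⟩ + ⟨y, hy⟩ := fun _ _ _ _ _ => rfl
  have neg_mk : ∀ (n : ℤ) x (hx : x ∈ Square.gr (X.gr U) n),
      (⟨-x, neg_mem hx⟩ : Square.gr (X.gr U) n) = -⟨x, hx⟩ := fun _ _ _ => rfl
  have zero_mk : ∀ (n : ℤ), (⟨0, zero_mem _⟩ : Square.gr (X.gr U) n) = 0 := fun _ => rfl
  change Env.pair u (sqRes V.2 s * sqRes V.2 t) = _
  induction hs using Square.gr_induction with
  | h0 => rw [zero_mk]; simp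
  | hadd x y hx hy h1 h2 => rw [add_mk _ _ _ hx hy]; simp only [map_add, add_mul, h1, h2]; rfl
  | hneg x hx h => rw [neg_mk _ _ hx]; simp only [map_neg, neg_mul, h]; rfl
  | ht i j a b ha hb _ hm =>
    subst hm
    induction ht using Square.gr_induction with
    | h0 => rw [zero_mk]; simp
    | hadd x y hx hy h1 h2 => rw [add_mk _ _ _ hx hy]; simp only [map_add, mul_add, h1, h2]
    | hneg x hx h => rw [neg_mk _ _ hx]; simp only [map_neg, mul_neg, h]
    | ht k l c d hc hd _ hn =>
      subst hn
      change _ = Jet.conv (toJet U (i + j) ⟨_, Square.tmul_mem _ ha hb⟩)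
        (toJet U (k + l) ⟨_, Square.tmul_mem _ hc hd⟩) V (Env.coprod u)
      rw [Jet.conv_tmul ha hb hc hd, Jet.conv_one_tmul_coprod hb hd, sqRes_tmul, sqRes_tmul,
        Square.tmul_mul _ _ _ (X.res_mem V.2 hb) (X.res_mem V.2 hc), map_sign, Env.pair_tmul,
        map_mul (X.res V.2), map_mul (X.res V.2)]

end DGSheaf
end DGJet

/-! ### The completion of `A ⊗_R A` along the diagonal -/

namespace DGJet
namespace Square
variable {R A : Type u} [CommRing R] [Ring A] [Algebra R A] (𝒜 : ℤ → Submodule R A)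
  [GradedAlgebra 𝒜]

/-- The projection of `A ⊗_R A` to its part of degree `n`, for an algebra `A` in nonpositive
degrees. -/
noncomputable def proj (n : ℤ) : Square 𝒜 →+ Square 𝒜 :=
  (ofTensor 𝒜).toAddMonoidHom.comp
    ((∑ i ∈ Finset.range ((-n).toNat + 1), TensorProduct.map (GradedAlgebra.proj 𝒜 (-(i : ℤ)))
      (GradedAlgebra.proj 𝒜 (n + i))).toAddMonoidHom.comp (ofTensor 𝒜).symm.toAddMonoidHom)

lemma proj_apply_tmul (n : ℤ) (a b : A) : proj 𝒜 n (tmul 𝒜 a b) =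
    ∑ i ∈ Finset.range ((-n).toNat + 1), tmul 𝒜 (GradedAlgebra.proj 𝒜 (-(i : ℤ)) a)
      (GradedAlgebra.proj 𝒜 (n + i) b) := by
  change ofTensor 𝒜 ((∑ i ∈ Finset.range ((-n).toNat + 1),
    TensorProduct.map (GradedAlgebra.proj 𝒜 (-(i : ℤ))) (GradedAlgebra.proj 𝒜 (n + i))) (a ⊗ₜ b)) = _
  rw [LinearMap.sum_apply, map_sum]
  rfl

lemma proj_of_mem {i j : ℤ} {a : A} (ha : a ∈ 𝒜 i) :
    GradedAlgebra.proj 𝒜 j a = if i = j then a else 0 := by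
  rw [GradedAlgebra.proj_apply]
  split_ifs with h
  · subst h; exact DirectSum.decompose_of_mem_same 𝒜 ha
  · exact DirectSum.decompose_of_mem_ne 𝒜 ha h

@[simp] lemma zero_tmul (b : A) : tmul 𝒜 0 b = 0 := by
  rw [tmul, TensorProduct.zero_tmul]; rfl

@[simp] lemma tmul_zero (a : A) : tmul 𝒜 a 0 = 0 := by
  rw [tmul, TensorProduct.tmul_zero]; rfl

lemma tmul_algebraMap (a : A) (r : R) :
    tmul 𝒜 a (algebraMap R A r) = tmul 𝒜 (algebraMap R A r * a) 1 := by
  rw [tmul, tmul, Algebra.algebraMap_eq_smul_one, TensorProduct.tmul_smul, TensorProduct.smul_tmul',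
    Algebra.smul_mul_assoc, one_mul]

variable {𝒜} (hpos : ∀ i, 0 < i → ∀ a ∈ 𝒜 i, a = 0)

include hpos in
lemma proj_tmul {i j : ℤ} {a b : A} (ha : a ∈ 𝒜 i) (hb : b ∈ 𝒜 j) (n : ℤ) :
    proj 𝒜 n (tmul 𝒜 a b) = if i + j = n then tmul 𝒜 a b else 0 := by
  by_cases hi : 0 < i
  · rw [hpos i hi a ha]; simp
  by_cases hj : 0 < j
  · rw [hpos j hj b hb]; simp
  rw [proj_apply_tmul]
  simp only [proj_of_mem 𝒜 ha, proj_of_mem 𝒜 hb]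
  split_ifs with h
  · rw [Finset.sum_eq_single (-i).toNat]
    · rw [if_pos (by omega), if_pos (by omega)]
    · intro k _ hk
      rw [if_neg (by omega), zero_tmul]
    · intro hk
      exact absurd (Finset.mem_range.2 (by omega)) hk
  · refine Finset.sum_eq_zero fun k _ => ?_
    split_ifs <;> first | (exfalso; omega) | simp

include hpos in
lemma proj_of_mem_gr {m n : ℤ} {t : Square 𝒜} (ht : t ∈ gr 𝒜 m) :
    proj 𝒜 n t = if m = n then t else 0 := by
  induction ht using gr_induction with
  | h0 => simp
  | hadd x y hx hy h1 h2 => rw [map_add, h1, h2]; split_ifs <;> simp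
  | hneg x hx h => rw [map_neg, h]; split_ifs <;> simp
  | ht i j a b ha hb h hij => subst hij; exact proj_tmul hpos ha hb n

variable (𝒜) in
/-- The part of `A ⊗_R A` of degree at most `-k`. -/
noncomputable def low (k : ℕ) : AddSubgroup (Square 𝒜) :=
  AddSubgroup.closure {t | ∃ q ≤ -(k : ℤ), t ∈ gr 𝒜 q}

lemma mul_mem_low {k l : ℕ} {s t : Square 𝒜} (hs : s ∈ low 𝒜 k) (ht : t ∈ low 𝒜 l) :
    s * t ∈ low 𝒜 (k + l) := by
  induction hs using AddSubgroup.closure_induction with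
  | mem s h =>
    obtain ⟨q, hq, hs⟩ := h
    induction ht using AddSubgroup.closure_induction with
    | mem t h =>
      obtain ⟨q', hq', ht⟩ := h
      exact AddSubgroup.subset_closure ⟨q + q', by push_cast; omega, mul_mem 𝒜 hs ht⟩
    | zero => rw [mul_zero]; exact zero_mem _
    | add x y _ _ h1 h2 => rw [mul_add]; exact add_mem h1 h2
    | neg x _ h => rw [mul_neg]; exact neg_mem h
  | zero => rw [zero_mul]; exact zero_mem _
  | add x y _ _ h1 h2 => rw [add_mul]; exact add_mem h1 h2
  | neg x _ h => rw [neg_mul]; exact neg_mem h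

include hpos in
lemma proj_low {k : ℕ} {n : ℤ} (hn : -(k : ℤ) < n) {t : Square 𝒜} (ht : t ∈ low 𝒜 k) :
    proj 𝒜 n t = 0 := by
  induction ht using AddSubgroup.closure_induction with
  | mem s h =>
    obtain ⟨q, hq, hs⟩ := h
    rw [proj_of_mem_gr hpos hs, if_neg (by omega)]
  | zero => rw [map_zero]
  | add x y _ _ h1 h2 => rw [map_add, h1, h2, add_zero]
  | neg x _ h => rw [map_neg, h, neg_zero]

variable (hc : IsGradedComm 𝒜) (hzero : ∀ a ∈ 𝒜 0, ∃ r, a = algebraMap R A r)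

include hpos hzero in
/-- Up to terms of negative degree, an element of `A ⊗_R A` is the constant which multiplication
maps to its part of degree zero. -/
lemma exists_sub_mem_low (t : Square 𝒜) : ∃ r, t - tmul 𝒜 (algebraMap R A r) 1 ∈ low 𝒜 1 ∧
    GradedAlgebra.proj 𝒜 0 (mulMap hc t) = algebraMap R A r := by
  induction t using induction with
  | h0 => exact ⟨0, by rw [map_zero, zero_tmul, sub_zero]; exact zero_mem _, by simp⟩
  | hadd x y h1 h2 =>
    obtain ⟨r, h1, h1'⟩ := h1
    obtain ⟨r', h2, h2'⟩ := h2
    refine ⟨r + r', ?_, by rw [map_add, map_add, h1', h2', map_add]⟩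
    rw [map_add, add_tmul, add_sub_add_comm]
    exact add_mem h1 h2
  | ht i j a b ha hb =>
    rw [mulMap_tmul, proj_of_mem 𝒜 (SetLike.mul_mem_graded ha hb)]
    rcases lt_trichotomy 0 (i + j) with h | h | h
    · rw [if_neg h.ne']
      refine ⟨0, ?_, by simp⟩
      have : tmul 𝒜 a b = 0 := by
        rcases lt_or_ge 0 i with hi | hi
        · rw [hpos i hi a ha, zero_tmul]
        · rw [hpos j (by omega) b hb, tmul_zero]
      rw [this, map_zero, zero_tmul, sub_zero]
      exact zero_mem _
    · rw [if_pos h.symm]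
      rcases lt_or_ge 0 i with hi | hi
      · refine ⟨0, ?_, by rw [hpos i hi a ha]; simp⟩
        rw [hpos i hi a ha, map_zero, zero_tmul, zero_tmul, sub_zero]
        exact zero_mem _
      rcases lt_or_ge 0 j with hj | hj
      · refine ⟨0, ?_, by rw [hpos j hj b hb]; simp⟩
        rw [hpos j hj b hb, map_zero, zero_tmul, tmul_zero, sub_zero]
        exact zero_mem _
      obtain rfl : i = 0 := by omega
      obtain rfl : j = 0 := by omega
      obtain ⟨r, rfl⟩ := hzero a ha
      obtain ⟨r', rfl⟩ := hzero b hb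
      refine ⟨r' * r, ?_, by rw [mul_comm, map_mul]⟩
      rw [tmul_algebraMap, map_mul, sub_self]
      exact zero_mem _
    · rw [if_neg h.ne]
      refine ⟨0, ?_, by simp⟩
      rw [map_zero, zero_tmul, sub_zero]
      exact AddSubgroup.subset_closure ⟨i + j, by push_cast; omega, tmul_mem 𝒜 ha hb⟩

include hpos hzero in
/-- The ideal of the diagonal sits in negative degrees, so that its `k`-th power sits in degrees
at most `-k`. -/
lemma diagIdeal_pow_le_low (k : ℕ) {t : Square 𝒜} (ht : t ∈ diagIdeal hc ^ k) : t ∈ low 𝒜 k := by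
  induction k generalizing t with
  | zero =>
    clear ht
    induction t using induction with
    | h0 => exact zero_mem _
    | hadd x y h1 h2 => exact add_mem h1 h2
    | ht i j a b ha hb =>
      rcases lt_or_ge 0 i with hi | hi
      · rw [hpos i hi a ha, zero_tmul]; exact zero_mem _
      rcases lt_or_ge 0 j with hj | hj
      · rw [hpos j hj b hb, tmul_zero]; exact zero_mem _
      exact AddSubgroup.subset_closure ⟨i + j, by push_cast; omega, tmul_mem 𝒜 ha hb⟩
  | succ k ih =>
    rw [Submodule.pow_succ] at ht
    induction ht using Submodule.mul_induction_on' with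
    | mem_mul_mem y hy z hz =>
      refine mul_mem_low (ih hy) ?_
      obtain ⟨r, h1, h2⟩ := exists_sub_mem_low hpos hc hzero z
      change mulMap hc z = 0 at hz
      rw [hz, map_zero] at h2
      rwa [← h2, zero_tmul, sub_zero] at h1
    | add y _ z _ h1 h2 => exact add_mem h1 h2

include hpos hzero in
lemma eq_zero_of_mem_pow {k : ℕ} {n : ℤ} (hn : -(k : ℤ) < n) {t : Square 𝒜} (ht : t ∈ gr 𝒜 n)
    (h : t ∈ diagIdeal hc ^ k) : t = 0 := by
  have h1 := proj_low hpos hn (diagIdeal_pow_le_low hpos hc hzero k h)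
  rwa [proj_of_mem_gr hpos ht, if_pos rfl] at h1

/-- The map from the degree `n` part of `A ⊗_R A` to the completion. -/
noncomputable def Completion.ofHom (n : ℤ) : gr 𝒜 n →+ Completion hc n :=
  AddMonoidHom.mk' (fun t => Completion.of hc t.1 t.2) fun s t => Subtype.ext (funext fun _ =>
    map_add (Ideal.Quotient.mk _) s.1 t.1)

include hpos hzero in
/-- In each degree the completion of `A ⊗_R A` along the diagonal is `A ⊗_R A` itself. -/
lemma Completion.ofHom_bijective (n : ℤ) : Function.Bijective (Completion.ofHom hc n) := by
  constructor
  · refine (injective_iff_map_eq_zero _).2 fun t ht => Subtype.ext ?_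
    have h := congrFun (congrArg Subtype.val ht) (-n).toNat
    exact eq_zero_of_mem_pow hpos hc hzero (k := (-n).toNat + 1) (by push_cast; omega) t.2
      (Ideal.Quotient.eq_zero_iff_mem.1 h)
  · intro x
    obtain ⟨t, ht, hx⟩ := x.2.2 (-n).toNat
    refine ⟨⟨t, ht⟩, Subtype.ext (funext fun k => ?_)⟩
    change Ideal.Quotient.mk _ t = x.1 k
    have down : ∀ i j, i ≤ j → ∀ s, Ideal.Quotient.mk _ s = x.1 j →
        Ideal.Quotient.mk _ s = x.1 i := by
      intro i j hj
      induction j, hj using Nat.le_induction with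
      | base => exact fun s hs => hs
      | succ j hj ih => exact fun s hs => ih s (by rw [← x.2.1 j, ← hs, Nbhd.step_mk])
    rcases le_total k (-n).toNat with hk | hk
    · exact down _ _ hk t hx
    · obtain ⟨s, hs, hs'⟩ := x.2.2 k
      have h1 := (down _ _ hk s hs').trans hx.symm
      have h2 : s - t = 0 := eq_zero_of_mem_pow hpos hc hzero (k := (-n).toNat + 1)
        (by push_cast; omega) (sub_mem hs ht) (Ideal.Quotient.eq.1 h1)
      rw [← sub_eq_zero.1 h2, hs']

end Square
end DGJet

/-! ### Counting generators and the Euler vector field -/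

namespace DGJet
namespace DGSheaf
variable {ι : Type u} [Preorder ι] {X : DGSheaf ι} {U : ι} (S : SymStructure X)

namespace SymStructure

/-- The operator on `A` which multiplies a product of `k` generators by `c k`. -/
noncomputable def W (U : ι) (c : ℕ → X.R U) : X.A U →ₗ[X.R U] X.A U := (S.weight U c).choose

lemma W_gprod (c : ℕ → X.R U) (l : List (Σ m, S.G U m)) :
    S.W U c (S.gprod l) = c l.length • S.gprod l := (S.weight U c).choose_spec l

/-- Linear maps which agree on the products of generators are equal. -/
lemma linearMap_ext {f g : X.A U →ₗ[X.R U] X.A U} (h : ∀ l, f (S.gprod l) = g (S.gprod l)) :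
    f = g :=
  Env.linearMap_ext_gr fun _ _ hb => S.gr_induction (P := fun b => f b = g b) (by simp)
    (fun x y h1 h2 => by simp [h1, h2]) (fun r x h1 => by simp [h1]) (fun l _ => h l) hb

lemma W_W (c c' : ℕ → X.R U) (s : X.A U) : S.W U c (S.W U c' s) = S.W U (c * c') s := by
  refine LinearMap.congr_fun (f := S.W U c ∘ₗ S.W U c') (S.linearMap_ext fun l => ?_) s
  rw [LinearMap.comp_apply, W_gprod, map_smul, W_gprod, W_gprod, smul_smul, mul_comm]
  rfl

lemma W_add (c c' : ℕ → X.R U) (s : X.A U) : S.W U (c + c') s = S.W U c s + S.W U c' s := by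
  refine LinearMap.congr_fun (g := S.W U c + S.W U c') (S.linearMap_ext fun l => ?_) s
  rw [LinearMap.add_apply, W_gprod, W_gprod, W_gprod, ← add_smul]
  rfl

lemma W_one (s : X.A U) : S.W U 1 s = s := by
  refine LinearMap.congr_fun (g := LinearMap.id) (S.linearMap_ext fun l => ?_) s
  rw [W_gprod, Pi.one_apply, one_smul]
  rfl

lemma W_mem (c : ℕ → X.R U) {d : ℤ} {s : X.A U} (hs : s ∈ X.gr U d) : S.W U c s ∈ X.gr U d :=
  S.gr_induction (P := fun s => S.W U c s ∈ X.gr U d) (by rw [map_zero]; exact zero_mem _)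
    (fun x y h1 h2 => by rw [map_add]; exact add_mem h1 h2)
    (fun r x h1 => by rw [map_smul]; exact Submodule.smul_mem _ _ h1)
    (fun l hl => by rw [W_gprod]; exact Submodule.smul_mem _ _ (hl ▸ S.gprod_mem l)) hs

/-- The augmentation `A → R ⊆ A`, which kills the generators. -/
noncomputable def aug (U : ι) : X.A U →ₗ[X.R U] X.A U := S.W U (Pi.single 0 1)

lemma exists_aug (s : X.A U) : ∃ r, S.aug U s = algebraMap (X.R U) (X.A U) r := by
  induction s using DirectSum.Decomposition.inductionOn (X.gr U) with
  | zero => exact ⟨0, by simp⟩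
  | add x y h1 h2 =>
    obtain ⟨r, h1⟩ := h1
    obtain ⟨r', h2⟩ := h2
    exact ⟨r + r', by rw [map_add, h1, h2, map_add]⟩
  | homogeneous s =>
    refine S.gr_induction (P := fun s => ∃ r, S.aug U s = algebraMap (X.R U) (X.A U) r)
      ⟨0, by simp⟩ ?_ ?_ ?_ s.2
    · rintro x y ⟨r, h1⟩ ⟨r', h2⟩
      exact ⟨r + r', by rw [map_add, h1, h2, map_add]⟩
    · rintro r x ⟨r', h⟩
      exact ⟨r * r', by rw [map_smul, h, Algebra.smul_def, map_mul]⟩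
    · intro l _
      cases l with
      | nil => exact ⟨1, by rw [aug, W_gprod]; simp [gprod_nil]⟩
      | cons p l => exact ⟨0, by rw [aug, W_gprod]; simp⟩

lemma aug_algebraMap (r : X.R U) :
    S.aug U (algebraMap (X.R U) (X.A U) r) = algebraMap (X.R U) (X.A U) r := by
  rw [Algebra.algebraMap_eq_smul_one, map_smul, ← S.gprod_nil, aug, W_gprod]
  simp

/-- The operator which multiplies products of `k` generators by `k`. -/
noncomputable def count (U : ι) : X.A U →ₗ[X.R U] X.A U := S.W U fun k => k

/-- The operator which divides products of `k ≠ 0` generators by `k`. -/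
noncomputable def homotopy (U : ι) : X.A U →ₗ[X.R U] X.A U :=
  S.W U fun k => Ring.inverse (k : X.R U)

lemma homotopy_mem {d : ℤ} {s : X.A U} (hs : s ∈ X.gr U d) : S.homotopy U s ∈ X.gr U d :=
  S.W_mem _ hs

lemma homotopy_count_add_aug (s : X.A U) : S.homotopy U (S.count U s) + S.aug U s = s := by
  rw [homotopy, count, W_W, aug, ← W_add]
  convert S.W_one s using 3
  funext k
  rcases eq_or_ne k 0 with rfl | hk
  · simp
  · simp [hk, Ring.inverse_mul_cancel _ (S.isUnit_natCast U k hk)]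

lemma count_homotopy_add_aug (s : X.A U) : S.count U (S.homotopy U s) + S.aug U s = s := by
  conv_rhs => rw [← S.homotopy_count_add_aug s]
  rw [homotopy, count, W_W, W_W, mul_comm]

/-- The operator `count + 1` is injective, since the numbers `k + 1` are invertible. -/
lemma exists_leftInverse_count_add_one :
    ∃ f : X.A U →ₗ[X.R U] X.A U, ∀ s, f (S.count U s + s) = s := by
  refine ⟨S.W U fun k => Ring.inverse ((k + 1 : ℕ) : X.R U), fun s => ?_⟩
  rw [map_add, count, W_W, ← W_add]
  convert S.W_one s using 3
  funext k
  have := Ring.inverse_mul_cancel _ (S.isUnit_natCast U (k + 1) k.succ_ne_zero)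
  simp only [Pi.add_apply, Pi.mul_apply, Pi.one_apply]
  rw [← this]
  push_cast
  ring

end SymStructure

namespace Frame
open SymStructure
variable {S} (F : Frame X S.G U)

/-- A generator of the frame, as a homogeneous element. -/
def gen (m : ℕ) (j : Fin (F.J m)) : X.gr U (genDeg m) := ⟨F.x m j, S.deg (F.x_mem m j)⟩

/-- The Euler vector field `∑ x ∂/∂x` of the generators of degree at least `-M`. -/
noncomputable def euler (M : ℕ) : X.Tan U 0 :=
  ∑ m ∈ Finset.range M, ∑ j, Tan.cast (by rw [genDeg]; ring) (Tan.smul (F.gen m j) (F.vf m j))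

lemma euler_apply (M : ℕ) (V : Below U) (a : X.A V.1) : (F.euler M).1 V a =
    ∑ m ∈ Finset.range M, ∑ j, X.res V.2 (F.x m j) * (F.vf m j).1 V a := by
  rw [euler, AddSubgroup.val_finsetSum, Finset.sum_apply, LinearMap.sum_apply]
  refine Finset.sum_congr rfl fun m _ => ?_
  rw [AddSubgroup.val_finsetSum, Finset.sum_apply, LinearMap.sum_apply]
  rfl

lemma vf_euler (M : ℕ) : Env.vf (F.euler M) =
    ∑ m ∈ Finset.range M, ∑ j, Env.fn (F.gen m j) * Env.vf (F.vf m j) := by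
  simp only [euler, Env.vf_sum, Env.vf_cast, Env.fn_mul_vf]

lemma sum' (V : Below U) (m : ℕ) {g : X.A V.1} (hg : g ∈ S.G V.1 m) :
    ∑ j, X.res V.2 (F.x m j) * (F.vf m j).1 V g = g := by
  conv_rhs => rw [← F.sum V m g hg]
  refine Finset.sum_congr rfl fun j _ => ?_
  obtain ⟨r, hr⟩ := F.vf_range V m m j g hg
  rw [hr, Algebra.commutes]

lemma euler_gen (M : ℕ) (V : Below U) {m : ℕ} {g : X.A V.1} (hg : g ∈ S.G V.1 m) :
    (F.euler M).1 V g = if m < M then g else 0 := by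
  have h0 : ∀ m' ≠ m, ∑ j, X.res V.2 (F.x m' j) * (F.vf m' j).1 V g = 0 := fun m' hm' =>
    Finset.sum_eq_zero fun j _ => by rw [F.vf_ne V m' m j hm'.symm g hg, mul_zero]
  rw [euler_apply]
  split_ifs with h
  · rw [Finset.sum_eq_single m (fun m' _ hm' => h0 m' hm')
      (fun hm => absurd (Finset.mem_range.2 h) hm), F.sum' V m hg]
  · refine Finset.sum_eq_zero fun m' hm' => h0 m' ?_
    rintro rfl
    exact h (Finset.mem_range.1 hm')

/-- In degrees at least `-M` the Euler vector field counts generators: a product of such a degree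
involves only generators of degree at least `-M`. -/
lemma euler_eq_count (M : ℕ) (V : Below U) {q : ℤ} (hq : -(M : ℤ) ≤ q) {s : X.A V.1}
    (hs : s ∈ X.gr V.1 q) : (F.euler M).1 V s = S.count V.1 s := by
  refine S.gr_induction (P := fun s => (F.euler M).1 V s = S.count V.1 s) (by simp)
    (fun x y h1 h2 => by simp [h1, h2]) (fun r x h1 => by simp [h1]) (fun l hl => ?_) hs
  rw [count, W_gprod]
  have hM := S.lt_of_mem (hl ▸ hq)
  clear hl
  induction l with
  | nil => rw [S.gprod_nil, Tan.map_one]; simp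
  | cons a l ih =>
    have h := (F.euler M).2.2.2 V _ a.2.1 (S.gprod l) (S.deg a.2.2)
    rw [zero_mul, Int.negOnePow_zero, one_smul] at h
    rw [S.gprod_cons, h, ih fun q hq => hM q (List.mem_cons_of_mem _ hq), F.euler_gen M V a.2.2,
      if_pos (hM a (List.mem_cons_self ..)), List.length_cons, mul_smul_comm]
    push_cast
    rw [add_smul, one_smul, add_comm]

/-- The bracket with the Euler vector field measures the weight of a coordinate derivation, which
lowers the number of generators by one. -/
lemma bracket_euler {M m : ℕ} (hm : m < M) (j : Fin (F.J m)) :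
    Tan.bracket (F.vf m j) (F.euler M) = Tan.cast (add_zero _).symm (F.vf m j) := by
  refine Tan.ext_gen S fun V m' g hg => ?_
  have e : (Tan.bracket (F.vf m j) (F.euler M)).1 V g =
      (F.vf m j).1 V ((F.euler M).1 V g) - (F.euler M).1 V ((F.vf m j).1 V g) := by
    change ((F.vf m j).1 V * (F.euler M).1 V - (((m : ℤ) + 1) * 0).negOnePow •
      ((F.euler M).1 V * (F.vf m j).1 V)) g = _
    rw [mul_zero, Int.negOnePow_zero, one_smul]
    rfl
  obtain ⟨r, hr⟩ := F.vf_range V m m' j g hg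
  rw [e, F.euler_gen M V hg]
  change _ = (F.vf m j).1 V g
  split_ifs with h
  · rw [hr, Tan.map_algebraMap, sub_zero]
  · rw [F.vf_ne V m m' j (by omega) g hg]
    simp

lemma vf_mul_euler {M m : ℕ} (hm : m < M) (j : Fin (F.J m)) :
    Env.vf (F.vf m j) * Env.vf (F.euler M) =
      Env.vf (F.euler M) * Env.vf (F.vf m j) + Env.vf (F.vf m j) := by
  rw [Env.vf_mul_vf, F.bracket_euler hm, Env.vf_cast, mul_zero, Int.negOnePow_zero, one_smul]

end Frame

namespace SymStructure

/-- A set of sections of `A` which is stable under the derivations of a frame and contains no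
nonzero function contains no nonzero homogeneous element. -/
lemma eq_zero_of_stable (F : Frame X S.G U) (K : Set (X.A U))
    (hK : ∀ s ∈ K, ∀ m j, Tan.app (F.vf m j) s ∈ K)
    (hr : ∀ r, algebraMap (X.R U) (X.A U) r ∈ K → r = 0) {q : ℤ} {s : X.A U} (hs : s ∈ X.gr U q)
    (h : s ∈ K) : s = 0 := by
  induction hM : (-q).toNat using Nat.strong_induction_on generalizing q s with
  | _ M ih =>
    by_cases hq : 0 < q
    · exact S.eq_zero_of_pos hq hs
    have h1 : ∀ m j, Tan.app (F.vf m j) s = 0 := by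
      intro m j
      by_cases hq' : 0 < q + (m + 1)
      · exact S.eq_zero_of_pos hq' (Tan.app_mem (F.vf m j) hs)
      · exact ih _ (by omega) (Tan.app_mem (F.vf m j) hs) (hK s h m j) rfl
    have h2 : S.count U s = 0 := by
      rw [← F.euler_eq_count M ⟨U, le_refl U⟩ (q := q) (by omega) hs, F.euler_apply]
      refine Finset.sum_eq_zero fun m _ => Finset.sum_eq_zero fun j _ => ?_
      have := h1 m j
      rw [Tan.app] at this
      rw [this, mul_zero]
    have h3 := S.homotopy_count_add_aug s
    obtain ⟨r, hr'⟩ := S.exists_aug s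
    rw [h2, map_zero, zero_add, hr'] at h3
    rw [← h3, hr r (h3 ▸ h), map_zero]

/-- A homogeneous section of `A` vanishes if it vanishes on the thin open sets. -/
lemma eq_zero_of_thin {q : ℤ} {s : X.A U} (hs : s ∈ X.gr U q)
    (h : ∀ V (hV : V ≤ U), Thin X S.G V → X.res hV s = 0) : s = 0 := by
  refine S.eq_zero_of_stable (S.frame U) {s | ∀ V (hV : V ≤ U), Thin X S.G V → X.res hV s = 0}
    (fun s hs m j V hV hT => ?_) (fun r hr => S.detect r fun V hV hT => ?_) hs h
  · rw [← Tan.app_res, hs V hV hT, map_zero]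
  · have := hr V hV hT
    rw [X.res_algebraMap] at this
    exact S.algebraMap_injective V (by rw [this, map_zero])

/-- If no nonzero function is divisible by all powers of `a`, neither is a nonzero homogeneous
section of `A`. -/
lemma eq_zero_of_divisible (S : SymStructure X) {a : X.R U}
    (ha : ∀ r, (∀ n : ℕ, a ^ n ∣ r) → r = 0) {q : ℤ} {s : X.A U}
    (hs : s ∈ X.gr U q) (h : ∀ N : ℕ, ∃ s', s = a ^ N • s') : s = 0 := by
  refine S.eq_zero_of_stable (S.frame U) {s | ∀ N : ℕ, ∃ s', s = a ^ N • s'}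
    (fun s hs m j N => ?_) (fun r hr => ha r fun N => ?_) hs h
  · obtain ⟨s', rfl⟩ := hs N
    exact ⟨_, map_smul _ _ _⟩
  · obtain ⟨s', hs'⟩ := hr N
    obtain ⟨r', hr'⟩ := S.exists_aug s'
    refine ⟨r', S.algebraMap_injective U ?_⟩
    rw [← S.aug_algebraMap r, hs', map_smul, hr', map_mul, Algebra.smul_def]

end SymStructure
end DGSheaf
end DGJet

/-! ### Jets that vanish on the coordinate derivations -/

namespace DGJet
namespace DGSheaf
variable {ι : Type u} [Preorder ι] {X : DGSheaf ι} {U : ι} (S : SymStructure X)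

namespace Jet
open Env

lemma apply_fn_mul {n : ℤ} {φ : X.Fam U} (hφ : φ ∈ X.Jet U n) (V : Below U) {i : ℤ} (a : X.gr V.1 i)
    (u : X.Env V.1) : φ V (fn a * u) = (n * i).negOnePow • ((a : X.A V.1) * φ V u) :=
  hφ.2.2 V i a u

variable {S} (F : Frame X S.G U) {n : ℤ} {φ : X.Fam U} (hφ : φ ∈ X.Jet U n)

include hφ in
/-- The vanishing of a jet on a derivation which involves only finitely many of the coordinate
derivations follows from its vanishing on the latter. -/
lemma apply_vf_mul_of_finite {V : Below U} {w : X.Env V.1}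
    (h : ∀ m j, φ V (vf (Tan.res V.2 (F.vf m j)) * w) = 0) {p : ℤ} (D : X.Tan V.1 p) (N : ℕ)
    (hD : ∀ (V' : Below V.1) (m : ℕ), N ≤ m → ∀ g ∈ S.G V'.1 m, D.1 V' g = 0) :
    φ V (vf D * w) = 0 := by
  have hx : ∀ m j, X.res V.2 (F.x m j) ∈ X.gr V.1 (genDeg m) := fun m j =>
    X.res_mem V.2 (S.deg (F.x_mem m j))
  have e : D = ∑ m ∈ Finset.range N, ∑ j, Tan.cast (by rw [genDeg]; ring)
      (Tan.smul (⟨_, Tan.app_mem D (hx m j)⟩ : X.gr V.1 (genDeg m + p))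
        (Tan.res V.2 (F.vf m j))) := by
    refine Tan.ext_gen S fun V' m g hg => ?_
    have e1 : (∑ m ∈ Finset.range N, ∑ j, Tan.cast (by rw [genDeg]; ring)
        (Tan.smul (⟨_, Tan.app_mem D (hx m j)⟩ : X.gr V.1 (genDeg m + p))
          (Tan.res V.2 (F.vf m j))) : X.Tan V.1 p).1 V' g = ∑ m ∈ Finset.range N, ∑ j,
        X.res V'.2 (Tan.app D (X.res V.2 (F.x m j))) *
          (F.vf m j).1 ⟨V'.1, V'.2.trans V.2⟩ g := by
      rw [AddSubgroup.val_finsetSum, Finset.sum_apply, LinearMap.sum_apply]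
      refine Finset.sum_congr rfl fun m _ => ?_
      rw [AddSubgroup.val_finsetSum, Finset.sum_apply, LinearMap.sum_apply]
      rfl
    have h0 : ∀ m' ≠ m, ∑ j, X.res V'.2 (Tan.app D (X.res V.2 (F.x m' j))) *
          (F.vf m' j).1 ⟨V'.1, V'.2.trans V.2⟩ g = 0 := fun m' hm' =>
      Finset.sum_eq_zero fun j _ => by
        rw [F.vf_ne ⟨V'.1, V'.2.trans V.2⟩ m' m j hm'.symm g hg, mul_zero]
    rw [e1]
    by_cases hm : m < N
    · rw [Finset.sum_eq_single m (fun m' _ hm' => h0 m' hm')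
        (fun h => absurd (Finset.mem_range.2 hm) h)]
      conv_lhs => rw [← F.sum ⟨V'.1, V'.2.trans V.2⟩ m g hg, map_sum]
      refine Finset.sum_congr rfl fun j _ => ?_
      obtain ⟨r, hr⟩ := F.vf_range ⟨V'.1, V'.2.trans V.2⟩ m m j g hg
      have e2 : X.res V'.2 (Tan.app D (X.res V.2 (F.x m j))) =
          D.1 V' (X.res (V'.2.trans V.2) (F.x m j)) := by
        rw [Tan.app, ← D.2.1 ⟨V.1, le_refl _⟩ V' V'.2, X.res_trans]
      rw [hr, e2, ← Algebra.smul_def, map_smul, Algebra.smul_def, Algebra.commutes]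
    · rw [hD V' m (by omega) g hg]
      refine (Finset.sum_eq_zero fun m' hm' => h0 m' ?_).symm
      rintro rfl
      exact hm (Finset.mem_range.1 hm')
  rw [e]
  simp only [vf_sum, vf_cast, ← fn_mul_vf, Finset.sum_mul, map_sum, mul_assoc]
  refine Finset.sum_eq_zero fun m _ => Finset.sum_eq_zero fun j _ => ?_
  rw [apply_fn_mul hφ, h, mul_zero, smul_zero]

include hφ in
/-- Let `D'` be a derivation whose coefficients at the coordinate derivations of degree `m + 1` are
divisible by `a ^ m`, where no nonzero function is divisible by all powers of `a`. A jet which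
vanishes on the coordinate derivations vanishes on `D'`: for every `N`, all but finitely many of the
coefficients are divisible by `a ^ N`, hence so is the value of the jet. -/
lemma apply_vf_mul_of_scale {V : Below U} {w : X.Env V.1} {r : ℤ} (hw : w ∈ Env.gr X V.1 r)
    (h : ∀ m j, φ V (vf (Tan.res V.2 (F.vf m j)) * w) = 0) {p : ℤ} (D : X.Tan V.1 p)
    {a : X.R V.1} (ha : ∀ r, (∀ n : ℕ, a ^ n ∣ r) → r = 0) (c : ℕ → X.R V.1) {D' : X.Tan V.1 p}
    (hD' : ∀ (V' : Below V.1) m, ∀ g ∈ S.G V'.1 m,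
      D'.1 V' g = X.resR V'.2 (a ^ m * c m) • D.1 V' g) : φ V (vf D' * w) = 0 := by
  refine S.eq_zero_of_divisible ha (hφ.2.1 V _ _ (mono_mul_mem (vf_mem D') hw)) fun N => ?_
  obtain ⟨D₁, h₁⟩ := S.scale (fun m => if m < N then a ^ m * c m else 0) D
  obtain ⟨D₂, h₂⟩ := S.scale (fun m => if m < N then 0 else a ^ (m - N) * c m) D
  have hr : algebraMap (X.R V.1) (X.A V.1) (a ^ N) ∈ X.gr V.1 0 := by
    rw [Algebra.algebraMap_eq_smul_one]
    exact Submodule.smul_mem _ _ (SetLike.one_mem_graded _)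
  have e : D' = D₁ + Tan.cast (zero_add p) (Tan.smul ⟨_, hr⟩ D₂) := by
    refine Tan.ext_gen S fun V' m g hg => ?_
    change _ = D₁.1 V' g + X.res V'.2 (algebraMap _ _ (a ^ N)) * D₂.1 V' g
    rw [hD' V' m g hg, h₁ V' m g hg, h₂ V' m g hg, X.res_algebraMap, ← Algebra.smul_def, smul_smul,
      ← map_mul]
    split_ifs with hm
    · rw [mul_zero, map_zero, zero_smul, add_zero]
    · rw [← mul_assoc, ← pow_add, Nat.add_sub_cancel' (by omega), map_zero, zero_smul, zero_add]
  refine ⟨φ V (vf D₂ * w), ?_⟩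
  rw [e, vf_add, add_mul, map_add, vf_cast, ← fn_mul_vf, mul_assoc, apply_fn_mul hφ, mul_zero,
    Int.negOnePow_zero, one_smul, ← Algebra.smul_def, apply_vf_mul_of_finite F hφ h D₁ N, zero_add]
  intro V' m hm g hg
  rw [h₁ V' m g hg, if_neg (by omega), map_zero, zero_smul]

include hφ in
/-- A jet which vanishes on the coordinate derivations vanishes on all derivations, although these
are infinite combinations of the coordinate derivations. -/
lemma apply_vf_mul {V : Below U} {w : X.Env V.1} {r : ℤ} (hw : w ∈ Env.gr X V.1 r)
    (h : ∀ (W : Below U) (hW : W.1 ≤ V.1) m j,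
      φ W (vf (Tan.res W.2 (F.vf m j)) * Env.res hW w) = 0) {p : ℤ} (D : X.Tan V.1 p) :
    φ V (vf D * w) = 0 := by
  refine S.eq_zero_of_thin (hφ.2.1 V _ _ (mono_mul_mem (vf_mem D) hw)) fun W hW hT => ?_
  let W' : Below U := ⟨W, hW.trans V.2⟩
  rw [← hφ.1 V W' hW, map_mul, res_vf]
  have hw' : Env.res hW w ∈ Env.gr X W r := Env.res_mem hW hw
  rcases hT with ⟨a, b, hab, ha, hb⟩ | ⟨N, hN⟩
  · -- Write `1 = a ^ m * s m + b ^ m * t m` for every `m`, and split `D` accordingly.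
    choose s t hst using fun m : ℕ => (hab.pow (m := m) (n := m))
    obtain ⟨D₁, h₁⟩ := S.scale (fun m => a ^ m * s m) (Tan.res hW D)
    obtain ⟨D₂, h₂⟩ := S.scale (fun m => b ^ m * t m) (Tan.res hW D)
    have e : Tan.res hW D = D₁ + D₂ := by
      refine Tan.ext_gen S fun V' m g hg => ?_
      change _ = D₁.1 V' g + D₂.1 V' g
      rw [h₁ V' m g hg, h₂ V' m g hg, ← add_smul, ← map_add, mul_comm (a ^ m), mul_comm (b ^ m), hst,
        map_one, one_smul]
    rw [e, vf_add, add_mul, map_add,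
      apply_vf_mul_of_scale (V := W') F hφ hw' (h W' hW) _ ha s h₁,
      apply_vf_mul_of_scale (V := W') F hφ hw' (h W' hW) _ hb t h₂, add_zero]
  · refine apply_vf_mul_of_finite (V := W') F hφ (h W' hW) _ N fun V' m hm g hg => ?_
    rw [hN V'.1 V'.2 m hm g hg, map_zero]

/-- Jets are determined by their values on the products of coordinate derivations: a class `Z` of
jets vanishing at `1` which is stable under right translation by the coordinate derivations
consists of zero only. -/
lemma eq_zero_of_stable (Z : ℤ → Set (X.Fam U)) (hZ : ∀ n, ∀ φ ∈ Z n, φ ∈ X.Jet U n)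
    (h1 : ∀ n, ∀ φ ∈ Z n, ∀ V, φ V 1 = 0)
    (ht : ∀ n, ∀ φ ∈ Z n, ∀ (m : ℕ) j, trans (m + 1) (vf (F.vf m j)) φ ∈ Z (n + (m + 1)))
    {n : ℤ} {φ : X.Fam U} (hφ : φ ∈ Z n) : φ = 0 := by
  have key : ∀ (k : ℕ) (n : ℤ), ∀ φ ∈ Z n, ∀ (V : Below U) (l : List (Σ n, X.Tan V.1 n)),
      l.length = k → φ V (vprod l) = 0 := by
    intro k
    induction k using Nat.strong_induction_on with
    | _ k ih =>
      intro n φ hφ V l hl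
      cases l with
      | nil => exact h1 n φ hφ V
      | cons p l =>
        rw [vprod_cons]
        refine apply_vf_mul F (hZ n φ hφ) (vprod_mem l) (fun W hW m j => ?_) p.2
        rw [res_vprod]
        have hl' : (l.map fun p => (⟨p.1, Tan.res hW p.2⟩ : Σ n, X.Tan W.1 n)).length = l.length := by
          simp
        generalize l.map (fun p => (⟨p.1, Tan.res hW p.2⟩ : Σ n, X.Tan W.1 n)) = l' at hl' ⊢
        have hlk : l'.length < k := by rw [hl', ← hl]; simp
        obtain ⟨c, hc⟩ := vf_mul_vprod_sub_mem (Tan.res W.2 (F.vf m j)) l'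
        have e1 : ∀ u ∈ AddSubgroup.closure {u | ∃ l'' : List (Σ n, X.Tan W.1 n),
            l''.length = l'.length ∧ u = vprod l''}, φ W u = 0 := by
          intro u hu
          induction hu using AddSubgroup.closure_induction with
          | mem u h => obtain ⟨l'', h, rfl⟩ := h; exact ih _ hlk n φ hφ W l'' h
          | zero => rw [map_zero]
          | add x y _ _ h1 h2 => rw [map_add, h1, h2, add_zero]
          | neg x _ h => rw [map_neg, h, neg_zero]
        have e2 : φ W (vprod l' * vf (Tan.res W.2 (F.vf m j))) = 0 := by
          have h := ih _ hlk _ _ (ht n φ hφ m j) W l' rfl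
          rw [trans_apply, par_of_mem _ (vprod_mem l'), smul_mul_assoc, map_sign, res_vf] at h
          exact (smul_eq_zero_iff_eq _).1 h
        have h := e1 _ hc
        rwa [map_sub, map_sign, e2, smul_zero, sub_zero] at h
  funext V
  refine AddMonoidHom.ext fun u => ?_
  induction mem_closure_vprod u using AddSubgroup.closure_induction with
  | mem u h =>
    obtain ⟨i, a, l, rfl⟩ := h
    rw [apply_fn_mul (hZ n φ hφ), key _ n φ hφ V l rfl, mul_zero, smul_zero]
    rfl
  | zero => rw [map_zero, map_zero]
  | add x y _ _ h1 h2 => rw [map_add, h1, h2, map_add]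
  | neg x _ h => rw [map_neg, h, map_neg]

/-- There are no jets of positive degree. -/
lemma eq_zero_of_pos (S : SymStructure X) {n : ℤ} (hn : 0 < n) {φ : X.Fam U} (hφ : φ ∈ X.Jet U n) :
    φ = 0 := by
  refine eq_zero_of_stable (S.frame U) (fun n => {φ | 0 < n ∧ φ ∈ X.Jet U n}) (fun n φ h => h.2)
    (fun n φ h V => ?_) (fun n φ h m j => ⟨by have := h.1; omega, trans_mem (vf_mem _) h.2⟩)
    (n := n) ⟨hn, hφ⟩
  have h1 : (1 : X.Env V.1) ∈ Env.gr X V.1 0 := mono_mem (X := X) (U := V.1) []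
  have h2 := h.2.2.1 V 0 1 h1
  rw [zero_add] at h2
  exact S.eq_zero_of_pos h.1 h2

end Jet
end DGSheaf
end DGJet

/-! ### The jet map is bijective -/

namespace DGJet
namespace DGSheaf
variable {ι : Type u} [Preorder ι] {X : DGSheaf ι} {U : ι} {S : SymStructure X}

lemma jetFun_one_right (a : X.A U) (V : Below U) :
    jetFun U (Square.tmul _ a 1) V 1 = X.res V.2 a := by
  rw [jetFun_apply, sqRes_tmul, map_one, Env.pair_tmul, Env.sact_one, mul_one]

lemma shift_vf_one {n : ℤ} (D : X.Tan U n) (a : X.A U) :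
    Env.shift (Env.vf D) (Square.tmul _ a 1) = 0 := by
  rw [Env.shift_tmul, Env.sact_one_right, Env.act_vf, Tan.app, Tan.map_one, Square.tmul_zero]

namespace SymStructure

/-- The augmentation of the second factor maps `A ⊗_R A` to `A ⊗ 1`. -/
lemma exists_rmap_aug (S : SymStructure X) (t : Square (X.gr U)) :
    ∃ a, Square.rmap _ (S.aug U) t = Square.tmul _ a 1 := by
  induction t using Square.induction with
  | h0 => exact ⟨0, by simp⟩
  | hadd x y h1 h2 =>
    obtain ⟨a, h1⟩ := h1
    obtain ⟨b, h2⟩ := h2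
    exact ⟨a + b, by rw [map_add, h1, h2, Square.add_tmul]⟩
  | ht i j a b ha hb =>
    obtain ⟨r, hr⟩ := S.exists_aug b
    exact ⟨_, by rw [Square.rmap_tmul, hr, Square.tmul_algebraMap]⟩

end SymStructure

namespace Frame
variable (F : Frame X S.G U) {n : ℤ} {M : ℕ} (hM : -(M : ℤ) ≤ n) {t : Square (X.gr U)}
  (ht : t ∈ Square.gr (X.gr U) n)

include hM ht in
/-- The Euler vector field acts on `A ⊗_R A`, through the second factor, by counting generators. -/
lemma shift_euler : Env.shift (Env.vf (F.euler M)) t = Square.rmap _ (S.count U) t := by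
  refine Square.eq_of_mem_gr (fun i j hij a ha b hb => ?_) ht
  rw [Env.shift_tmul, Square.rmap_tmul, Env.sact_even (Env.vf_mem _), Env.act_vf, Tan.app]
  rcases lt_or_ge 0 i with hi | hi
  · rw [S.eq_zero_of_pos hi ha, Square.zero_tmul, Square.zero_tmul]
  · rw [F.euler_eq_count M ⟨U, le_refl U⟩ (q := j) (by omega) hb]

include hM ht in
/-- Up to elements `a ⊗ 1`, an element of `A ⊗_R A` is recovered from its image under the Euler
vector field by dividing by the number of generators. -/
lemma rmap_homotopy_shift_euler : Square.rmap _ (S.homotopy U) (Env.shift (Env.vf (F.euler M)) t) +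
    Square.rmap _ (S.aug U) t = t := by
  rw [F.shift_euler hM ht]
  refine Square.hom_ext (f := (Square.rmap _ (S.homotopy U)).comp (Square.rmap _ (S.count U)) +
    Square.rmap _ (S.aug U)) (g := AddMonoidHom.id _) (fun i j a ha b hb => ?_) t
  change Square.tmul (X.gr U) a (S.homotopy U (S.count U b)) + Square.tmul (X.gr U) a (S.aug U b) =
    Square.tmul (X.gr U) a b
  rw [← Square.tmul_add, S.homotopy_count_add_aug]

include hM ht in
lemma shift_euler_rmap_homotopy : Env.shift (Env.vf (F.euler M)) (Square.rmap _ (S.homotopy U) t) +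
    Square.rmap _ (S.aug U) t = t := by
  have h := Square.rmap_mem (p := 0) (f := S.homotopy U)
    (fun i a ha => by rw [add_zero]; exact S.homotopy_mem ha) ht
  rw [F.shift_euler (n := n + 0) (by omega) h]
  refine Square.hom_ext (f := (Square.rmap _ (S.count U)).comp (Square.rmap _ (S.homotopy U)) +
    Square.rmap _ (S.aug U)) (g := AddMonoidHom.id _) (fun i j a ha b hb => ?_) t
  change Square.tmul (X.gr U) a (S.count U (S.homotopy U b)) + Square.tmul (X.gr U) a (S.aug U b) =
    Square.tmul (X.gr U) a b
  rw [← Square.tmul_add, S.count_homotopy_add_aug]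

include hM ht in
/-- The numbers of generators are not negative, so that `-1` is not an eigenvalue of the Euler
vector field. -/
lemma eq_zero_of_shift_euler_add_self (h : Env.shift (Env.vf (F.euler M)) t + t = 0) : t = 0 := by
  obtain ⟨f, hf⟩ := S.exists_leftInverse_count_add_one (U := U)
  rw [F.shift_euler hM ht] at h
  have e : Square.rmap _ f (Square.rmap _ (S.count U) t + t) = t := by
    refine Square.hom_ext (f := (Square.rmap _ f).comp (Square.rmap _ (S.count U) +
      AddMonoidHom.id _)) (g := AddMonoidHom.id _) (fun i j a ha b hb => ?_) t
    change Square.rmap _ f (Square.tmul _ a _ + Square.tmul _ a b) = Square.tmul _ a b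
    rw [← Square.tmul_add, Square.rmap_tmul, hf]
  rw [← e, h, map_zero]

end Frame

/-- An element of `A ⊗_R A` is determined by its jet. If the jet of `t` is zero, so are the jets
of the elements `(1 ⊗ ∂) t` for the coordinate derivations `∂`, which have larger degree. By
induction these elements vanish, and then so does the image of `t` under the Euler vector field.
Hence `t` is of the form `a ⊗ 1`, and `a` is the value of its jet at `1`. -/
lemma eq_zero_of_jetFun (S : SymStructure X) {n : ℤ} {t : Square (X.gr U)}
    (ht : t ∈ Square.gr (X.gr U) n) (h : jetFun U t = 0) : t = 0 := by
  induction hM : (-n).toNat using Nat.strong_induction_on generalizing n t with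
  | _ M ih =>
    let F := S.frame U
    by_cases hn : 0 < n
    · have h1 := Square.proj_of_mem_gr (fun i hi a => S.eq_zero_of_pos hi) (n := n) ht
      have h2 := Square.proj_low (fun i hi a => S.eq_zero_of_pos hi) (k := 0) (n := n)
        (by simpa using hn)
        (Square.diagIdeal_pow_le_low (fun i hi a => S.eq_zero_of_pos hi) (X.comm U)
          (fun a ha => S.exists_algebraMap ha) 0 (t := t)
          (by rw [Submodule.pow_zero, Ideal.one_eq_top]; trivial))
      rwa [h1, if_pos rfl] at h2
    have h1 : ∀ m < M, ∀ j, Env.shift (Env.vf (F.vf m j)) t = 0 := fun m hm j =>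
      ih _ (by omega) (Env.shift_mem (Env.vf_mem _) ht)
        (by rw [← trans_jetFun (Env.vf_mem _), h, map_zero]) rfl
    have h2 : Env.shift (Env.vf (F.euler M)) t = 0 := by
      change Env.shiftHom U _ t = 0
      rw [F.vf_euler, map_sum, AddMonoidHom.finsetSum_apply]
      refine Finset.sum_eq_zero fun m hm => ?_
      rw [map_sum, AddMonoidHom.finsetSum_apply]
      refine Finset.sum_eq_zero fun j _ => ?_
      have h3 := Env.shift_shift (Env.fn (F.gen m j)) (Env.vf_mem (F.vf m j)) t
      rw [h1 m (Finset.mem_range.1 hm), map_zero, Env.par_of_mem _ (Env.fn_mem _),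
        smul_mul_assoc] at h3
      change _ = Env.shiftHom U _ t at h3
      rw [map_sign, AddMonoidHom.smul_apply] at h3
      exact (smul_eq_zero_iff_eq _).1 h3.symm
    have h3 := F.rmap_homotopy_shift_euler (M := M) (by omega) ht
    obtain ⟨a, ha⟩ := S.exists_rmap_aug t
    rw [h2, map_zero, zero_add, ha] at h3
    have h4 := jetFun_one_right a ⟨U, le_refl U⟩
    rw [h3, h, X.res_refl] at h4
    rw [← h3, ← h4]
    exact Square.zero_tmul _ _

/-- Every jet comes from an element of `A ⊗_R A`. By descending induction on the degree of the
jet, as its translates by the coordinate derivations have larger degree. -/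
lemma exists_jetFun_eq (S : SymStructure X) {n : ℤ} {φ : X.Fam U} (hφ : φ ∈ X.Jet U n) :
    ∃ t ∈ Square.gr (X.gr U) n, jetFun U t = φ := by
  induction hM : (-n).toNat using Nat.strong_induction_on generalizing n φ with
  | _ M ih =>
    let F := S.frame U
    by_cases hn : 0 < n
    · exact ⟨0, zero_mem _, by rw [map_zero, Jet.eq_zero_of_pos S hn hφ]⟩
    have hMn : -(M : ℤ) ≤ n := by omega
    -- The translates of `φ` by the coordinate derivations come from `A ⊗_R A` by induction; so does
    -- its translate by the Euler vector field.
    have h1 : ∀ m < M, ∀ j, ∃ t ∈ Square.gr (X.gr U) (n + (m + 1)),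
        jetFun U t = trans (m + 1) (Env.vf (F.vf m j)) φ := fun m hm j =>
      ih _ (by omega) (trans_mem (Env.vf_mem _) hφ) rfl
    have h2 : ∃ t ∈ Square.gr (X.gr U) n, jetFun U t = trans 0 (Env.vf (F.euler M)) φ := by
      have e1 : trans 0 (Env.vf (F.euler M)) φ = ∑ m ∈ Finset.range M, ∑ j,
          trans 0 (Env.fn (F.gen m j) * Env.vf (F.vf m j)) φ := by
        change transHom 0 φ _ = ∑ m ∈ Finset.range M, ∑ j, transHom 0 φ _
        rw [F.vf_euler]
        simp only [map_sum]
      have e2 : ∀ m < M, ∀ j, ∃ t ∈ Square.gr (X.gr U) n,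
          jetFun U t = trans 0 (Env.fn (F.gen m j) * Env.vf (F.vf m j)) φ := by
        intro m hm j
        obtain ⟨t, ht, h⟩ := h1 m hm j
        have h3 := trans_trans (q' := m + 1) (Env.vf (F.vf m j)) (Env.fn_mem (F.gen m j)) φ
        rw [← h, trans_jetFun (Env.fn_mem _)] at h3
        have e3 : genDeg m + ((m : ℤ) + 1) = 0 := by rw [genDeg]; ring
        rw [e3] at h3
        have h4 := Env.shift_mem (Env.fn_mem (F.gen m j)) ht
        have e4 : n + ((m : ℤ) + 1) + genDeg m = n := by rw [genDeg]; ring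
        rw [e4] at h4
        refine ⟨_, Env.sign_mem _ (((m : ℤ) + 1) * genDeg m).negOnePow h4, ?_⟩
        rw [map_sign, h3, smul_smul, Int.units_mul_self, one_smul]
      choose! t ht using e2
      refine ⟨∑ m ∈ Finset.range M, ∑ j, t m j, sum_mem fun m hm => sum_mem fun j _ =>
        (ht m (Finset.mem_range.1 hm) j).1, ?_⟩
      rw [e1, map_sum]
      refine Finset.sum_congr rfl fun m hm => ?_
      rw [map_sum]
      exact Finset.sum_congr rfl fun j _ => (ht m (Finset.mem_range.1 hm) j).2
    obtain ⟨t, ht, h2⟩ := h2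
    -- Divide the translate by the Euler vector field by the number of generators, and subtract the
    -- result from `φ`. The difference `ψ` is killed by the coordinate derivations.
    have ht' : Square.rmap _ (S.homotopy U) t ∈ Square.gr (X.gr U) n := by
      have h := Square.rmap_mem (p := 0) (f := S.homotopy U)
        (fun i a ha => by rw [add_zero]; exact S.homotopy_mem ha) ht
      rwa [add_zero] at h
    have h3 := F.shift_euler_rmap_homotopy hMn ht
    generalize Square.rmap _ (S.homotopy U) t = t' at ht' h3
    obtain ⟨a, ha⟩ := S.exists_rmap_aug t
    have hψ : φ - jetFun U t' ∈ X.Jet U n := sub_mem hφ (jetFun_mem ht')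
    have h4 : trans 0 (Env.vf (F.euler M)) (φ - jetFun U t') = jetFun U (Square.tmul _ a 1) := by
      rw [map_sub, ← h2, trans_jetFun (Env.vf_mem _), ← map_sub, ← ha]
      congr 1
      rw [sub_eq_iff_eq_add', h3]
    have h5 : ∀ m < M, ∀ j, trans (m + 1) (Env.vf (F.vf m j)) (φ - jetFun U t') = 0 := by
      intro m hm j
      obtain ⟨s, hs, h⟩ := h1 m hm j
      have hs' := sub_mem hs (Env.shift_mem (Env.vf_mem (F.vf m j)) ht')
      have e : trans (m + 1) (Env.vf (F.vf m j)) (φ - jetFun U t') =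
          jetFun U (s - Env.shift (Env.vf (F.vf m j)) t') := by
        rw [map_sub, map_sub, h, trans_jetFun (Env.vf_mem _)]
      generalize φ - jetFun U t' = ψ at *
      generalize s - Env.shift (Env.vf (F.vf m j)) t' = s' at *
      have h6 := trans_trans (q' := 0) (Env.vf (F.euler M)) (Env.vf_mem (F.vf m j)) ψ
      have h7 := trans_trans (q' := m + 1) (Env.vf (F.vf m j)) (Env.vf_mem (F.euler M)) ψ
      rw [h4, trans_jetFun (Env.vf_mem _), shift_vf_one, map_zero, zero_mul, Int.negOnePow_zero,
        one_smul, F.vf_mul_euler hm, trans_add, add_zero] at h6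
      rw [mul_zero, Int.negOnePow_zero, one_smul, zero_add, e, trans_jetFun (Env.vf_mem _)] at h7
      rw [← h7, e, ← map_add] at h6
      rw [e, F.eq_zero_of_shift_euler_add_self (n := n + (m + 1)) (by omega) hs'
        (eq_zero_of_jetFun S (add_mem
          (by simpa using Env.shift_mem (Env.vf_mem (F.euler M)) hs') hs') h6.symm), map_zero]
    generalize hψ' : φ - jetFun U t' = ψ at *
    -- What remains is the constant jet with value `ψ 1`.
    have hU : (1 : X.Env U) ∈ Env.gr X U 0 := Env.mono_mem (X := X) (U := U) []
    have hb : ψ ⟨U, le_refl U⟩ 1 ∈ X.gr U n := by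
      have h := hψ.2.1 ⟨U, le_refl U⟩ 0 1 hU
      rwa [zero_add] at h
    have h6 : ψ - jetFun U (Square.tmul _ (ψ ⟨U, le_refl U⟩ 1) 1) = 0 := by
      refine Jet.eq_zero_of_stable F (fun n => {χ | χ ∈ X.Jet U n ∧ (∀ V, χ V 1 = 0) ∧
        ∀ (m : ℕ) j, trans (m + 1) (Env.vf (F.vf m j)) χ = 0}) (fun n χ h => h.1) (fun n χ h => h.2.1)
        (fun n χ h m j => ?_) (n := n)
        ⟨sub_mem hψ (jetFun_mem (Square.tmul_one_mem hb)), fun V => ?_, fun m j => ?_⟩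
      · rw [h.2.2 m j]
        exact ⟨zero_mem _, fun V => rfl, fun m j => map_zero _⟩
      · have h := hψ.1 ⟨U, le_refl U⟩ V V.2 1
        rw [map_one] at h
        rw [Pi.sub_apply, AddMonoidHom.sub_apply, jetFun_one_right, h, sub_self]
      · rw [map_sub, trans_jetFun (Env.vf_mem _), shift_vf_one, map_zero, sub_zero]
        rcases lt_or_ge m M with hm | hm
        · exact h5 m hm j
        · exact Jet.eq_zero_of_pos S (by omega) (trans_mem (Env.vf_mem (F.vf m j)) hψ)
    refine ⟨_, add_mem ht' (Square.tmul_one_mem hb), ?_⟩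
    rw [map_add, ← sub_eq_zero.1 h6, ← hψ']
    abel

/-- The jet map is an isomorphism. -/
lemma toJet_bijective (S : SymStructure X) (U : ι) (n : ℤ) :
    Function.Bijective (toJet (X := X) U n) := by
  constructor
  · refine (injective_iff_map_eq_zero _).2 fun t ht => Subtype.ext ?_
    exact eq_zero_of_jetFun S t.2 (congrArg Subtype.val ht)
  · intro φ
    obtain ⟨t, ht, h⟩ := exists_jetFun_eq S φ.2
    exact ⟨⟨t, ht⟩, Subtype.ext h⟩

/-- The comparison of formal functions on a neighbourhood of the diagonal and jets. -/
theorem exists_formal_equiv_jet (S : SymStructure X) :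
    ∃ Φ : ∀ (U : ι) (n : ℤ), X.Formal U n ≃+ X.Jet U n,
      (∀ (U : ι) (m n : ℤ) (x : X.Formal U m) (y : X.Formal U n),
        Φ U (m + n) (Formal.mul x y) = Jet.mul (Φ U m x) (Φ U n y)) ∧
      (∀ (U : ι) (i j : ℤ) (a : X.gr U i) (b : X.gr U j),
        Φ U (i + j) (Formal.ofTensor a b) = Jet.ofTensor a b) ∧
      (∀ (U : ι) (n : ℤ) (x : X.Formal U n), Φ U (n + 1) (Formal.diff x) = Jet.diff (Φ U n x)) ∧
      (∀ (U V : ι) (h : V ≤ U) (n : ℤ) (x : X.Formal U n),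
        Φ V n (Formal.res h x) = Jet.res h (Φ U n x)) := by
  have hb : ∀ U n, Function.Bijective (Square.Completion.ofHom (X.comm U) n) := fun U n =>
    Square.Completion.ofHom_bijective (fun i hi a => S.eq_zero_of_pos hi) (X.comm U)
      (fun a ha => S.exists_algebraMap ha) n
  let e : ∀ U n, Square.gr (X.gr U) n ≃+ X.Formal U n := fun U n => AddEquiv.ofBijective _ (hb U n)
  let e' : ∀ U n, Square.gr (X.gr U) n ≃+ X.Jet U n := fun U n =>
    AddEquiv.ofBijective _ (toJet_bijective S U n)
  have he : ∀ U n (t : Square.gr (X.gr U) n), ((e U n).symm.trans (e' U n))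
      (Square.Completion.of (X.comm U) t.1 t.2) = toJet U n t := fun U n t => by
    change e' U n ((e U n).symm (e U n t)) = _
    rw [AddEquiv.symm_apply_apply]
    rfl
  refine ⟨fun U n => (e U n).symm.trans (e' U n), fun U m n x y => ?_, fun U i j a b => ?_,
    fun U n x => ?_, fun U V h n x => ?_⟩
  · obtain ⟨s, rfl⟩ := (hb U m).2 x
    obtain ⟨t, rfl⟩ := (hb U n).2 y
    exact (he U (m + n) ⟨s.1 * t.1, Square.mul_mem _ s.2 t.2⟩).trans ((toJet_mul s t).trans
      (congrArg₂ Jet.mul (he U m s).symm (he U n t).symm))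
  · exact (he U (i + j) ⟨_, Square.tmul_mem _ a.2 b.2⟩).trans (toJet_tmul a b)
  · obtain ⟨t, rfl⟩ := (hb U n).2 x
    exact (he U (n + 1) ⟨_, Square.diff_mem (X.d_der U) t.2⟩).trans ((toJet_diff t).trans
      (congrArg Jet.diff (he U n t).symm))
  · obtain ⟨t, rfl⟩ := (hb U n).2 x
    exact (he V n ⟨_, Square.map_mem _ _ _ _ t.2⟩).trans ((toJet_res h t).trans
      (congrArg (Jet.res h) (he U n t).symm))

end DGSheaf
end DGJet

/-! ### Derivations of graded symmetric algebras -/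

namespace DGJet

namespace GSym
variable {R : Type u} [CommRing R] {M : ℕ → Type u} [∀ n, AddCommGroup (M n)] [∀ n, Module R (M n)]

lemma gr_induction {d : ℤ} {P : GSym R M → Prop} (h0 : P 0)
    (hadd : ∀ x y, P x → P y → P (x + y)) (hsmul : ∀ (r : R) x, P x → P (r • x))
    (hl : ∀ l : List (Σ n, M n), (l.map fun p => genDeg p.1).sum = d → P (l.map (gen R)).prod)
    {s : GSym R M} (hs : s ∈ gr R M d) : P s := by
  rw [gr] at hs
  induction hs using Submodule.span_induction with
  | mem x h => obtain ⟨l, h1, rfl⟩ := h; exact hl l h1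
  | zero => exact h0
  | add x y _ _ h1 h2 => exact hadd _ _ h1 h2
  | smul r x _ h => exact hsmul r x h

variable (R M) in
/-- The ground ring is a retract of the graded symmetric algebra. -/
lemma algebraMap_injective : Function.Injective (algebraMap R (GSym R M)) :=
  Function.LeftInverse.injective (g := lift R M (S := R) (fun _ => 0) fun m n x y => by simp)
    fun r => AlgHom.commutes _ r

/-- Multiplication of the products of `k` generators by a number that depends on `k` only is
well defined, since the relations of the graded symmetric algebra are homogeneous in the number of
generators. -/
lemma exists_weight (c : ℕ → R) : ∃ W : GSym R M →ₗ[R] GSym R M, ∀ l : List (Σ n, M n),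
    W (l.map (gen R)).prod = c l.length • (l.map (gen R)).prod := by
  let L := lift R M (S := Polynomial (GSym R M)) (fun n =>
    { toFun x := Polynomial.monomial 1 (gen R ⟨n, x⟩)
      map_add' x y := by rw [gen_add, map_add]
      map_smul' r x := by rw [gen_smul, RingHom.id_apply, Polynomial.smul_monomial] })
    (fun m n x y => by
      simp only [LinearMap.coe_mk, AddHom.coe_mk, Polynomial.monomial_mul_monomial]
      rw [gen_comm, map_sign (Polynomial.monomial (1 + 1))])
  have hL : ∀ l : List (Σ n, M n),
      L (l.map (gen R)).prod = Polynomial.monomial l.length (l.map (gen R)).prod := by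
    intro l
    induction l with
    | nil => simp
    | cons p l ih =>
      rw [List.map_cons, List.prod_cons, map_mul, ih, lift_gen]
      simp only [LinearMap.coe_mk, AddHom.coe_mk, Polynomial.monomial_mul_monomial]
      rw [List.length_cons, add_comm]
  refine ⟨(Polynomial.lsum fun k => c k • LinearMap.id) ∘ₗ L.toLinearMap, fun l => ?_⟩
  change Polynomial.lsum _ (L _) = _
  rw [hL, Polynomial.lsum_apply, Polynomial.sum_monomial_index _ _ (by simp)]
  rfl

section Derivation
variable {p : ℤ} (θ : ∀ n, M n →ₗ[R] GSym R M)
  (hθ : ∀ n x, θ n x ∈ gr R M (genDeg n + p))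

include hθ in
/-- A map from the generators to `S_R(E[1])` extends to a derivation. A derivation of
degree `p` is the same as a morphism of algebras `a ↦ !![(-1)^{p|a|} a, D a; 0, a]`. -/
lemma exists_derivation : ∃ D : GSym R M →ₗ[R] GSym R M,
    (∀ n x, D (gen R ⟨n, x⟩) = θ n x) ∧ (∀ i, ∀ a ∈ gr R M i, D a ∈ gr R M (i + p)) ∧
    ∀ i, ∀ a ∈ gr R M i, ∀ b, D (a * b) = D a * b + (p * i).negOnePow • (a * D b) := by
  let L := lift R M (S := Matrix (Fin 2) (Fin 2) (GSym R M)) (fun n =>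
    { toFun x := !![(p * genDeg n).negOnePow • gen R ⟨n, x⟩, θ n x; 0, gen R ⟨n, x⟩]
      map_add' x y := by ext i j; fin_cases i <;> fin_cases j <;> simp [gen_add]
      map_smul' r x := by
        ext i j; fin_cases i <;> fin_cases j <;> simp [gen_smul, smul_comm r] })
    (fun m n x y => by
      have h1 := graded_comm R M (gen_mem R M ⟨m, x⟩) (hθ n y)
      have h2 := graded_comm R M (hθ m x) (gen_mem R M ⟨n, y⟩)
      have h3 := gen_comm R (M := M) ⟨m, x⟩ ⟨n, y⟩
      have e1 : (p * genDeg m).negOnePow * (genDeg m * (genDeg n + p)).negOnePow =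
          (genDeg m * genDeg n).negOnePow := by
        rw [← Int.negOnePow_add, Int.negOnePow_eq_iff]
        exact ⟨p * genDeg m, by ring⟩
      simp only [LinearMap.coe_mk, AddHom.coe_mk]
      rw [Matrix.mul_fin_two, Matrix.mul_fin_two, Matrix.smul_of, Matrix.smul_cons,
        Matrix.smul_cons, Matrix.smul_cons, Matrix.smul_cons, Matrix.smul_cons, Matrix.smul_cons]
      simp only [mul_zero, zero_mul, add_zero, zero_add, smul_mul_assoc, mul_smul_comm, h1, h2, h3,
        smul_smul, smul_add, e1, Matrix.smul_empty, smul_zero]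
      rw [add_comm, add_mul, Int.negOnePow_add]
      have e2 : (p * genDeg n).negOnePow * ((p * genDeg m).negOnePow *
          (genDeg m * genDeg n).negOnePow) = (genDeg m * genDeg n).negOnePow *
            ((p * genDeg m).negOnePow * (p * genDeg n).negOnePow) := by
        rw [← mul_assoc, mul_comm, mul_comm (p * genDeg n).negOnePow]
      rw [e2])
  have hgen : ∀ q : Σ n, M n, L (gen R q) =
      !![(p * genDeg q.1).negOnePow • gen R q, θ q.1 q.2; 0, gen R q] := fun q => lift_gen ..
  have hL : ∀ i, ∀ a ∈ gr R M i, ∃ d ∈ gr R M (i + p),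
      L a = !![(p * i).negOnePow • a, d; 0, a] := by
    intro i a ha
    refine gr_induction (P := fun a => ∃ d ∈ gr R M (i + p),
      L a = !![(p * i).negOnePow • a, d; 0, a]) ⟨0, zero_mem _, ?_⟩ ?_ ?_ ?_ ha
    · rw [map_zero, smul_zero]
      exact (Matrix.eta_fin_two 0)
    · rintro x y ⟨d, h, e⟩ ⟨d', h', e'⟩
      refine ⟨_, add_mem h h', ?_⟩
      rw [map_add, e, e', smul_add]
      simp
    · rintro r x ⟨d, h, e⟩
      refine ⟨_, Submodule.smul_mem _ r h, ?_⟩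
      rw [_root_.map_smul, e, smul_comm _ r x]
      simp
    · rintro l rfl
      clear ha
      induction l with
      | nil =>
        refine ⟨0, zero_mem _, ?_⟩
        simp [Matrix.one_fin_two]
      | cons q l ih =>
        obtain ⟨d, h, e⟩ := ih
        refine ⟨(p * genDeg q.1).negOnePow • gen R q * d + θ q.1 q.2 * (l.map (gen R)).prod, ?_, ?_⟩
        · rw [List.map_cons, List.sum_cons]
          refine add_mem ?_ ?_
          · rw [smul_mul_assoc, Units.smul_def, add_assoc]
            exact zsmul_mem (SetLike.mul_mem_graded (gen_mem R M q) h) _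
          · rw [add_right_comm]
            exact SetLike.mul_mem_graded (hθ _ _) (prod_mem R M l)
        · rw [List.map_cons, List.prod_cons, map_mul, hgen, e, Matrix.mul_fin_two, smul_mul_smul_comm,
            mul_zero, zero_mul, mul_zero, add_zero, zero_mul, zero_add, zero_add, List.map_cons,
            List.sum_cons, mul_add, Int.negOnePow_add]
  refine ⟨Matrix.entryLinearMap R (GSym R M) 0 1 ∘ₗ L.toLinearMap, fun n x => ?_,
    fun i a ha => ?_, fun i a ha b => ?_⟩
  · change L _ 0 1 = _
    rw [hgen]
    rfl
  · obtain ⟨d, h, e⟩ := hL i a ha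
    change L a 0 1 ∈ _
    rw [e]
    exact h
  · change L _ 0 1 = L a 0 1 * b + _ • (a * L b 0 1)
    have hb : L b 1 1 = b := by
      induction b using DirectSum.Decomposition.inductionOn (gr R M) with
      | zero => simp
      | add x y h1 h2 => rw [map_add, Matrix.add_apply, h1, h2]
      | homogeneous b =>
        obtain ⟨d, h, e⟩ := hL _ _ b.2
        rw [e]
        rfl
    obtain ⟨d, h, e⟩ := hL i a ha
    rw [map_mul, Matrix.mul_apply, Fin.sum_univ_two, hb, e, add_comm, ← smul_mul_assoc]
    rfl

end Derivation

/-- A derivation of degree `p` relative to a morphism of graded symmetric algebras is determined by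
its values on the generators. -/
lemma derivation_ext {p : ℤ} {B : Type u} [Ring B] (φ : GSym R M →+* B) {D D' : GSym R M →+ B}
    (hD : ∀ i, ∀ a ∈ gr R M i, ∀ b, D (a * b) = D a * φ b + (p * i).negOnePow • (φ a * D b))
    (hD' : ∀ i, ∀ a ∈ gr R M i, ∀ b, D' (a * b) = D' a * φ b + (p * i).negOnePow • (φ a * D' b))
    (h0 : ∀ r, D (algebraMap R _ r) = 0) (h0' : ∀ r, D' (algebraMap R _ r) = 0)
    (h : ∀ q, D (gen R q) = D' (gen R q)) (a : GSym R M) : D a = D' a := by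
  induction a using DirectSum.Decomposition.inductionOn (gr R M) with
  | zero => simp
  | add x y h1 h2 => rw [map_add, map_add, h1, h2]
  | @homogeneous i a =>
    refine gr_induction (P := fun a => D a = D' a) (by simp)
      (fun x y h1 h2 => by rw [map_add, map_add, h1, h2])
      (fun r x h1 => ?_) (fun l hl => ?_) a.2
    · have hr : algebraMap R (GSym R M) r ∈ gr R M 0 := SetLike.algebraMap_mem_graded _ _
      rw [Algebra.smul_def, hD _ _ hr, hD' _ _ hr, h0, h0', h1]
    · clear hl
      induction l with
      | nil => simpa using (h0 1).trans (h0' 1).symm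
      | cons q l ih =>
        rw [List.map_cons, List.prod_cons, hD _ _ (gen_mem R M q), hD' _ _ (gen_mem R M q), ih, h]

end GSym
end DGJet

/-! ### Sections over basic open sets -/

namespace DGJet
section Scheme
open CategoryTheory Opposite

variable {Y : Scheme.{u}} {U : Y.Opens}

section Sheaf
variable {κ : Type u} {V : κ → Y.Opens} (hV : ∀ i, V i ≤ U) (hU : U ≤ iSup V)

include hU in
lemma resO_ext {r s : Γ(Y, U)} (h : ∀ i, resO (hV i) r = resO (hV i) s) : r = s :=
  Y.sheaf.eq_of_locally_eq' V U (fun i => homOfLE (hV i)) hU r s h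

include hU in
lemma resO_glue (r : ∀ i, Γ(Y, V i)) (h : ∀ i j, resO (inf_le_left : V i ⊓ V j ≤ V i) (r i) =
    resO (inf_le_right : V i ⊓ V j ≤ V j) (r j)) : ∃ s, ∀ i, resO (hV i) s = r i :=
  (Y.sheaf.existsUnique_gluing' V U (fun i => homOfLE (hV i)) hU r h).exists

variable (M : Y.Modules)

include hU in
lemma resM_ext {x y : Γ(M, U)} (h : ∀ i, resM M (hV i) x = resM M (hV i) y) : x = y :=
  TopCat.Sheaf.eq_of_locally_eq' (C := Ab) (X := Y) ⟨M.presheaf, M.isSheaf⟩ V U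
    (fun i => homOfLE (hV i)) hU x y h

include hU in
lemma resM_glue (x : ∀ i, Γ(M, V i)) (h : ∀ i j, resM M (inf_le_left : V i ⊓ V j ≤ V i) (x i) =
    resM M (inf_le_right : V i ⊓ V j ≤ V j) (x j)) : ∃ y, ∀ i, resM M (hV i) y = x i :=
  (TopCat.Sheaf.existsUnique_gluing' (C := Ab) (X := Y) ⟨M.presheaf, M.isSheaf⟩ V U
    (fun i => homOfLE (hV i)) hU x fun i j => h i j).exists

end Sheaf

section BasicOpen
variable (hU : IsAffineOpen U) {f : Γ(Y, U)} {W : Y.Opens} (h : W ≤ U) (hW : W = Y.basicOpen f)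

include hU hW in
lemma exists_pow_mul_eq_zero {r : Γ(Y, U)} (hr : resO h r = 0) : ∃ n : ℕ, f ^ n * r = 0 := by
  let _ := (resO h).toAlgebra
  have : IsLocalization.Away f Γ(Y, W) := hU.isLocalization_of_eq_basicOpen f (homOfLE h) hW
  obtain ⟨⟨_, n, rfl⟩, h⟩ := (IsLocalization.map_eq_zero_iff (Submonoid.powers f) Γ(Y, W) r).1 hr
  exact ⟨n, h⟩

include hU hW in
lemma exists_resO_eq (r : Γ(Y, W)) : ∃ (n : ℕ) (s : Γ(Y, U)), resO h s = resO h f ^ n * r := by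
  let _ := (resO h).toAlgebra
  have : IsLocalization.Away f Γ(Y, W) := hU.isLocalization_of_eq_basicOpen f (homOfLE h) hW
  obtain ⟨⟨s, _, n, rfl⟩, h⟩ := IsLocalization.surj (Submonoid.powers f) r
  refine ⟨n, s, h.symm.trans ?_⟩
  rw [mul_comm, map_pow]
  rfl

include hU hW in
lemma isUnit_resO : IsUnit (resO h f) := by
  let _ := (resO h).toAlgebra
  have : IsLocalization.Away f Γ(Y, W) := hU.isLocalization_of_eq_basicOpen f (homOfLE h) hW
  exact IsLocalization.Away.algebraMap_isUnit f

end BasicOpen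

section LocallyFree
variable (M : Y.Modules)

/-- The sections `b₁, …, bₙ` of `M` over `U` form a basis over every open subset of `U`. -/
def IsLocalBasis {n : ℕ} (b : Fin n → Γ(M, U)) : Prop :=
  ∀ (V : Y.Opens) (h : V ≤ U),
    Function.Bijective fun c : Fin n → Γ(Y, V) => ∑ i, c i • resM M h (b i)

variable {M}

lemma IsLocalBasis.res {n : ℕ} {b : Fin n → Γ(M, U)} (hb : IsLocalBasis M b) {V : Y.Opens}
    (h : V ≤ U) : IsLocalBasis M fun i => resM M h (b i) := by
  intro W h'
  simp only [resM_trans]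
  exact hb W (h'.trans h)

section Affine
variable {n : ℕ} {b : Fin n → Γ(M, U)} (hb : IsLocalBasis M b) (hU : IsAffineOpen U)
  {f : Γ(Y, U)} {W : Y.Opens} (h : W ≤ U) (hW : W = Y.basicOpen f)

include hb hU hW in
lemma IsLocalBasis.exists_pow_smul_eq_zero {x : Γ(M, U)} (hx : resM M h x = 0) :
    ∃ N : ℕ, ∀ k ≥ N, f ^ k • x = 0 := by
  obtain ⟨c, rfl⟩ := (hb U le_rfl).2 x
  have h1 : (fun i => resO h (c i)) = 0 := by
    refine (hb W h).1 ?_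
    simpa [resM_trans, map_sum, LinearMap.map_smulₛₗ] using hx
  choose k hk using fun i => exists_pow_mul_eq_zero hU h hW (congrFun h1 i)
  refine ⟨∑ i, k i, fun N hN => ?_⟩
  simp only [Finset.smul_sum, smul_smul]
  refine Finset.sum_eq_zero fun i _ => ?_
  obtain ⟨m, hm⟩ := Nat.exists_eq_add_of_le
    ((Finset.single_le_sum (fun _ _ => Nat.zero_le _) (Finset.mem_univ i)).trans hN)
  rw [hm, pow_add, mul_right_comm, hk, zero_mul, zero_smul]

include hb hU hW in
lemma IsLocalBasis.exists_resM_eq (x : Γ(M, W)) :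
    ∃ N : ℕ, ∀ k ≥ N, ∃ y, resM M h y = resO h f ^ k • x := by
  obtain ⟨c, rfl⟩ := (hb W h).2 x
  choose k s hs using fun i => exists_resO_eq hU h hW (c i)
  refine ⟨∑ i, k i, fun N hN => ?_⟩
  choose m hm using fun i => Nat.exists_eq_add_of_le
    ((Finset.single_le_sum (fun _ _ => Nat.zero_le _) (Finset.mem_univ i)).trans hN)
  refine ⟨∑ i, (f ^ m i * s i) • b i, ?_⟩
  simp only [map_sum, LinearMap.map_smulₛₗ, Finset.smul_sum, smul_smul, map_mul, hs, map_pow]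
  refine Finset.sum_congr rfl fun i _ => ?_
  rw [← mul_assoc, ← pow_add, add_comm, ← hm]

end Affine

/-- A locally free sheaf of modules on an affine open set `U` is free on each of finitely many basic
open sets that cover `U`. -/
lemma IsLocallyFree.exists_cover (hM : IsLocallyFree M) (hU : IsAffineOpen U) :
    ∃ t : Finset Γ(Y, U), Ideal.span (t : Set Γ(Y, U)) = ⊤ ∧ U ≤ ⨆ g : t, Y.basicOpen g.1 ∧
      ∀ g ∈ t, ∃ (n : ℕ) (b : Fin n → Γ(M, Y.basicOpen g)), IsLocalBasis M b := by
  let s : Set Γ(Y, U) := {g | ∃ (n : ℕ) (b : Fin n → Γ(M, Y.basicOpen g)), IsLocalBasis M b}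
  have hs : Ideal.span s = ⊤ := by
    rw [← hU.self_le_iSup_basicOpen_iff]
    intro y hy
    obtain ⟨V, hyV, n, b, hb⟩ := hM y
    obtain ⟨g, hg, hy'⟩ := hU.exists_basicOpen_le ⟨y, hyV⟩ hy
    exact TopologicalSpace.Opens.mem_iSup.2 ⟨⟨g, n, _, IsLocalBasis.res (M := M) hb hg⟩, hy'⟩
  obtain ⟨t, hts, ht⟩ := (Ideal.span_eq_top_iff_finite s).1 hs
  exact ⟨t, ht, hU.self_le_iSup_basicOpen_iff.2 ht, fun g hg => hts hg⟩

end LocallyFree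
end Scheme
end DGJet

/-! ### Dual bases over affine open sets -/

namespace DGJet

/-- A module that is free of finite rank after localization at each of finitely many elements that
generate the unit ideal has a finite dual basis. -/
lemma exists_dualBasis {R P : Type u} [CommRing R] [AddCommGroup P] [Module R P] (s : Set R)
    (hs : Ideal.span s = ⊤) (R' P' : s → Type u) [∀ g, CommRing (R' g)] [∀ g, Algebra R (R' g)]
    [∀ g : s, IsLocalization.Away g.1 (R' g)] [∀ g, AddCommGroup (P' g)] [∀ g, Module R (P' g)]
    [∀ g, Module (R' g) (P' g)] [∀ g, IsScalarTower R (R' g) (P' g)] (φ : ∀ g, P →ₗ[R] P' g)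
    [∀ g : s, IsLocalizedModule (Submonoid.powers g.1) (φ g)] [∀ g, Module.Free (R' g) (P' g)]
    [∀ g, Module.Finite (R' g) (P' g)] :
    ∃ (n : ℕ) (e : Fin n → P) (c : Fin n → P →ₗ[R] R), ∀ x, ∑ j, c j x • e j = x := by
  have : Module.FinitePresentation R P :=
    Module.FinitePresentation.of_localizationSpan' s hs (Rₚ := R') φ fun g =>
      Module.finitePresentation_of_projective (R' g) (P' g)
  have : Module.Flat R P := by
    refine Module.flat_of_isLocalized_span R P s hs P' φ fun g => ?_
    have : Module.Flat R (R' g) := IsLocalization.flat (R' g) (Submonoid.powers g.1)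
    exact Module.Flat.trans R (R' g) (P' g)
  have : Module.Projective R P := Module.Flat.projective_of_finitePresentation
  obtain ⟨n, p, hp⟩ := Module.Finite.exists_fin' R P
  obtain ⟨i, hi⟩ := Module.projective_lifting_property p LinearMap.id hp
  refine ⟨n, fun j => p (Pi.single j 1), fun j => LinearMap.proj j ∘ₗ i, fun x => ?_⟩
  have h : p (i x) = x := LinearMap.congr_fun hi x
  conv_rhs => rw [← h, pi_eq_sum_univ' (i x), map_sum]
  refine Finset.sum_congr rfl fun j _ => ?_
  rw [map_smul]
  congr 2

section Scheme
open CategoryTheory Opposite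
variable {Y : Scheme.{u}} {U : Y.Opens} {M : Y.Modules}

lemma basicOpen_resO {V : Y.Opens} (h : V ≤ U) (f : Γ(Y, U)) :
    Y.basicOpen (resO h f) = V ⊓ Y.basicOpen f := Y.basicOpen_res f (homOfLE h).op

namespace IsLocallyFree
variable (hM : IsLocallyFree M) (hU : IsAffineOpen U) {f : Γ(Y, U)} {W : Y.Opens} (h : W ≤ U)
  (hW : W = Y.basicOpen f)

include hM hU hW in
/-- Together with `exists_resM_eq`: the sections of `M` over a basic open set of an affine open
set `U` are the localization of the sections over `U`. Both are proved on the members of a finite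
cover of `U` on which `M` is free. -/
lemma exists_pow_smul_eq_zero {x : Γ(M, U)} (hx : resM M h x = 0) : ∃ N : ℕ, f ^ N • x = 0 := by
  obtain ⟨t, -, ht, hb⟩ := hM.exists_cover hU
  have h1 : ∀ g : t, ∃ N : ℕ, ∀ k ≥ N, resO (Y.basicOpen_le g.1) f ^ k •
      resM M (Y.basicOpen_le g.1) x = 0 := fun g => by
    obtain ⟨n, b, hb⟩ := hb g g.2
    refine hb.exists_pow_smul_eq_zero (hU.basicOpen g.1) (W := Y.basicOpen g.1 ⊓ W) inf_le_left
      (by rw [basicOpen_resO, hW]) ?_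
    rw [resM_trans, ← resM_trans M h inf_le_right, hx, map_zero]
  choose N hN using h1
  refine ⟨∑ g, N g, resM_ext (fun g : t => Y.basicOpen_le g.1) ht M fun g => ?_⟩
  rw [LinearMap.map_smulₛₗ, map_pow, map_zero,
    hN g _ (Finset.single_le_sum (fun _ _ => Nat.zero_le _) (Finset.mem_univ g))]

include hM hU hW in
lemma exists_resM_eq (x : Γ(M, W)) : ∃ (N : ℕ) (y : Γ(M, U)), resM M h y = resO h f ^ N • x := by
  obtain ⟨t, -, ht, hb⟩ := hM.exists_cover hU
  have hle : ∀ g : t, Y.basicOpen g.1 ≤ U := fun g => Y.basicOpen_le g.1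
  have h1 : ∀ g : t, ∃ N : ℕ, ∀ k ≥ N, ∃ y,
      resM M (inf_le_left : Y.basicOpen g.1 ⊓ W ≤ _) y =
        resO (inf_le_left : Y.basicOpen g.1 ⊓ W ≤ _) (resO (hle g) f) ^ k •
          resM M (inf_le_right : Y.basicOpen g.1 ⊓ W ≤ _) x := fun g => by
    obtain ⟨n, b, hb⟩ := hb g g.2
    exact hb.exists_resM_eq (hU.basicOpen g.1) (W := Y.basicOpen g.1 ⊓ W) (f := resO (hle g) f)
      inf_le_left (by rw [basicOpen_resO, hW]) _
  choose N hN using h1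
  choose y hy using fun g => hN g _ (Finset.single_le_sum (fun _ _ => Nat.zero_le _)
    (Finset.mem_univ g))
  have hle' : ∀ g g' : t, Y.basicOpen g.1 ⊓ Y.basicOpen g'.1 ≤ U := fun g g' =>
    inf_le_left.trans (hle g)
  have h2 : ∀ g g' : t, ∃ N : ℕ, ∀ k ≥ N, resO (hle' g g') f ^ k •
      (resM M (inf_le_left : Y.basicOpen g.1 ⊓ Y.basicOpen g'.1 ≤ _) (y g) -
        resM M (inf_le_right : Y.basicOpen g.1 ⊓ Y.basicOpen g'.1 ≤ _) (y g')) = 0 := fun g g' => by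
    obtain ⟨n, b, hb⟩ := hb g g.2
    have hV : IsAffineOpen (Y.basicOpen g.1 ⊓ Y.basicOpen g'.1) := by
      rw [← basicOpen_resO (hle g)]
      exact (hU.basicOpen g.1).basicOpen _
    refine (IsLocalBasis.res (M := M) hb inf_le_left).exists_pow_smul_eq_zero hV
      (W := Y.basicOpen g.1 ⊓ Y.basicOpen g'.1 ⊓ W)
      (f := resO (hle' g g') f) inf_le_left (by rw [basicOpen_resO, hW]) ?_
    have e1 := congrArg (resM M (le_inf (inf_le_left.trans inf_le_left) inf_le_right :
      Y.basicOpen g.1 ⊓ Y.basicOpen g'.1 ⊓ W ≤ Y.basicOpen g.1 ⊓ W)) (hy g)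
    have e2 := congrArg (resM M (le_inf (inf_le_left.trans inf_le_right) inf_le_right :
      Y.basicOpen g.1 ⊓ Y.basicOpen g'.1 ⊓ W ≤ Y.basicOpen g'.1 ⊓ W)) (hy g')
    simp only [LinearMap.map_smulₛₗ, map_pow, resM_trans, resO_trans] at e1 e2
    rw [map_sub, resM_trans, resM_trans, e1, e2, sub_self]
  choose K hK using h2
  have h3 : ∀ g g', K g g' ≤ ∑ g, ∑ g', K g g' := fun g g' =>
    (Finset.single_le_sum (f := fun g' => K g g') (fun _ _ => Nat.zero_le _)
      (Finset.mem_univ g')).trans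
      (Finset.single_le_sum (f := fun g => ∑ g', K g g') (fun _ _ => Nat.zero_le _)
        (Finset.mem_univ g))
  generalize ∑ g, ∑ g', K g g' = k at h3
  generalize ∑ g, N g = m at hy
  obtain ⟨z, hz⟩ := resM_glue hle ht M (fun g => resO (hle g) f ^ k • y g) fun g g' => by
    have e := hK g g' k (h3 g g')
    rw [smul_sub, sub_eq_zero] at e
    simpa only [LinearMap.map_smulₛₗ, map_pow, resO_trans] using e
  refine ⟨k + m, z, resM_ext (V := fun g : t => Y.basicOpen g.1 ⊓ W) (fun g => inf_le_right) ?_ M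
    fun g => ?_⟩
  · rw [← iSup_inf_eq]
    exact le_inf (h.trans ht) le_rfl
  · have e := congrArg (resM M (inf_le_left : Y.basicOpen g.1 ⊓ W ≤ _)) (hz g)
    rw [LinearMap.map_smulₛₗ, hy, resM_trans, smul_smul] at e
    rw [resM_trans, LinearMap.map_smulₛₗ]
    simp only [map_pow, resO_trans] at e ⊢
    rw [e, pow_add]

include hM hU in
/-- The module of sections of a locally free sheaf over an affine open set has a finite dual
basis. -/
lemma exists_dualBasis : ∃ (n : ℕ) (e : Fin n → Γ(M, U)) (c : Fin n → Γ(M, U) →ₗ[Γ(Y, U)] Γ(Y, U)),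
    ∀ x, ∑ j, c j x • e j = x := by
  obtain ⟨t, ht, -, hb⟩ := hM.exists_cover hU
  have hle : ∀ g : (t : Set Γ(Y, U)), Y.basicOpen g.1 ≤ U := fun g => Y.basicOpen_le g.1
  let (g : (t : Set Γ(Y, U))) : Algebra Γ(Y, U) Γ(Y, Y.basicOpen g.1) := (resO (hle g)).toAlgebra
  let (g : (t : Set Γ(Y, U))) : Module Γ(Y, U) Γ(M, Y.basicOpen g.1) :=
    Module.compHom _ (resO (hle g))
  have (g : (t : Set Γ(Y, U))) : IsScalarTower Γ(Y, U) Γ(Y, Y.basicOpen g.1)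
      Γ(M, Y.basicOpen g.1) := ⟨fun r s x => mul_smul (resO (hle g) r) s x⟩
  have (g : (t : Set Γ(Y, U))) : IsLocalization.Away g.1 Γ(Y, Y.basicOpen g.1) :=
    hU.isLocalization_of_eq_basicOpen g.1 (homOfLE (hle g)) rfl
  let φ (g : (t : Set Γ(Y, U))) : Γ(M, U) →ₗ[Γ(Y, U)] Γ(M, Y.basicOpen g.1) :=
    { toFun := resM M (hle g)
      map_add' := map_add _
      map_smul' := LinearMap.map_smulₛₗ _ }
  have (g : (t : Set Γ(Y, U))) : IsLocalizedModule (Submonoid.powers g.1) (φ g) := by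
    refine ⟨?_, fun x => ?_, fun {x y} hxy => ?_⟩
    · rintro ⟨_, n, rfl⟩
      have h1 : IsUnit (resO (hle g) (g.1 ^ n)) := by
        rw [map_pow]
        exact (isUnit_resO hU (hle g) rfl).pow n
      rw [Module.End.isUnit_iff]
      obtain ⟨r, hr⟩ := h1
      refine ⟨fun x y hxy => ?_, fun x => ⟨(↑r⁻¹ : Γ(Y, Y.basicOpen g.1)) • x, ?_⟩⟩
      · have h2 : (↑r⁻¹ : Γ(Y, Y.basicOpen g.1)) • resO (hle g) (g.1 ^ n) • x =
          (↑r⁻¹ : Γ(Y, Y.basicOpen g.1)) • resO (hle g) (g.1 ^ n) • y := congrArg _ hxy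
        rwa [← hr, smul_smul, smul_smul, Units.inv_mul, one_smul, one_smul] at h2
      · change resO (hle g) (g.1 ^ n) • (↑r⁻¹ : Γ(Y, Y.basicOpen g.1)) • x = x
        rw [← hr, smul_smul, Units.mul_inv, one_smul]
    · obtain ⟨n, y, hy⟩ := hM.exists_resM_eq hU (hle g) rfl x
      rw [← map_pow] at hy
      exact ⟨⟨y, ⟨_, n, rfl⟩⟩, hy.symm⟩
    · have h1 : resM M (hle g) (x - y) = 0 := (map_sub _ x y).trans (sub_eq_zero.2 hxy)
      obtain ⟨n, hn⟩ := hM.exists_pow_smul_eq_zero hU (hle g) rfl h1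
      rw [smul_sub, sub_eq_zero] at hn
      exact ⟨⟨_, n, rfl⟩, hn⟩
  have hb' (g : (t : Set Γ(Y, U))) : ∃ n, Nonempty
      (Module.Basis (Fin n) Γ(Y, Y.basicOpen g.1) Γ(M, Y.basicOpen g.1)) := by
    obtain ⟨n, b, hb⟩ := hb g.1 g.2
    have h1 := hb _ le_rfl
    simp only [resM_refl] at h1
    exact ⟨n, ⟨.ofEquivFun (LinearEquiv.ofBijective (Fintype.linearCombination _ b) h1).symm⟩⟩
  have (g : (t : Set Γ(Y, U))) : Module.Free Γ(Y, Y.basicOpen g.1) Γ(M, Y.basicOpen g.1) := by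
    obtain ⟨n, ⟨b⟩⟩ := hb' g
    exact .of_basis b
  have (g : (t : Set Γ(Y, U))) : Module.Finite Γ(Y, Y.basicOpen g.1) Γ(M, Y.basicOpen g.1) := by
    obtain ⟨n, ⟨b⟩⟩ := hb' g
    exact .of_basis b
  exact DGJet.exists_dualBasis (t : Set Γ(Y, U)) ht (fun g => Γ(Y, Y.basicOpen g.1))
    (fun g => Γ(M, Y.basicOpen g.1)) φ

end IsLocallyFree
end Scheme
end DGJet

/-! ### Functionals on the sections of locally free sheaves -/

namespace DGJet
section Scheme
open CategoryTheory Opposite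
variable {Y : Scheme.{u}} {U : Y.Opens} {M : Y.Modules}

lemma exists_basicOpen_cover (hU : IsAffineOpen U) {V : Y.Opens} (hV : V ≤ U) :
    V ≤ ⨆ f : {f : Γ(Y, U) // Y.basicOpen f ≤ V}, Y.basicOpen f.1 := fun y hy => by
  obtain ⟨f, hf, hy'⟩ := hU.exists_basicOpen_le ⟨y, hy⟩ (hV hy)
  exact TopologicalSpace.Opens.mem_iSup.2 ⟨⟨f, hf⟩, hy'⟩

/-- The value `r` on the section `x` over `V ⊆ U` of the functional induced by a functional `c` on
the sections over the affine open set `U`: this is prescribed on the basic open sets of `U`, over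
which the sections of a locally free sheaf are obtained by localization. -/
def IsExtValue (c : Γ(M, U) →ₗ[Γ(Y, U)] Γ(Y, U)) (V : Y.Opens) (x : Γ(M, V)) (r : Γ(Y, V)) :
    Prop :=
  ∀ (f : Γ(Y, U)) (h : Y.basicOpen f ≤ V), ∃ (n : ℕ) (y : Γ(M, U)),
    resM M (Y.basicOpen_le f) y = resO (Y.basicOpen_le f) f ^ n • resM M h x ∧
      resO (Y.basicOpen_le f) (c y) = resO (Y.basicOpen_le f) f ^ n * resO h r

namespace IsExtValue
variable {c : Γ(M, U) →ₗ[Γ(Y, U)] Γ(Y, U)} {V : Y.Opens} {x x' : Γ(M, V)} {r r' : Γ(Y, V)}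

lemma add (h : IsExtValue c V x r) (h' : IsExtValue c V x' r') :
    IsExtValue c V (x + x') (r + r') := fun f hf => by
  obtain ⟨n, y, h1, h2⟩ := h f hf
  obtain ⟨n', y', h1', h2'⟩ := h' f hf
  refine ⟨n + n', f ^ n' • y + f ^ n • y', ?_, ?_⟩
  · simp only [map_add, LinearMap.map_smulₛₗ, h1, h1', map_pow, smul_smul, smul_add, ← pow_add]
    rw [add_comm n']
  · simp only [map_add, map_smul, smul_eq_mul, map_mul, h2, h2', map_pow]
    ring

lemma smul (hU : IsAffineOpen U) (h : IsExtValue c V x r) (s : Γ(Y, V)) :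
    IsExtValue c V (s • x) (s * r) := fun f hf => by
  obtain ⟨n, y, h1, h2⟩ := h f hf
  obtain ⟨m, a, ha⟩ := exists_resO_eq hU (Y.basicOpen_le f) rfl (resO hf s)
  refine ⟨m + n, a • y, ?_, ?_⟩
  · simp only [LinearMap.map_smulₛₗ, h1, ha, smul_smul]
    congr 1
    ring
  · simp only [map_smul, smul_eq_mul, map_mul, h2, ha]
    ring

lemma res {W : Y.Opens} (h : IsExtValue c V x r) (hW : W ≤ V) :
    IsExtValue c W (resM M hW x) (resO hW r) := fun f hf => by
  obtain ⟨n, y, h1, h2⟩ := h f (hf.trans hW)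
  exact ⟨n, y, by rw [h1, resM_trans], by rw [h2, resO_trans]⟩

end IsExtValue

namespace IsLocallyFree
variable (hM : IsLocallyFree M) (hU : IsAffineOpen U) (c : Γ(M, U) →ₗ[Γ(Y, U)] Γ(Y, U))
  {V : Y.Opens} {x : Γ(M, V)}

include hM hU in
/-- The fractions `c y / f ^ n` and `c z / g ^ m` agree if `y / f ^ n` and `z / g ^ m` represent the
same section `x`. -/
lemma resO_functional_eq {f g : Γ(Y, U)} {y z : Γ(M, U)} {n m : ℕ} (hf : Y.basicOpen f ≤ V)
    (hg : Y.basicOpen g ≤ V)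
    (hy : resM M (Y.basicOpen_le f) y = resO (Y.basicOpen_le f) f ^ n • resM M hf x)
    (hz : resM M (Y.basicOpen_le g) z = resO (Y.basicOpen_le g) g ^ m • resM M hg x)
    (h : Y.basicOpen f ⊓ Y.basicOpen g ≤ U) :
    resO h (g ^ m * c y) = resO h (f ^ n * c z) := by
  have hfg : Y.basicOpen f ⊓ Y.basicOpen g = Y.basicOpen (f * g) := (Y.basicOpen_mul f g).symm
  have h1 : resM M h (g ^ m • y - f ^ n • z) = 0 := by
    have e1 := congrArg (resM M (inf_le_left : Y.basicOpen f ⊓ Y.basicOpen g ≤ _)) hy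
    have e2 := congrArg (resM M (inf_le_right : Y.basicOpen f ⊓ Y.basicOpen g ≤ _)) hz
    simp only [LinearMap.map_smulₛₗ, map_pow, resM_trans, resO_trans] at e1 e2
    rw [map_sub, LinearMap.map_smulₛₗ, LinearMap.map_smulₛₗ, e1, e2, map_pow, map_pow, smul_comm,
      sub_self]
  obtain ⟨N, hN⟩ := hM.exists_pow_smul_eq_zero hU h hfg h1
  have h2 := congrArg (resO h) (congrArg c hN)
  simp only [map_zero, map_smul c, map_sub c, smul_eq_mul] at h2
  rw [map_mul, map_pow, ((isUnit_resO hU h hfg).pow N).mul_right_eq_zero, map_sub,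
    sub_eq_zero] at h2
  exact h2

include hM hU in
/-- The existential quantifier in `IsExtValue` may be replaced by a universal one. -/
lemma functional_eq_of_isExtValue {r : Γ(Y, V)} (h : IsExtValue c V x r) {f : Γ(Y, U)}
    (hf : Y.basicOpen f ≤ V) {n : ℕ} {y : Γ(M, U)}
    (hy : resM M (Y.basicOpen_le f) y = resO (Y.basicOpen_le f) f ^ n • resM M hf x) :
    resO (Y.basicOpen_le f) (c y) = resO (Y.basicOpen_le f) f ^ n * resO hf r := by
  obtain ⟨m, z, hz, h2⟩ := h f hf
  have h3 := hM.resO_functional_eq hU c hf hf hy hz (inf_le_left.trans (Y.basicOpen_le f))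
  have h4 := congrArg (resO (le_inf le_rfl le_rfl : Y.basicOpen f ≤ _)) h3
  rw [resO_trans, resO_trans, map_mul, map_mul, h2, map_pow, map_pow, mul_left_comm] at h4
  exact ((isUnit_resO hU (Y.basicOpen_le f) rfl).pow m).mul_left_cancel h4

include hM hU in
lemma isExtValue_unique (hV : V ≤ U) {r r' : Γ(Y, V)} (h : IsExtValue c V x r)
    (h' : IsExtValue c V x r') : r = r' := by
  refine resO_ext (fun f : {f : Γ(Y, U) // Y.basicOpen f ≤ V} => f.2)
    (exists_basicOpen_cover hU hV) fun f => ?_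
  obtain ⟨n, y, hy, h1⟩ := h f.1 f.2
  rw [hM.functional_eq_of_isExtValue hU c h' f.2 hy] at h1
  exact (((isUnit_resO hU (Y.basicOpen_le f.1) rfl).pow n).mul_left_cancel h1).symm

include hM hU in
lemma exists_isExtValue (hV : V ≤ U) (x : Γ(M, V)) : ∃ r, IsExtValue c V x r := by
  let κ := {f : Γ(Y, U) // Y.basicOpen f ≤ V}
  choose n y hy using fun f : κ => hM.exists_resM_eq hU (Y.basicOpen_le f.1) rfl (resM M f.2 x)
  have h1 : ∀ f : κ, ∃ r, resO (Y.basicOpen_le f.1) (c (y f)) =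
      resO (Y.basicOpen_le f.1) f.1 ^ n f * r := fun f => by
    obtain ⟨u, hu⟩ := (isUnit_resO hU (Y.basicOpen_le f.1) rfl).pow (n f)
    exact ⟨↑u⁻¹ * resO (Y.basicOpen_le f.1) (c (y f)), by rw [← hu, Units.mul_inv_cancel_left]⟩
  choose r hr using h1
  obtain ⟨s, hs⟩ := resO_glue (fun f : κ => f.2) (exists_basicOpen_cover hU hV) r fun f g => by
    have hle : Y.basicOpen f.1 ⊓ Y.basicOpen g.1 ≤ U := inf_le_left.trans (Y.basicOpen_le f.1)
    have h2 := hM.resO_functional_eq hU c f.2 g.2 (hy f) (hy g) hle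
    have e1 := congrArg (resO (inf_le_left : Y.basicOpen f.1 ⊓ Y.basicOpen g.1 ≤ _)) (hr f)
    have e2 := congrArg (resO (inf_le_right : Y.basicOpen f.1 ⊓ Y.basicOpen g.1 ≤ _)) (hr g)
    simp only [map_mul, map_pow, resO_trans] at h2 e1 e2
    rw [e1, e2, mul_left_comm] at h2
    have hfg : Y.basicOpen f.1 ⊓ Y.basicOpen g.1 = Y.basicOpen (f.1 * g.1) :=
      (Y.basicOpen_mul f.1 g.1).symm
    have h3 := isUnit_resO hU hle hfg
    rw [map_mul, IsUnit.mul_iff] at h3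
    exact (h3.2.pow _).mul_left_cancel ((h3.1.pow _).mul_left_cancel h2)
  exact ⟨s, fun f hf => ⟨_, _, hy ⟨f, hf⟩, by rw [hs ⟨f, hf⟩, hr ⟨f, hf⟩]⟩⟩

include hM hU in
/-- The sections of a locally free sheaf over the open subsets of an affine open set `U` have a dual
basis that is compatible with restriction. -/
lemma exists_frame : ∃ (n : ℕ) (e : Fin n → Γ(M, U))
    (c : ∀ V : {V : Y.Opens // V ≤ U}, Fin n → Γ(M, V.1) →ₗ[Γ(Y, V.1)] Γ(Y, V.1)),
    (∀ (V W : {V : Y.Opens // V ≤ U}) (h : W.1 ≤ V.1) j x,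
      c W j (resM M h x) = resO h (c V j x)) ∧
    ∀ V x, ∑ j, c V j x • resM M V.2 (e j) = x := by
  obtain ⟨n, e, c, hc⟩ := hM.exists_dualBasis hU
  choose c' hc' using fun (V : {V : Y.Opens // V ≤ U}) (j : Fin n) (x : Γ(M, V.1)) =>
    hM.exists_isExtValue hU (c j) V.2 x
  refine ⟨n, e, fun V j =>
    { toFun := c' V j
      map_add' x y := hM.isExtValue_unique hU (c j) V.2 (hc' V j _) ((hc' V j x).add (hc' V j y))
      map_smul' r x := hM.isExtValue_unique hU (c j) V.2 (hc' V j _) ((hc' V j x).smul hU r) },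
    fun V W h j x => hM.isExtValue_unique hU (c j) W.2 (hc' W j _) ((hc' V j x).res h),
    fun V x => ?_⟩
  refine resM_ext (fun f : {f : Γ(Y, U) // Y.basicOpen f ≤ V.1} => f.2)
    (exists_basicOpen_cover hU V.2) M fun f => ?_
  obtain ⟨m, y, hy⟩ := hM.exists_resM_eq hU (Y.basicOpen_le f.1) rfl (resM M f.2 x)
  have h1 : resO (Y.basicOpen_le f.1) f.1 ^ m • resM M f.2 (∑ j, c' V j x • resM M V.2 (e j)) =
      resO (Y.basicOpen_le f.1) f.1 ^ m • resM M f.2 x := by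
    rw [← hy]
    conv_rhs => rw [← hc y]
    simp only [map_sum, LinearMap.map_smulₛₗ, Finset.smul_sum, smul_smul, resM_trans]
    refine Finset.sum_congr rfl fun j _ => ?_
    rw [hM.functional_eq_of_isExtValue hU (c j) (hc' V j x) f.2 hy]
  obtain ⟨u, hu⟩ := (isUnit_resO hU (Y.basicOpen_le f.1) rfl).pow m
  rw [← hu] at h1
  have h2 := congrArg ((↑u⁻¹ : Γ(Y, Y.basicOpen f.1)) • ·) h1
  simp only [smul_smul, Units.inv_mul, one_smul] at h2
  exact h2

end IsLocallyFree
end Scheme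
end DGJet

/-! ### Functions on affine open sets of a reduced scheme over a field -/

namespace DGJet

/-- A nonzero element of a reduced noetherian ring remains nonzero in a localization at one element
that is a domain, namely on the complement of all but one of the irreducible components. -/
lemma exists_away_isDomain {A : Type*} [CommRing A] [IsNoetherianRing A] [IsReduced A] {r : A}
    (hr : r ≠ 0) : ∃ g : A, (∀ n : ℕ, g ^ n * r ≠ 0) ∧
      ∀ x y : A, (∃ n : ℕ, g ^ n * (x * y) = 0) →
        (∃ n : ℕ, g ^ n * x = 0) ∨ ∃ n : ℕ, g ^ n * y = 0 := by
  have h0 : ∀ x : A, (∀ q ∈ minimalPrimes A, x ∈ q) → x = 0 := fun x hx => by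
    have h : x ∈ sInf (⊥ : Ideal A).minimalPrimes := Ideal.mem_sInf.2 fun {q} hq => hx q hq
    rw [Ideal.sInf_minimalPrimes] at h
    obtain ⟨n, hn⟩ := h
    exact eq_zero_of_pow_eq_zero hn
  obtain ⟨p, hp, hrp⟩ : ∃ p ∈ minimalPrimes A, r ∉ p := by
    by_contra! h
    exact hr (h0 r h)
  have hp' : p.IsPrime := hp.1.1
  have h1 : ∀ q ∈ minimalPrimes A, ∃ g ∉ p, q ≠ p → g ∈ q := fun q hq => by
    by_cases h : q = p
    · exact ⟨1, fun h => hp'.ne_top ((Ideal.eq_top_iff_one p).2 h), fun h' => absurd h h'⟩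
    · have h2 : ¬ q ≤ p := fun h2 => h (le_antisymm h2 (hp.2 hq.1 h2))
      obtain ⟨g, hg, hg'⟩ := SetLike.not_le_iff_exists.1 h2
      exact ⟨g, hg', fun _ => hg⟩
  choose! g hg hg' using h1
  have hfin := minimalPrimes.finite_of_isNoetherianRing A
  have h2 : ∏ q ∈ hfin.toFinset, g q ∉ p := fun h => by
    obtain ⟨q, hq, h⟩ := hp'.prod_mem_iff.1 h
    exact hg q (hfin.mem_toFinset.1 hq) h
  have h3 : ∀ q ∈ minimalPrimes A, q ≠ p → ∏ q ∈ hfin.toFinset, g q ∈ q := fun q hq h =>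
    Ideal.mem_of_dvd _ (Finset.dvd_prod_of_mem g (hfin.mem_toFinset.2 hq)) (hg' q hq h)
  generalize ∏ q ∈ hfin.toFinset, g q = G at h2 h3
  have h4 : ∀ (n : ℕ) (x : A), G ^ n * x = 0 → x ∈ p := fun n x h =>
    (hp'.mem_or_mem (h ▸ zero_mem p : G ^ n * x ∈ p)).resolve_left
      fun h' => h2 (hp'.mem_of_pow_mem n h')
  have h5 : ∀ x ∈ p, G ^ 1 * x = 0 := fun x hx => h0 _ fun q hq => by
    by_cases h : q = p
    · rw [h]; exact Ideal.mul_mem_left _ _ hx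
    · rw [pow_one]; exact Ideal.mul_mem_right _ _ (h3 q hq h)
  refine ⟨G, fun n h => hrp (h4 n r h), fun x y ⟨n, h⟩ => ?_⟩
  exact (hp'.mem_or_mem (h4 n _ h)).imp (fun h => ⟨1, h5 x h⟩) fun h => ⟨1, h5 y h⟩

/-- A noetherian Jacobson domain that is not a field has at least two maximal ideals, hence two
coprime elements to whose powers no nonzero element is infinitely divisible, by Krull's
intersection theorem. -/
lemma isField_or_exists_isCoprime (B : Type*) [CommRing B] [IsDomain B] [IsNoetherianRing B]
    [IsJacobsonRing B] : IsField B ∨ ∃ a b : B, IsCoprime a b ∧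
      (∀ r, (∀ n : ℕ, a ^ n ∣ r) → r = 0) ∧ ∀ r, (∀ n : ℕ, b ^ n ∣ r) → r = 0 := by
  have hK : ∀ m : Ideal B, m.IsMaximal → ∀ a ∈ m, ∀ r, (∀ n : ℕ, a ^ n ∣ r) → r = 0 := by
    intro m hm a ha r hr
    have h : r ∈ ⨅ i : ℕ, m ^ i := (Ideal.mem_iInf).2 fun n =>
      Ideal.mem_of_dvd _ (hr n) (Ideal.pow_mem_pow ha n)
    rwa [Ideal.iInf_pow_eq_bot_of_isDomain m hm.ne_top] at h
  by_cases h : IsLocalRing B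
  · left
    have h1 : (⊥ : Ideal B).jacobson = ⊥ :=
      IsJacobsonRing.out inferInstance Ideal.isPrime_bot.isRadical
    rw [IsLocalRing.jacobson_eq_maximalIdeal ⊥ bot_ne_top] at h1
    exact IsLocalRing.isField_iff_maximalIdeal_eq.2 h1
  · right
    obtain ⟨m, hm⟩ := Ideal.exists_maximal B
    obtain ⟨m', hm', hne⟩ : ∃ m' : Ideal B, m'.IsMaximal ∧ m' ≠ m := by
      by_contra! h'
      exact h (IsLocalRing.of_unique_max_ideal ⟨m, hm, h'⟩)
    have h1 : m ⊔ m' = ⊤ := hm.coprime_of_ne hm' hne.symm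
    obtain ⟨a, ha, b, hb, hab⟩ := Submodule.mem_sup.1 ((Ideal.eq_top_iff_one _).1 h1)
    exact ⟨a, b, ⟨1, 1, by rw [one_mul, one_mul, hab]⟩, hK m hm a ha, hK m' hm' b hb⟩

section Scheme
open CategoryTheory Opposite
variable {k : Type u} [Field k] {Y : Scheme.{u}} (f : Y ⟶ Spec (.of k)) {U : Y.Opens}

/-- The functions on an affine open set of a scheme locally of finite type over `k` form a finitely
generated `k`-algebra. -/
lemma exists_finiteType [LocallyOfFiniteType f] (hU : IsAffineOpen U) :
    ∃ φ : k →+* Γ(Y, U), φ.FiniteType := by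
  have h := f.finiteType_appLE (isAffineOpen_top (Spec (.of k))) hU le_top
  refine ⟨(f.appLE ⊤ U le_top).hom.comp (Scheme.ΓSpecIso (.of k)).inv.hom, h.comp ?_⟩
  exact RingHom.FiniteType.of_surjective _
    (ConcreteCategory.bijective_of_isIso (Scheme.ΓSpecIso (.of k)).inv).2

/-- A nonzero function on an affine open set of a reduced scheme locally of finite type over a field
is nonzero on an affine open set that either consists of one point or has two coprime functions to
whose powers no nonzero function is infinitely divisible. -/
lemma exists_basicOpen_resO_ne_zero [LocallyOfFiniteType f] [AlgebraicGeometry.IsReduced Y]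
    (hU : IsAffineOpen U) {r : Γ(Y, U)} (hr : r ≠ 0) :
    ∃ g : Γ(Y, U), resO (Y.basicOpen_le g) r ≠ 0 ∧
      ((∃ a b : Γ(Y, Y.basicOpen g), IsCoprime a b ∧ (∀ r, (∀ n : ℕ, a ^ n ∣ r) → r = 0) ∧
        ∀ r, (∀ n : ℕ, b ^ n ∣ r) → r = 0) ∨ ∃ y, (Y.basicOpen g : Set Y) = {y}) := by
  obtain ⟨φ, hφ⟩ := exists_finiteType f hU
  let _ := φ.toAlgebra
  have : Algebra.FiniteType k Γ(Y, U) := hφ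
  have : IsNoetherianRing Γ(Y, U) := Algebra.FiniteType.isNoetherianRing k _
  have : IsJacobsonRing Γ(Y, U) := isJacobsonRing_of_finiteType (A := k)
  obtain ⟨g, h1, h2⟩ := exists_away_isDomain hr
  let B := Γ(Y, Y.basicOpen g)
  let _ : Algebra Γ(Y, U) B := (resO (Y.basicOpen_le g)).toAlgebra
  have : IsLocalization.Away g B := hU.isLocalization_basicOpen g
  have hz : ∀ {x : Γ(Y, U)}, algebraMap _ B x = 0 → ∃ n : ℕ, g ^ n * x = 0 := fun h =>
    exists_pow_mul_eq_zero hU (Y.basicOpen_le g) rfl h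
  have hr' : algebraMap _ B r ≠ 0 := fun h => by
    obtain ⟨n, hn⟩ := hz h
    exact h1 n hn
  have : Nontrivial B := ⟨_, _, hr'⟩
  have hg : IsUnit (algebraMap _ B g) := IsLocalization.Away.algebraMap_isUnit g
  have : NoZeroDivisors B := ⟨fun {x y} hxy => by
    have hs : ∀ x : B, ∃ (n : ℕ) (a : Γ(Y, U)), algebraMap _ B a = algebraMap _ B g ^ n * x :=
      exists_resO_eq hU (Y.basicOpen_le g) rfl
    obtain ⟨n, a, ha⟩ := hs x
    obtain ⟨m, b, hb⟩ := hs y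
    have h3 : algebraMap _ B (a * b) = 0 := by
      rw [map_mul, ha, hb, mul_mul_mul_comm, hxy, mul_zero]
    have h4 : ∀ {a : Γ(Y, U)} {x : B} {n : ℕ}, algebraMap _ B a = algebraMap _ B g ^ n * x →
        (∃ n : ℕ, g ^ n * a = 0) → x = 0 := fun {a x n} ha ⟨m, hm⟩ => by
      have h5 := congrArg (algebraMap _ B) hm
      rwa [map_mul, map_zero, map_pow, (hg.pow m).mul_right_eq_zero, ha,
        (hg.pow n).mul_right_eq_zero] at h5
    exact (h2 a b (hz h3)).imp (h4 ha) (h4 hb)⟩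
  have : IsDomain B := {}
  have : IsNoetherianRing B := IsLocalization.isNoetherianRing (Submonoid.powers g) B inferInstance
  have : IsJacobsonRing B := isJacobsonRing_localization g
  refine ⟨g, hr', (isField_or_exists_isCoprime B).symm.imp_right fun h => ?_⟩
  have := Ring.isField_iff_isSimpleOrder_ideal.1 h
  have h3 : ∀ p q : PrimeSpectrum B, p = q := fun p q => by
    have h4 : ∀ p : PrimeSpectrum B, p.asIdeal = ⊥ := fun p =>
      (IsSimpleOrder.eq_bot_or_eq_top p.asIdeal).resolve_right p.2.ne_top
    exact PrimeSpectrum.ext ((h4 p).trans (h4 q).symm)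
  have h5 := (hU.basicOpen g).range_fromSpec
  obtain ⟨p⟩ : Nonempty (PrimeSpectrum B) := inferInstance
  refine ⟨(hU.basicOpen g).fromSpec p, h5.symm.trans (Set.eq_singleton_iff_unique_mem.2
    ⟨⟨p, rfl⟩, ?_⟩)⟩
  rintro _ ⟨q, rfl⟩
  exact congrArg _ (h3 q p)

end Scheme
end DGJet

/-! ### The structure sheaf of the dg-scheme -/

namespace DGJet

/-- The generators of `S_R(E[1])` of a given degree, as a linear map. -/
noncomputable def GSym.genLinear (R : Type u) [CommRing R] {M : ℕ → Type u}
    [∀ n, AddCommGroup (M n)] [∀ n, Module R (M n)] (n : ℕ) : M n →ₗ[R] GSym R M where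
  toFun x := gen R ⟨n, x⟩
  map_add' := gen_add R M n
  map_smul' := gen_smul R M n

section Scheme
open CategoryTheory Opposite
variable {Y : Scheme.{u}} {E : ℕ → Y.Modules} {Q : Differential E}

lemma resS_gen {U V : Y.Opens} (h : V ≤ U) (n : ℕ) (x : Γ(E n, U)) :
    resS E h (GSym.gen _ ⟨n, x⟩) = GSym.gen _ ⟨n, resM (E n) h x⟩ := GSym.map_gen _ _ _

lemma resS_smul {U V : Y.Opens} (h : V ≤ U) (r : Γ(Y, U)) (a : SymE E U) :
    resS E h (r • a) = resO h r • resS E h a := GSym.map_smul _ _ _ _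

lemma resS_algebraMap {U V : Y.Opens} (h : V ≤ U) (r : Γ(Y, U)) :
    resS E h (algebraMap _ _ r) = algebraMap _ _ (resO h r) := GSym.map_algebraMap _ _ _

/-- A vector field on `S_{O_Y}(E[1])` may be prescribed on the generators. -/
lemma exists_tan {U : Y.affineOpens} {p : ℤ}
    (θ : ∀ (V : Below U) n, Γ(E n, V.1.1) →ₗ[Γ(Y, V.1.1)] SymE E V.1.1)
    (hθ : ∀ V n x, θ V n x ∈ GSym.gr Γ(Y, V.1.1) (fun n => Γ(E n, V.1.1)) (genDeg n + p))
    (hres : ∀ (V W : Below U) (h : W.1 ≤ V.1) n x,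
      θ W n (resM (E n) h x) = resS E h (θ V n x)) :
    ∃ D : (structureSheaf E Q).Tan U p, ∀ (V : Below U) n (x : Γ(E n, V.1.1)),
      D.1 V (GSym.gen Γ(Y, V.1.1) ⟨n, x⟩ : SymE E V.1.1) = θ V n x := by
  choose D h1 h2 h3 using fun V => GSym.exists_derivation (θ V) (hθ V)
  have h0 : ∀ (V : Below U) (r : Γ(Y, V.1.1)), D V (algebraMap _ _ r) = 0 := fun V r => by
    have h := h3 V 0 1 SetLike.GradedOne.one_mem 1
    rw [mul_one, mul_one, one_mul, mul_zero, Int.negOnePow_zero, one_smul, left_eq_add] at h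
    rw [Algebra.algebraMap_eq_smul_one, map_smul, h, smul_zero]
  refine ⟨⟨D, fun V W h a => ?_, h2, fun V i a b ha => h3 V i a ha b⟩, h1⟩
  refine GSym.derivation_ext (p := p) (resS E h)
    (D := (D W).toAddMonoidHom.comp (resS E h).toAddMonoidHom)
    (D' := (resS E h).toAddMonoidHom.comp (D V).toAddMonoidHom) (fun i a ha b => ?_)
    (fun i a ha b => ?_) (fun r => ?_) (fun r => ?_) (fun q => ?_) a
  · change D W (resS E h (a * b)) = _
    rw [map_mul]
    exact h3 W i _ (GSym.map_mem _ _ ha) _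
  · change resS E h (D V (a * b)) = _
    rw [h3 V i a ha, map_add, map_sign (resS E h), map_mul, map_mul]
    rfl
  · change D W (resS E h _) = 0
    rw [resS_algebraMap, h0]
  · change resS E h (D V _) = 0
    rw [h0, map_zero]
  · change D W (resS E h _) = resS E h (D V _)
    obtain ⟨n, x⟩ := q
    rw [resS_gen, h1, h1, hres]

/-- The sections of `E m`, as generators of the graded algebra `S_{O_Y}(E[1])`. -/
def symGen (E : ℕ → Y.Modules) (U : Y.affineOpens) (m : ℕ) : Set (SymE E U.1) :=
  Set.range fun x : Γ(E m, U.1) => GSym.gen Γ(Y, U.1) ⟨m, x⟩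

/-- The coordinate derivations are the extensions of the functionals of dual bases of the `E m`. -/
lemma nonempty_frame (hE : ∀ n, IsLocallyFree (E n)) (U : Y.affineOpens) :
    Nonempty (Frame (structureSheaf E Q) (symGen E) U) := by
  choose J e c hc hs using fun m : ℕ => (hE m).exists_frame U.2
  let c' (m : ℕ) (j : Fin (J m)) (V : Below U) (m' : ℕ) :
      Γ(E m', V.1.1) →ₗ[Γ(Y, V.1.1)] SymE E V.1.1 :=
    if h : m = m' then h ▸ Algebra.linearMap _ _ ∘ₗ c m ⟨V.1.1, V.2⟩ j else 0
  have h1 : ∀ (m : ℕ) j V x, c' m j V m x = algebraMap _ (SymE E V.1.1) (c m ⟨V.1.1, V.2⟩ j x) :=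
    fun m j V x => by simp only [c', dif_pos]; rfl
  have h2 : ∀ (m : ℕ) j V m' x, m' ≠ m → c' m j V m' x = 0 := fun m j V m' x h => by
    simp only [c', dif_neg h.symm]; rfl
  have h3 : ∀ (m : ℕ) j, ∃ D : (structureSheaf E Q).Tan U ((m : ℤ) + 1),
      ∀ (V : Below U) n (x : Γ(E n, V.1.1)),
        D.1 V (GSym.gen Γ(Y, V.1.1) ⟨n, x⟩ : SymE E V.1.1) = c' m j V n x := fun m j => by
    refine exists_tan _ (fun V n x => ?_) fun V W h n x => ?_
    · by_cases hn : n = m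
      · subst hn
        rw [h1]
        have e : genDeg n + ((n : ℤ) + 1) = 0 := by rw [genDeg]; ring
        rw [e]
        exact SetLike.algebraMap_mem_graded _ _
      · rw [h2 _ _ _ _ _ hn]
        exact zero_mem _
    · by_cases hn : n = m
      · subst hn
        rw [h1, h1, resS_algebraMap, hc n ⟨V.1.1, V.2⟩ ⟨W.1.1, W.2⟩ h]
      · rw [h2 _ _ _ _ _ hn, h2 _ _ _ _ _ hn, map_zero]
  choose D hD using h3
  refine ⟨⟨J, fun m j => (GSym.gen Γ(Y, U.1) ⟨m, e m j⟩ : SymE E U.1), fun m j => ⟨e m j, rfl⟩, D,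
    ?_, ?_, ?_⟩⟩
  · rintro V m m' j hm _ ⟨x, rfl⟩
    exact (hD m j V m' x).trans (h2 m j V m' x hm)
  · rintro V m m' j _ ⟨x, rfl⟩
    by_cases hm : m' = m
    · subst hm
      exact ⟨_, (hD m' j V m' x).trans (h1 m' j V x)⟩
    · exact ⟨0, (hD m j V m' x).trans ((h2 m j V m' x hm).trans (map_zero _).symm)⟩
  · rintro V m _ ⟨x, rfl⟩
    have h4 : ∀ j, c' m j V m x * resS E V.2 (GSym.gen _ ⟨m, e m j⟩) =
        GSym.genLinear Γ(Y, V.1.1) (M := fun n => Γ(E n, V.1.1)) m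
          (c m ⟨V.1.1, V.2⟩ j x • resM (E m) V.2 (e m j)) := fun j => by
      rw [map_smul, Algebra.smul_def, ← h1, resS_gen]
      rfl
    refine (Finset.sum_congr rfl fun j _ => (congrArg (fun a : SymE E V.1.1 =>
      a * resS E V.2 (GSym.gen _ ⟨m, e m j⟩)) (hD m j V m x)).trans (h4 j)).trans ?_
    rw [← map_sum]
    exact congrArg (GSym.genLinear Γ(Y, V.1.1) (M := fun n => Γ(E n, V.1.1)) m)
      (hs m ⟨V.1.1, V.2⟩ x)

/-- The coefficients of a vector field may be rescaled, by different functions for different `E m`,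
because a vector field is prescribed by its values on the generators. -/
lemma exists_scale {U : Y.affineOpens} {p : ℤ} (c : ℕ → Γ(Y, U.1))
    (D : (structureSheaf E Q).Tan U p) : ∃ D' : (structureSheaf E Q).Tan U p,
      ∀ (V : Below U) m, ∀ g ∈ symGen E V.1 m,
        D'.1 V g = (structureSheaf E Q).resR V.2 (c m) • D.1 V g := by
  let L (V : Below U) : SymE E V.1.1 →ₗ[Γ(Y, V.1.1)] SymE E V.1.1 := D.1 V
  obtain ⟨D', h⟩ := exists_tan (Q := Q) (U := U) (p := p)
    (fun V n => resO V.2 (c n) • L V ∘ₗ GSym.genLinear Γ(Y, V.1.1) (M := fun n => Γ(E n, V.1.1)) n)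
    (fun V n x => Submodule.smul_mem _ _ (D.2.2.1 V _ _
      (GSym.gen_mem Γ(Y, V.1.1) (fun n => Γ(E n, V.1.1)) ⟨n, x⟩)))
    (fun V W h n x => by
      change resO W.2 (c n) • L W (GSym.gen _ ⟨n, resM (E n) h x⟩) =
        resS E h (resO V.2 (c n) • L V (GSym.gen _ ⟨n, x⟩))
      rw [resS_smul, resO_trans, ← resS_gen]
      exact congrArg (resO W.2 (c n) • ·) (D.2.1 V W h _))
  refine ⟨D', ?_⟩
  rintro V m _ ⟨x, rfl⟩
  exact h V m x

lemma exists_symGen_weight (U : Y.affineOpens) (c : ℕ → Γ(Y, U.1)) :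
    ∃ W : SymE E U.1 →ₗ[Γ(Y, U.1)] SymE E U.1, ∀ l : List (Σ m, symGen E U m),
      W (l.map fun p => (p.2 : SymE E U.1)).prod =
        c l.length • (l.map fun p => (p.2 : SymE E U.1)).prod := by
  obtain ⟨W, h⟩ := GSym.exists_weight (M := fun n => Γ(E n, U.1)) c
  refine ⟨W, fun l => ?_⟩
  have h1 := h (l.map fun p => ⟨p.1, p.2.2.choose⟩)
  rw [List.map_map, List.length_map] at h1
  have h2 : (GSym.gen Γ(Y, U.1) ∘ fun p : (Σ m, symGen E U m) => ⟨p.1, p.2.2.choose⟩) =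
      fun p => (p.2 : SymE E U.1) := funext fun p => p.2.2.choose_spec
  rwa [h2] at h1

/-- Functions are determined by their restrictions to the thin open sets. The hypothesis on the
isolated points of `Y` enters here: the functions on an open set that consists of one point form a
field, and only the vanishing of almost all `E n` makes it thin. -/
lemma eq_zero_of_thin {k : Type u} [Field k] (f : Y ⟶ Spec (.of k)) [LocallyOfFiniteType f]
    [AlgebraicGeometry.IsReduced Y]
    (hfin : ∀ (y : Y) (hy : IsOpen ({y} : Set Y)),
      ∃ N, ∀ n ≥ N, Subsingleton Γ(E n, ⟨{y}, hy⟩))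
    {U : Y.affineOpens} (r : Γ(Y, U.1))
    (h : ∀ (V : Y.affineOpens) (h : V ≤ U), Thin (structureSheaf E Q) (symGen E) V →
      resO h r = 0) : r = 0 := by
  by_contra hr
  obtain ⟨g, h1, h2⟩ := exists_basicOpen_resO_ne_zero f U.2 hr
  refine h1 (h ⟨Y.basicOpen g, U.2.basicOpen g⟩ (Y.basicOpen_le g) (h2.imp_right ?_))
  rintro ⟨y, hy⟩
  have hy' : IsOpen ({y} : Set Y) := hy ▸ (Y.basicOpen g).2
  obtain ⟨N, hN⟩ := hfin y hy'
  refine ⟨N, fun V hV m hm a ha => ?_⟩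
  have : Subsingleton Γ(E m, V.1) := by
    have hV' : (V.1 : Set Y) ⊆ {y} := hy ▸ hV
    rcases Set.subset_singleton_iff_eq.1 hV' with h | h
    · exact ⟨fun x x' => resM_ext (V := fun i : PEmpty.{u + 1} => i.elim) (fun i => i.elim)
        (fun z hz => absurd (show z ∈ (V.1 : Set Y) from hz) (by rw [h]; exact id)) _
        fun i => i.elim⟩
    · have e : V.1 = ⟨{y}, hy'⟩ := TopologicalSpace.Opens.ext h
      rw [e]
      exact hN m hm
  obtain ⟨x, rfl⟩ := ha
  rw [Subsingleton.elim x 0]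
  exact map_zero (GSym.genLinear Γ(Y, V.1) (M := fun n => Γ(E n, V.1)) m)

/-- In characteristic zero, `S_{O_Y}(E[1])` has all properties on which the comparison of formal
functions and jets depends. -/
lemma nonempty_symStructure {k : Type u} [Field k] [CharZero k] (f : Y ⟶ Spec (.of k))
    [LocallyOfFiniteType f] [AlgebraicGeometry.IsReduced Y] (hE : ∀ n, IsLocallyFree (E n))
    (hfin : ∀ (y : Y) (hy : IsOpen ({y} : Set Y)),
      ∃ N, ∀ n ≥ N, Subsingleton Γ(E n, ⟨{y}, hy⟩)) :
    Nonempty (SymStructure (structureSheaf E Q)) := by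
  refine ⟨⟨symGen E, ?_, fun {U d s} hs => ?_,
    fun U => GSym.algebraMap_injective Γ(Y, U.1) (fun n => Γ(E n, U.1)),
    fun U n hn => ?_, exists_symGen_weight, exists_scale, fun U => (nonempty_frame hE U).some,
    fun {U} r h => eq_zero_of_thin f hfin r h⟩⟩
  · rintro U m _ ⟨x, rfl⟩
    exact GSym.gen_mem Γ(Y, U.1) (fun n => Γ(E n, U.1)) ⟨m, x⟩
  · refine Submodule.span_mono ?_ hs
    rintro _ ⟨l, rfl, rfl⟩
    refine ⟨l.map fun p => ⟨p.1, _, p.2, rfl⟩, ?_, ?_⟩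
    · rw [List.map_map]; rfl
    · rw [List.map_map]; rfl
  · obtain ⟨φ, -⟩ := exists_finiteType f U.2
    have h := (IsUnit.mk0 (n : k) (Nat.cast_ne_zero.2 hn)).map φ
    rwa [map_natCast] at h

end Scheme
end DGJet

theorem mainTheorem12 {k : Type u} [Field k] [IsAlgClosed k] [CharZero k] {Y : Scheme.{u}}
    (f : Y ⟶ Spec (.of k)) [LocallyOfFiniteType f] [AlgebraicGeometry.IsReduced Y]
    (E : ℕ → Y.Modules) (hE : ∀ n, IsLocallyFree (E n))
    (hfin : ∀ (y : Y) (hy : IsOpen ({y} : Set Y)),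
      ∃ N, ∀ n ≥ N, Subsingleton Γ(E n, ⟨{y}, hy⟩))
    (Q : Differential E) :
    ∃ Φ : ∀ (U : Y.affineOpens) (n : ℤ),
        (structureSheaf E Q).Formal U n ≃+ (structureSheaf E Q).Jet U n,
      (∀ (U : Y.affineOpens) (m n : ℤ) (x : (structureSheaf E Q).Formal U m)
        (y : (structureSheaf E Q).Formal U n),
        Φ U (m + n) (Formal.mul x y) = Jet.mul (Φ U m x) (Φ U n y)) ∧
      (∀ (U : Y.affineOpens) (i j : ℤ) (a : (structureSheaf E Q).gr U i)
        (b : (structureSheaf E Q).gr U j),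
        Φ U (i + j) (Formal.ofTensor a b) = Jet.ofTensor a b) ∧
      (∀ (U : Y.affineOpens) (n : ℤ) (x : (structureSheaf E Q).Formal U n),
        Φ U (n + 1) (Formal.diff x) = Jet.diff (Φ U n x)) ∧
      (∀ (U V : Y.affineOpens) (h : V ≤ U) (n : ℤ) (x : (structureSheaf E Q).Formal U n),
        Φ V n (Formal.res h x) = Jet.res h (Φ U n x)) := by
  obtain ⟨S⟩ := nonempty_symStructure (Q := Q) f hE hfin
  exact exists_formal_equiv_jet S
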